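/- **Setting.** Let $K,p\ge 0$ be integers, $h=(h_0,\dots,h_K)$ and $\alpha=(\alpha_0,\dots,\alpha_K)$ real vectors, $P_X>0$ and $\sigma>0$. The Gaussian intersymbol interference channel maps $x\in\mathbb R^n$ to $y_t=\sum_{i=0}^K h_i x_{t-i}+w_t$, $1\le t\le n$, where $x_s=0$ for $s\le 0$ and the $w_t$ are i.i.d. $N(0,\sigma^2)$, independent of the input. A code of block length $n$ consists of $M$ equiprobable codewords $x_1,\dots,x_M\in\mathbb R^n$ with average power $\frac1M\sum_{i}\sum_{t} x_{i,t}^2\le nP_X$. The decoder picks the message $i$ that maximizes $\log V(y|x_i)=-\frac n2\log(2\pi\sigma^2)-\frac1{2\sigma^2}\sum_{t=1}^n\bigl(y_t-\sum_{l=0}^K\alpha_l x_{i,t-l}\bigr)^2$ (a tie with a wrong message counts as an error). A rate $R$ is achievable if for every $\delta>0$ there are codes of every block length $n\ge1$ with $M\ge e^{n(R-\delta)}$ whose error probability tends to $0$ as $n\to\infty$. The mismatch capacity $C^{\mathrm{Mis}}_{\mathrm{ISI}}$ is the supremum of the achievable rates. **The rate formula.** Let $\Gamma$ be the set of all $\gamma=(\gamma_0,\dots,\gamma_p)\in\mathbb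 R^{p+1}$ with $\gamma_0=P_X$ for which the Toeplitz matrix $(\gamma_{|i-j|})_{0\le i,j\le p}$ is positive definite. For $\gamma\in\Gamma$ put $\gamma_{-m}=\gamma_m$, let $(\varphi_1,\dots,\varphi_p)$ be the solution of the Yule–Walker equations $\gamma_m=\sum_{k=1}^p\varphi_k\gamma_{m-k}$, $1\le m\le p$, and define $\gamma_m$ for $m>p$ by the same recursion. Put $A(\nu)=\sum_{k=0}^K\alpha_ke^{-jk\nu}$, $H(\nu)=\sum_{k=0}^Kh_ke^{-jk\nu}$, $\Phi(\nu)=\sum_{k=1}^p\varphi_ke^{-jk\nu}$, $$\eta^2=P_X\Bigl[\frac1{2\pi}\int_0^{2\pi}\frac{d\nu}{|1-\Phi(\nu)|^2}\Bigr]^{-1},\qquad S_X(\nu)=\frac{\eta^2}{|1-\Phi(\nu)|^2},\qquad S_Y(\nu)=|H(\nu)|^2S_X(\nu)+\sigma^2 .$$ Let $\Pi_m(\alpha)=\sum_{k=0}^{K-m}\alpha_k\alpha_{k+m}$ for $1\le m\le K$, write $p\wedge K=\min(p,K)$ and $p\vee K=\max(p,K)$, and let $$\mathcal W=\Bigl\{\omega\in(0,\infty)^{p+2}:\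 \omega_0\ge\sum_{i=1}^p\omega_i+\omega_{p+1}\sum_{m=1+p\wedge K}^K|\Pi_m(\alpha)|\Bigr\},$$ $$g_\omega(\nu)=\sum_{k=0}^p\omega_k\cos(k\nu)+\omega_{p+1}\sum_{k=1+p\wedge K}^K\Pi_k(\alpha)\cos(k\nu),$$ $$F_\gamma(\omega)=-\frac1{4\pi}\int_0^{2\pi}\log g_\omega(\nu)\,d\nu+\frac{\omega_{p+1}^2}{8\pi}\int_0^{2\pi}\frac{S_Y(\nu)|A(\nu)|^2}{g_\omega(\nu)}\,d\nu-\omega_{p+1}\Bigl[\sum_{k=0}^K\sum_{i=0}^K\alpha_kh_i\gamma_{k-i}-\sum_{l=1+p\wedge K}^K\Pi_l(\alpha)\gamma_l\Bigr]+\sum_{k=0}^p\omega_k\gamma_k ,$$ where the second integral is $+\infty$ if it diverges, and $$\bar I_2(\alpha,\gamma)=\tfrac12\log(2e\eta^2)-\inf_{\omega\in\mathcal W}F_\gamma(\omega).$$ **Theorem.** 1. $C^{\mathrm{Mis}}_{\mathrm{ISI}}\ \ge\ \sup_{\gamma\in\Gamma}\bar I_2(\alpha,\gamma)$. 2. For every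 $\gamma\in\Gamma$ the minimization defining $\bar I_2(\alpha,\gamma)$ is convex: $\mathcal W$ is a convex set and $F_\gamma:\mathcal W\to(-\infty,\infty]$ is a convex function. 3. The rates are achieved by the fixed composition ensemble. For $\varepsilon>0$ let $\mathcal T^n_\varepsilon(\gamma)=\{x\in\mathbb R^n:\ |\frac1n\sum_{t=1}^nx_tx_{t-k}-\gamma_k|<\varepsilon,\ 0\le k\le p\}$, with $x_s=0$ for $s\le0$. For every $\gamma\in\Gamma$ and every real $R<\bar I_2(\alpha,\gamma)$ there is $\varepsilon_0>0$ such that for every $\varepsilon\in(0,\varepsilon_0)$ the set $\mathcal T^n_\varepsilon(\gamma)$ has positive volume for all large $n$, and, when $\lceil e^{nR}\rceil$ codewords are drawn independently and uniformly from $\mathcal T^n_\varepsilon(\gamma)$ and each is followed by $p\vee K$ zeros (total block length $n+p\vee K$), the error probability averaged over this ensemble tends to $0$ as $n\to\infty$. -/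

import Mathlib

open MeasureTheory ProbabilityTheory Filter Topology

noncomputable section

namespace ISI

/-! ### Channel, decoding metric, codes, mismatch capacity -/

/-- The entry `a_k` of a finite vector, read as `0` outside its index range. -/
def zeroExt {m : ℕ} (a : Fin m → ℝ) (k : ℕ) : ℝ :=
  if hk : k < m then a ⟨k, hk⟩ else 0

/-- `x_{t-i}` for a block `x` of length `n`, with zeros before the beginning of the block. -/
def delay {n : ℕ} (x : Fin n → ℝ) (i : ℕ) (t : Fin n) : ℝ :=
  if i ≤ (t : ℕ) then x ⟨(t : ℕ) - i, lt_of_le_of_lt (Nat.sub_le _ _) t.2⟩ else 0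

/-- `∑_{i=0}^K a_i x_{t-i}`. -/
def filterOut {K n : ℕ} (a : Fin (K + 1) → ℝ) (x : Fin n → ℝ) (t : Fin n) : ℝ :=
  ∑ i : Fin (K + 1), a i * delay x i t

/-- The law `W(· | x)` of the output block `y_t = ∑ h_i x_{t-i} + w_t`, where the `w_t` are
independent centred Gaussians of variance `σ²`. -/
def channelLaw {K n : ℕ} (h : Fin (K + 1) → ℝ) (σ : ℝ) (x : Fin n → ℝ) :
    Measure (Fin n → ℝ) :=
  Measure.pi fun t => gaussianReal (filterOut h x t) (Real.toNNReal (σ ^ 2))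

/-- The decoding metric `log V(y | x)` with the filter `α`. -/
def logV {K n : ℕ} (α : Fin (K + 1) → ℝ) (σ : ℝ) (y x : Fin n → ℝ) : ℝ :=
  -((n : ℝ) / 2) * Real.log (2 * Real.pi * σ ^ 2)
    - 1 / (2 * σ ^ 2) * ∑ t, (y t - filterOut α x t) ^ 2

/-- Error probability of the code `c` with `M` equiprobable messages under maximization of
`log V`. A tie with a wrong message counts as an error. -/
def errorProb {K n M : ℕ} (h α : Fin (K + 1) → ℝ) (σ : ℝ) (c : Fin M → Fin n → ℝ) : ENNReal :=
  (∑ i, channelLaw h σ (c i) {y | ∃ j, j ≠ i ∧ logV α σ y (c i) ≤ logV α σ y (c j)}) / M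

/-- `R` is achievable under the average power constraint `∑_t E X_t² ≤ n P`, where the expectation
is over the uniformly distributed message. -/
def Achievable {K : ℕ} (h α : Fin (K + 1) → ℝ) (P σ R : ℝ) : Prop :=
  ∀ δ : ℝ, 0 < δ → ∃ (M : ℕ → ℕ) (c : ∀ n, Fin (M n) → Fin n → ℝ),
    (∀ n : ℕ, 1 ≤ n →
      Real.exp (n * (R - δ)) ≤ M n ∧ (∑ t, (∑ i, c n i t ^ 2) / M n) ≤ n * P) ∧
    Tendsto (fun n => errorProb h α σ (c n)) atTop (𝓝 0)

/-- The mismatch capacity. -/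
def mismatchCapacity {K : ℕ} (h α : Fin (K + 1) → ℝ) (P σ : ℝ) : EReal :=
  sSup {r : EReal | ∃ R : ℝ, r = R ∧ Achievable h α P σ R}

/-! ### Autocorrelation vectors and the autoregressive spectrum -/

/-- The symmetric Toeplitz matrix `{γ_{|i-j|}}` of size `m`. -/
def toeplitz {p : ℕ} (γ : Fin (p + 1) → ℝ) (m : ℕ) : Matrix (Fin m) (Fin m) ℝ :=
  Matrix.of fun i j => zeroExt γ ((i : ℤ) - (j : ℤ)).natAbs

/-- The set `Γ` of admissible autocorrelation vectors `(γ_0, …, γ_p)`. -/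
def admissible (p : ℕ) (P : ℝ) : Set (Fin (p + 1) → ℝ) :=
  {γ | γ 0 = P ∧ (toeplitz γ (p + 1)).PosDef}

/-- The solution `(φ_1, …, φ_p)` of the Yule-Walker equations
`γ_m = ∑_{k=1}^p φ_k γ_{m-k}`, `m = 1, …, p`; `φ_{k+1}` is stored at index `k`. -/
def yuleWalker {p : ℕ} (γ : Fin (p + 1) → ℝ) : Fin p → ℝ :=
  (toeplitz γ p)⁻¹.mulVec fun m => γ m.succ

/-- The sequence `γ_m`, `m ≥ 0`, continued beyond lag `p` by `γ_m = ∑_{k=1}^p φ_k γ_{m-k}`. -/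
def autocov {p : ℕ} (γ : Fin (p + 1) → ℝ) (m : ℕ) : ℝ :=
  if hm : m < p + 1 then γ ⟨m, hm⟩
  else ∑ k : Fin p, yuleWalker γ k * autocov γ (m - ((k : ℕ) + 1))
termination_by m
decreasing_by have := k.2; omega

/-- The Fourier transform `∑_{k=0}^K a_k e^{-jkν}`. -/
def fourier {K : ℕ} (a : Fin (K + 1) → ℝ) (ν : ℝ) : ℂ :=
  ∑ k : Fin (K + 1), (a k : ℂ) * Complex.exp (-(Complex.I * (k : ℕ) * ν))

/-- `|1 - Φ(ν)|²`, where `Φ` is the Fourier transform of `(0, φ_1, …, φ_p)`. -/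
def arGain {p : ℕ} (γ : Fin (p + 1) → ℝ) (ν : ℝ) : ℝ :=
  ‖1 - fourier (Fin.cons 0 (yuleWalker γ) : Fin (p + 1) → ℝ) ν‖ ^ 2

/-- `η² = P_X [ (1/2π) ∫_0^{2π} dν / |1 - Φ(ν)|² ]⁻¹`, with `P_X = γ_0`. -/
def etaSq {p : ℕ} (γ : Fin (p + 1) → ℝ) : ℝ :=
  γ 0 * (1 / (2 * Real.pi) * ∫ ν in (0 : ℝ)..(2 * Real.pi), 1 / arGain γ ν)⁻¹

/-- The input spectrum `S_X`. -/
def specX {p : ℕ} (γ : Fin (p + 1) → ℝ) (ν : ℝ) : ℝ :=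
  etaSq γ / arGain γ ν

/-- The output spectrum `S_Y`. -/
def specY {K p : ℕ} (h : Fin (K + 1) → ℝ) (σ : ℝ) (γ : Fin (p + 1) → ℝ) (ν : ℝ) : ℝ :=
  ‖fourier h ν‖ ^ 2 * specX γ ν + σ ^ 2

/-! ### The rate formula -/

/-- `Π_m(α) = ∑_{k=0}^{K-m} α_k α_{k+m}`, used for `1 ≤ m ≤ K`. -/
def tapCorr {K : ℕ} (α : Fin (K + 1) → ℝ) (m : ℕ) : ℝ :=
  ∑ k ∈ Finset.range (K + 1 - m), zeroExt α k * zeroExt α (k + m)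

/-- The set `𝒲` of vectors `(ω_0, …, ω_{p+1})`. -/
def dualSet {K : ℕ} (p : ℕ) (α : Fin (K + 1) → ℝ) : Set (Fin (p + 2) → ℝ) :=
  {ω | (∀ k, 0 < ω k) ∧
    (∑ i : Fin p, ω i.succ.castSucc)
      + ω (Fin.last (p + 1)) * ∑ m ∈ Finset.Icc (1 + min p K) K, |tapCorr α m| ≤ ω 0}

/-- `g_ω(ν)`. -/
def gOmega {K p : ℕ} (α : Fin (K + 1) → ℝ) (ω : Fin (p + 2) → ℝ) (ν : ℝ) : ℝ :=
  (∑ k : Fin (p + 1), ω k.castSucc * Real.cos ((k : ℕ) * ν))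
    + ω (Fin.last (p + 1)) *
      ∑ k ∈ Finset.Icc (1 + min p K) K, tapCorr α k * Real.cos (k * ν)

/-- The function minimized over `𝒲`. The integral of the nonnegative function `S_Y |A|² / g_ω`
takes the value `+∞` if it diverges, which can happen when `g_ω` has a zero. -/
def objective {K p : ℕ} (h α : Fin (K + 1) → ℝ) (σ : ℝ) (γ : Fin (p + 1) → ℝ)
    (ω : Fin (p + 2) → ℝ) : EReal :=
  ((-(1 / (4 * Real.pi)) * (∫ ν in (0 : ℝ)..(2 * Real.pi), Real.log (gOmega α ω ν))
      - ω (Fin.last (p + 1)) *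
        ((∑ k : Fin (K + 1), ∑ i : Fin (K + 1),
            α k * h i * autocov γ (((k : ℕ) : ℤ) - ((i : ℕ) : ℤ)).natAbs)
          - ∑ l ∈ Finset.Icc (1 + min p K) K, tapCorr α l * autocov γ l)
      + ∑ k : Fin (p + 1), ω k.castSucc * γ k : ℝ) : EReal)
    + ((ENNReal.ofReal (ω (Fin.last (p + 1)) ^ 2 / (8 * Real.pi)) *
        ∫⁻ ν in Set.Icc (0 : ℝ) (2 * Real.pi),
          ENNReal.ofReal (specY h σ γ ν * ‖fourier α ν‖ ^ 2) / ENNReal.ofReal (gOmega α ω ν) :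
        ENNReal) : EReal)

/-- The rate `Ī₂(α, γ)`, in nats. -/
def rateI2 {K p : ℕ} (h α : Fin (K + 1) → ℝ) (σ : ℝ) (γ : Fin (p + 1) → ℝ) : EReal :=
  ((1 / 2 * Real.log (2 * Real.exp 1 * etaSq γ) : ℝ) : EReal)
    - ⨅ ω ∈ dualSet p α, objective h α σ γ ω

/-! ### The fixed composition ensemble -/

/-- The type class `𝒯^n_ε(γ)`. -/
def typeClass {p : ℕ} (n : ℕ) (ε : ℝ) (γ : Fin (p + 1) → ℝ) : Set (Fin n → ℝ) :=
  {x | ∀ k : Fin (p + 1), |1 / (n : ℝ) * (∑ t, x t * delay x k t) - γ k| < ε}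

/-- The block `x` followed by `L` zeros. -/
def zeroPad {n : ℕ} (L : ℕ) (x : Fin n → ℝ) : Fin (n + L) → ℝ :=
  Fin.append x 0

/-- Average error probability when `M` codewords are drawn independently and uniformly from
`𝒯^n_ε(γ)`, each followed by `max p K` zeros. -/
def ensembleErrorProb {K p : ℕ} (h α : Fin (K + 1) → ℝ) (σ : ℝ) (γ : Fin (p + 1) → ℝ)
    (ε : ℝ) (n M : ℕ) : ENNReal :=
  ∫⁻ c : Fin M → Fin n → ℝ, errorProb h α σ (fun i => zeroPad (max p K) (c i))
    ∂(Measure.pi fun _ : Fin M => cond volume (typeClass n ε γ))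

end ISI

end

/-! The proof is random coding on a type class. Wrong codewords are counted by volume, and both that
count and the typicality of the channel are controlled by Gaussian integrals of Toeplitz quadratic
forms.

Guard zeros make filtering an exact multiplication of transforms (`dft_filterOut_zeroPad`). Hence
all quadratic statistics are means over a period of a symbol against `‖dft x ν‖ ^ 2`, and a cosine
symbol gives an empirical lag (`toepForm_cos`). Up to terms in `y` alone and terms in the lags up to
`min p K`, which are nearly constant on a type class, the metric is a multiple of `score`
(`logV_zeroPad`). An error therefore needs either an atypical output or an independent codeword
whose score is about `n * scoreMean`.

Competitors. For nonnegative multipliers `ω`, Chernoff's inequality bounds the volume of high-score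
words in the type class by the integral over all of `ℝ^n` of a Gaussian whose quadratic part is the
Toeplitz form of `g_ω` (`volume_score_ge_le`). Its determinant is at least `exp (n * cmean (log
g_ω))`, the easy half of Szegő's theorem, which is Jensen's inequality in an eigenbasis. Its maximal
exponent is bounded by completing the square at each frequency, which produces `|A|² / g_ω` tested
against the output.

Volume of the type class. Since `1 / S_X` is a trigonometric polynomial of degree `p`, the density
of the autoregressive Gaussian process with spectrum `S_X` has an exponent that depends only on the
constrained lags. The typical set of that process gives volume at least about `exp (n / 2 * log (2πe
η²))` (`eventually_volume_typeClass_ge_exp`). Two classical facts enter: a positive definite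
Toeplitz matrix yields a prediction filter without zeros in the closed disc (`predictor_ne_zero`),
and the Fourier coefficients of `S_X` are the continued `γ_m` (`covX_eq_autocov`). Dividing the two
volumes leaves `exp (-n * (1/2 log (2e η²) - F_γ(ω)))`, which is compared with `exp (n R)`
codewords.

Typicality. In the Gaussian model the score and the output form are quadratic forms in independent
standard normals with bounded norm, so they have exponential tails around their traces; Fejér's
theorem identifies the limit of the trace of the output form. The uniform law on the type class is
dominated by this model up to `exp (O(ε n))`, so small `ε` preserves the decay
(`exists_tendsto_atypical`).

A multiplier at which `g_ω` has zeros is repaired by a small increase of `ω_0`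
(`exists_dualValue_lt`). For the capacity, shrinking `γ` slightly absorbs the tolerance `ε` in the
power (`exists_scaling`). Convexity holds because `g_ω` is affine in `ω`, the logarithm is concave,
and `u² / g` is jointly convex. -/

noncomputable section

namespace ISI

/-! ### Gaussian integrals and exponential moments of quadratic forms. -/

section GaussianIntegrals

open Matrix

variable {ι : Type*} [Fintype ι]

theorem lintegral_exp_neg_sum_mul_sq (a : ι → ℝ) (ha : ∀ i, 0 < a i) :
    ∫⁻ u : ι → ℝ, ENNReal.ofReal (Real.exp (-∑ i, a i * u i ^ 2))
      = ENNReal.ofReal (∏ i, Real.sqrt (Real.pi / a i)) := by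
  have hint : Integrable (fun u : ι → ℝ => ∏ i, Real.exp (-a i * u i ^ 2)) :=
    Integrable.fintype_prod (f := fun i v => Real.exp (-a i * v ^ 2))
      (fun i => integrable_exp_neg_mul_sq (ha i))
  have h1 : ∀ u : ι → ℝ, Real.exp (-∑ i, a i * u i ^ 2) = ∏ i, Real.exp (-a i * u i ^ 2) := by
    intro u
    rw [← Real.exp_sum, ← Finset.sum_neg_distrib]
    simp
  simp_rw [h1]
  rw [← ofReal_integral_eq_lintegral_ofReal hint
    (Eventually.of_forall fun u => Finset.prod_nonneg fun i _ => (Real.exp_pos _).le),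
    integral_fintype_prod_volume_eq_prod (fun i v => Real.exp (-a i * v ^ 2))]
  simp_rw [integral_gaussian]

/-- The standard Gaussian measure on `ℝ^ι`. -/
def stdGauss (ι : Type*) [Fintype ι] : Measure (ι → ℝ) := Measure.pi fun _ => gaussianReal 0 1

instance (ι : Type*) [Fintype ι] : IsProbabilityMeasure (stdGauss ι) := by
  unfold stdGauss; infer_instance

theorem stdGauss_eq_withDensity :
    stdGauss ι = (volume : Measure (ι → ℝ)).withDensity
      (fun x => ENNReal.ofReal ((Real.sqrt (2 * Real.pi))⁻¹ ^ Fintype.card ι *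
        Real.exp (-((1 / 2) * (x ⬝ᵥ x))))) := by
  unfold stdGauss
  refine Measure.pi_eq fun s hs => ?_
  have hfac : ∀ x : ι → ℝ, (Real.sqrt (2 * Real.pi))⁻¹ ^ Fintype.card ι *
        Real.exp (-((1 / 2) * (x ⬝ᵥ x))) = ∏ i, gaussianPDFReal 0 1 (x i) := by
    intro x
    simp only [gaussianPDFReal, Finset.prod_mul_distrib, Finset.prod_const, Finset.card_univ,
      ← Real.exp_sum, NNReal.coe_one, mul_one, sub_zero]
    congr 2
    simp only [dotProduct, Finset.mul_sum, ← Finset.sum_neg_distrib]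
    exact Finset.sum_congr rfl fun i _ => by ring
  simp_rw [hfac]
  rw [withDensity_apply _ (MeasurableSet.univ_pi hs)]
  have hind : ∀ x : ι → ℝ, (Set.univ.pi s).indicator
      (fun x => ENNReal.ofReal (∏ i, gaussianPDFReal 0 1 (x i))) x
      = ENNReal.ofReal (∏ i, (s i).indicator (gaussianPDFReal 0 1) (x i)) := by
    intro x
    by_cases hx : x ∈ Set.univ.pi s
    · rw [Set.indicator_of_mem hx]
      congr 1
      refine Finset.prod_congr rfl fun i _ => ?_
      rw [Set.indicator_of_mem (hx i trivial)]
    · rw [Set.indicator_of_notMem hx]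
      simp only [Set.mem_pi, Set.mem_univ, true_implies, not_forall] at hx
      obtain ⟨i, hi⟩ := hx
      rw [Finset.prod_eq_zero (Finset.mem_univ i) (Set.indicator_of_notMem hi _)]
      simp
  rw [← lintegral_indicator (MeasurableSet.univ_pi hs)]
  simp_rw [hind]
  have hi1 : ∀ i, Integrable ((s i).indicator (gaussianPDFReal 0 1)) :=
    fun i => (integrable_gaussianPDFReal 0 1).indicator (hs i)
  have hnn : ∀ i y, 0 ≤ (s i).indicator (gaussianPDFReal 0 1) y :=
    fun i y => Set.indicator_nonneg (fun z _ => gaussianPDFReal_nonneg 0 1 z) y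
  have hprod : Integrable (fun x : ι → ℝ => ∏ i, (s i).indicator (gaussianPDFReal 0 1) (x i)) :=
    Integrable.fintype_prod (f := fun i => (s i).indicator (gaussianPDFReal 0 1)) hi1
  rw [← ofReal_integral_eq_lintegral_ofReal hprod
    (Eventually.of_forall fun u => Finset.prod_nonneg fun i _ => hnn i _),
    integral_fintype_prod_volume_eq_prod (fun i => (s i).indicator (gaussianPDFReal 0 1)),
    ENNReal.ofReal_prod_of_nonneg (fun i _ => integral_nonneg (hnn i))]
  refine Finset.prod_congr rfl fun i _ => ?_
  rw [integral_indicator (hs i), gaussianReal_apply_eq_integral 0 one_ne_zero]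

theorem lintegral_stdGauss (f : (ι → ℝ) → ENNReal) :
    ∫⁻ x, f x ∂(stdGauss ι) = ENNReal.ofReal ((Real.sqrt (2 * Real.pi))⁻¹ ^ Fintype.card ι) *
      ∫⁻ x, ENNReal.ofReal (Real.exp (-((1 / 2) * (x ⬝ᵥ x)))) * f x := by
  have hm : Measurable (fun x : ι → ℝ => ENNReal.ofReal (Real.exp (-((1 / 2) * (x ⬝ᵥ x))))) := by
    unfold dotProduct; fun_prop
  rw [stdGauss_eq_withDensity, lintegral_withDensity_eq_lintegral_mul_non_measurable]
  · rw [← lintegral_const_mul' _ _ ENNReal.ofReal_ne_top]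
    refine lintegral_congr fun x => ?_
    simp only [Pi.mul_apply]
    rw [ENNReal.ofReal_mul (by positivity), mul_assoc]
  · unfold dotProduct; fun_prop
  · exact Eventually.of_forall fun x => ENNReal.ofReal_lt_top

variable [DecidableEq ι]

/-- Change of variables `x = C z` in a Lebesgue integral. -/
theorem lintegral_comp_mulVec (C : Matrix ι ι ℝ) (hC : C.det ≠ 0) (f : (ι → ℝ) → ENNReal) :
    ENNReal.ofReal |C.det| * ∫⁻ z, f (C *ᵥ z) = ∫⁻ x, f x := by
  have hmap := Real.map_matrix_volume_pi_eq_smul_volume_pi hC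
  let e : (ι → ℝ) ≃ₗ[ℝ] (ι → ℝ) := Matrix.toLinearEquiv' C ((Matrix.isUnit_iff_isUnit_det C).2 hC.isUnit).invertible
  let e' := e.toContinuousLinearEquiv.toHomeomorph.toMeasurableEquiv
  have he : ∀ z, e' z = C *ᵥ z := fun z => rfl
  have h1 : Measure.map e' (volume : Measure (ι → ℝ)) = ENNReal.ofReal |C.det⁻¹| • volume := by
    rw [← hmap]; rfl
  have h2 : ∫⁻ z, f (C *ᵥ z) = ∫⁻ x, f x ∂(Measure.map e' volume) := by
    rw [lintegral_map_equiv]; rfl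
  rw [h2, h1, lintegral_smul_measure, smul_eq_mul, ← mul_assoc, ← ENNReal.ofReal_mul (abs_nonneg _),
    ← abs_mul, mul_inv_cancel₀ hC]
  simp

theorem abs_det_eigenvectorUnitary {B : Matrix ι ι ℝ} (hB : B.IsHermitian) :
    |(hB.eigenvectorUnitary : Matrix ι ι ℝ).det| = 1 := by
  have h : (star (hB.eigenvectorUnitary : Matrix ι ι ℝ)) * (hB.eigenvectorUnitary : Matrix ι ι ℝ) = 1 :=
    Unitary.coe_star_mul_self _
  have h2 := congrArg Matrix.det h
  rw [Matrix.det_mul, Matrix.det_one, Matrix.star_eq_conjTranspose, Matrix.det_conjTranspose] at h2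
  simp only [star_trivial] at h2
  have h3 : |(hB.eigenvectorUnitary : Matrix ι ι ℝ).det| ^ 2 = 1 := by rw [sq_abs, sq, h2]
  nlinarith [abs_nonneg (hB.eigenvectorUnitary : Matrix ι ι ℝ).det]

theorem dotProduct_eigenvectorUnitary_mulVec {B : Matrix ι ι ℝ} (hB : B.IsHermitian) (u v : ι → ℝ) :
    ((hB.eigenvectorUnitary : Matrix ι ι ℝ) *ᵥ u) ⬝ᵥ ((hB.eigenvectorUnitary : Matrix ι ι ℝ) *ᵥ v)
      = u ⬝ᵥ v := by
  have h : ((hB.eigenvectorUnitary : Matrix ι ι ℝ))ᵀ * (hB.eigenvectorUnitary : Matrix ι ι ℝ) = 1 := by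
    have := Unitary.coe_star_mul_self hB.eigenvectorUnitary
    rwa [Matrix.star_eq_conjTranspose, Matrix.conjTranspose_eq_transpose_of_trivial] at this
  rw [Matrix.dotProduct_mulVec, Matrix.vecMul_mulVec, h, Matrix.vecMul_one]

theorem quadForm_eigenvectorUnitary_mulVec {B : Matrix ι ι ℝ} (hB : B.IsHermitian) (u : ι → ℝ) :
    ((hB.eigenvectorUnitary : Matrix ι ι ℝ) *ᵥ u) ⬝ᵥ
      (B *ᵥ ((hB.eigenvectorUnitary : Matrix ι ι ℝ) *ᵥ u))
      = ∑ i, hB.eigenvalues i * u i ^ 2 := by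
  have h1 : B * (hB.eigenvectorUnitary : Matrix ι ι ℝ)
      = (hB.eigenvectorUnitary : Matrix ι ι ℝ) * diagonal hB.eigenvalues := by
    have h := hB.spectral_theorem
    rw [Unitary.conjStarAlgAut_apply] at h
    have h' := congrArg (· * (hB.eigenvectorUnitary : Matrix ι ι ℝ)) h
    beta_reduce at h'
    rw [Matrix.mul_assoc, Unitary.coe_star_mul_self, Matrix.mul_one] at h'
    exact h'
  rw [Matrix.mulVec_mulVec, h1, ← Matrix.mulVec_mulVec, dotProduct_eigenvectorUnitary_mulVec]
  simp only [dotProduct, Matrix.mulVec_diagonal]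
  exact Finset.sum_congr rfl fun i _ => by ring

/-- Each eigenvalue is the form evaluated at a unit vector, so bounds on a quadratic form become
bounds on its eigenvalues without operator norms. -/
theorem eigenvalues_eq_quadForm {B : Matrix ι ι ℝ} (hB : B.IsHermitian) (i : ι) :
    ∃ e : ι → ℝ, e = (fun j => (hB.eigenvectorUnitary : Matrix ι ι ℝ) j i) ∧ e ⬝ᵥ e = 1 ∧
      hB.eigenvalues i = e ⬝ᵥ (B *ᵥ e) := by
  refine ⟨(hB.eigenvectorUnitary : Matrix ι ι ℝ) *ᵥ Pi.single i 1, ?_, ?_, ?_⟩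
  · ext j; simp
  · rw [dotProduct_eigenvectorUnitary_mulVec]; simp
  · rw [quadForm_eigenvectorUnitary_mulVec]
    simp [Pi.single_apply]

/-- Gaussian integral of a quadratic form `c |x|² + s xᵀ B x`. -/
theorem lintegral_exp_neg_quadForm {B : Matrix ι ι ℝ} (hB : B.IsHermitian) (c s : ℝ)
    (hpos : ∀ i, 0 < c + s * hB.eigenvalues i) :
    ∫⁻ x : ι → ℝ, ENNReal.ofReal (Real.exp (-(c * (x ⬝ᵥ x) + s * (x ⬝ᵥ (B *ᵥ x)))))
      = ENNReal.ofReal (∏ i, Real.sqrt (Real.pi / (c + s * hB.eigenvalues i))) := by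
  rw [← lintegral_exp_neg_sum_mul_sq _ hpos,
    ← lintegral_comp_mulVec (hB.eigenvectorUnitary : Matrix ι ι ℝ)
      (fun h => by have := abs_det_eigenvectorUnitary hB; rw [h] at this; simp at this),
    abs_det_eigenvectorUnitary, ENNReal.ofReal_one, one_mul]
  refine lintegral_congr fun u => ?_
  rw [dotProduct_eigenvectorUnitary_mulVec, quadForm_eigenvectorUnitary_mulVec]
  congr 3
  simp only [dotProduct, Finset.mul_sum, ← Finset.sum_add_distrib]
  exact Finset.sum_congr rfl fun i _ => by ring

/-- The left side is the exponential moment of `u * Z ^ 2` for a standard normal `Z`. The bound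
keeps the mean `u` exact and pays only a quadratic error, which is what makes the later tail bounds
exponential. -/
theorem inv_sqrt_one_sub_le {u : ℝ} (hu : |u| ≤ 1 / 4) :
    Real.sqrt (1 / (1 - 2 * u)) ≤ Real.exp (u + 2 * u ^ 2) := by
  have hu' := abs_le.1 hu
  have h1 : 0 < 1 - 2 * u := by linarith
  rw [Real.sqrt_le_left (Real.exp_pos _).le, ← Real.exp_nat_mul, div_le_iff₀ h1]
  -- For `u ≤ 0` the linear bound on `exp` suffices, because `(1 + 2u + 4u²)(1 - 2u) = 1 - 8u³`. For
  -- `u > 0` the quadratic term of `exp` is needed.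
  have h2 : 1 + (2 * u + 4 * u ^ 2) + (2 * u + 4 * u ^ 2) ^ 2 / 2 ≤ Real.exp (2 * u + 4 * u ^ 2) ∨
      u ≤ 0 := by
    by_cases h : 0 ≤ u
    · exact Or.inl (Real.quadratic_le_exp_of_nonneg (by positivity))
    · exact Or.inr (by linarith)
  have h3 := Real.add_one_le_exp (2 * u + 4 * u ^ 2)
  have h4 : Real.exp (((2 : ℕ) : ℝ) * (u + 2 * u ^ 2)) = Real.exp (2 * u + 4 * u ^ 2) := by
    congr 1; push_cast; ring
  rw [h4]
  have h5 : 1 + (2 * u + 4 * u ^ 2) ≤ Real.exp (2 * u + 4 * u ^ 2) := by linarith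
  have h6 : 1 ≤ (1 + (2 * u + 4 * u ^ 2)) * (1 - 2 * u) ∨ 0 < u := by
    by_cases h : 0 < u
    · exact Or.inr h
    · left; nlinarith [sq_nonneg u, mul_nonneg (sq_nonneg u) (by linarith : 0 ≤ -u)]
  rcases h6 with h6 | h6
  · nlinarith
  · rcases h2 with h2 | h2
    · nlinarith [sq_nonneg u, mul_nonneg (sq_nonneg u) h6.le, mul_nonneg (mul_nonneg (sq_nonneg u) h6.le) h6.le,
        mul_le_mul_of_nonneg_right h2 h1.le, mul_nonneg (sq_nonneg u) (by linarith : 0 ≤ 1 - 4 * u),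
        mul_nonneg (mul_nonneg (sq_nonneg u) (sq_nonneg u)) (by linarith : 0 ≤ 1 - 4 * u),
        mul_nonneg (mul_nonneg (sq_nonneg u) h6.le) (by linarith : 0 ≤ 1 - 4 * u)]
    · linarith

/-- Exponential moments of a bounded quadratic form under the standard Gaussian measure. -/
theorem lintegral_exp_quadForm_le {B : Matrix ι ι ℝ} (hB : B.IsHermitian) {C s : ℝ}
    (hC : ∀ v : ι → ℝ, |v ⬝ᵥ (B *ᵥ v)| ≤ C * (v ⬝ᵥ v)) (hs : |s| * C ≤ 1 / 4) :
    ∫⁻ v, ENNReal.ofReal (Real.exp (s * (v ⬝ᵥ (B *ᵥ v)))) ∂(stdGauss ι)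
      ≤ ENNReal.ofReal (Real.exp (s * B.trace + 2 * s ^ 2 * C ^ 2 * Fintype.card ι)) := by
  have hd : ∀ i, |hB.eigenvalues i| ≤ C := by
    intro i
    obtain ⟨e, -, h1, h2⟩ := eigenvalues_eq_quadForm hB i
    have := hC e
    rwa [h1, mul_one, ← h2] at this
  have hsd : ∀ i, |s * hB.eigenvalues i| ≤ 1 / 4 := by
    intro i
    rw [abs_mul]
    exact (mul_le_mul_of_nonneg_left (hd i) (abs_nonneg s)).trans hs
  have hpos : ∀ i, 0 < 1 / 2 + (-s) * hB.eigenvalues i := by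
    intro i
    have := abs_le.1 (hsd i)
    linarith
  rw [lintegral_stdGauss]
  have h1 : ∀ x : ι → ℝ, ENNReal.ofReal (Real.exp (-((1 / 2) * (x ⬝ᵥ x)))) *
      ENNReal.ofReal (Real.exp (s * (x ⬝ᵥ (B *ᵥ x))))
      = ENNReal.ofReal (Real.exp (-((1 / 2) * (x ⬝ᵥ x) + (-s) * (x ⬝ᵥ (B *ᵥ x))))) := by
    intro x
    rw [← ENNReal.ofReal_mul (Real.exp_pos _).le, ← Real.exp_add]
    congr 2; ring
  simp_rw [h1]
  rw [lintegral_exp_neg_quadForm hB _ _ hpos, ← ENNReal.ofReal_mul (by positivity)]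
  apply ENNReal.ofReal_le_ofReal
  -- The normalizing constant is shared out over the eigenvalues, so that the inequality reduces to
  -- the one-dimensional bound in each eigendirection.
  have h2 : (Real.sqrt (2 * Real.pi))⁻¹ ^ Fintype.card ι
      = ∏ _i : ι, (Real.sqrt (2 * Real.pi))⁻¹ := by simp
  rw [h2, ← Finset.prod_mul_distrib]
  have h3 : B.trace = ∑ i, hB.eigenvalues i := by
    have := hB.trace_eq_sum_eigenvalues
    simpa using this
  have h4 : s * B.trace + 2 * s ^ 2 * C ^ 2 * Fintype.card ι
      = ∑ i, (s * hB.eigenvalues i + 2 * s ^ 2 * C ^ 2) := by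
    rw [h3, Finset.sum_add_distrib, Finset.mul_sum]; simp; ring
  rw [h4, Real.exp_sum]
  refine Finset.prod_le_prod (fun i _ => by positivity) fun i _ => ?_
  rw [← Real.sqrt_inv, ← Real.sqrt_mul (by positivity)]
  have h5 : (2 * Real.pi)⁻¹ * (Real.pi / (1 / 2 + -s * hB.eigenvalues i))
      = 1 / (1 - 2 * (s * hB.eigenvalues i)) := by
    have := hpos i
    have h6 : 1 - 2 * (s * hB.eigenvalues i) ≠ 0 := by
      have : 1 - 2 * (s * hB.eigenvalues i) = 2 * (1 / 2 + -s * hB.eigenvalues i) := by ring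
      rw [this]; positivity
    have h7 := Real.pi_pos
    have h8 : (1 / 2 + -s * hB.eigenvalues i) = (1 - 2 * (s * hB.eigenvalues i)) / 2 := by ring
    rw [h8]
    field_simp
  rw [h5]
  refine (inv_sqrt_one_sub_le (hsd i)).trans (Real.exp_le_exp.2 ?_)
  have : hB.eigenvalues i ^ 2 ≤ C ^ 2 := sq_le_sq' (by have := abs_le.1 (hd i); linarith) (abs_le.1 (hd i)).2
  nlinarith [mul_le_mul_of_nonneg_left this (sq_nonneg s)]

end GaussianIntegrals

/-! ### Means over one period and orthogonality of cosines. -/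

section CircleMean

/-- The mean of a function over one period `[0, 2π]`. -/
def cmean (f : ℝ → ℝ) : ℝ := 1 / (2 * Real.pi) * ∫ ν in (0 : ℝ)..(2 * Real.pi), f ν

theorem cmean_add {f g : ℝ → ℝ} (hf : Continuous f) (hg : Continuous g) :
    cmean (fun ν => f ν + g ν) = cmean f + cmean g := by
  unfold cmean
  rw [intervalIntegral.integral_add (hf.intervalIntegrable _ _) (hg.intervalIntegrable _ _), mul_add]

theorem cmean_sub {f g : ℝ → ℝ} (hf : Continuous f) (hg : Continuous g) :
    cmean (fun ν => f ν - g ν) = cmean f - cmean g := by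
  unfold cmean
  rw [intervalIntegral.integral_sub (hf.intervalIntegrable _ _) (hg.intervalIntegrable _ _), mul_sub]

theorem cmean_const_mul (c : ℝ) (f : ℝ → ℝ) : cmean (fun ν => c * f ν) = c * cmean f := by
  unfold cmean
  rw [intervalIntegral.integral_const_mul]; ring

theorem cmean_mul_const (f : ℝ → ℝ) (c : ℝ) : cmean (fun ν => f ν * c) = cmean f * c := by
  unfold cmean
  rw [intervalIntegral.integral_mul_const]; ring

theorem cmean_sum {ι : Type*} (s : Finset ι) {f : ι → ℝ → ℝ} (hf : ∀ i ∈ s, Continuous (f i)) :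
    cmean (fun ν => ∑ i ∈ s, f i ν) = ∑ i ∈ s, cmean (f i) := by
  unfold cmean
  rw [intervalIntegral.integral_finsetSum fun i hi => (hf i hi).intervalIntegrable _ _,
    Finset.mul_sum]

theorem cmean_const (c : ℝ) : cmean (fun _ => c) = c := by
  unfold cmean
  have := Real.pi_pos
  simp; field_simp

theorem cmean_mono {f g : ℝ → ℝ} (hf : Continuous f) (hg : Continuous g) (h : ∀ ν, f ν ≤ g ν) :
    cmean f ≤ cmean g := by
  unfold cmean
  have := Real.pi_pos
  refine mul_le_mul_of_nonneg_left ?_ (by positivity)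
  exact intervalIntegral.integral_mono_on (by positivity) (hf.intervalIntegrable _ _)
    (hg.intervalIntegrable _ _) fun ν _ => h ν

theorem cmean_nonneg {f : ℝ → ℝ} (hf : Continuous f) (h : ∀ ν, 0 ≤ f ν) : 0 ≤ cmean f := by
  have := cmean_mono continuous_const hf h
  rwa [cmean_const] at this

theorem cmean_pos {f : ℝ → ℝ} (hf : Continuous f) (h : ∀ ν, 0 < f ν) : 0 < cmean f := by
  unfold cmean
  have := Real.pi_pos
  refine mul_pos (by positivity) ?_
  exact intervalIntegral.intervalIntegral_pos_of_pos_on (hf.intervalIntegrable _ _) (fun ν _ => h ν)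
    (by positivity)

theorem cmean_cos (m : ℤ) : cmean (fun ν => Real.cos (m * ν)) = if m = 0 then 1 else 0 := by
  split_ifs with h
  · subst h; simp [cmean_const]
  · unfold cmean
    have hm : (m : ℝ) ≠ 0 := by exact_mod_cast h
    rw [intervalIntegral.integral_comp_mul_left (fun x => Real.cos x) hm, integral_cos]
    have : Real.sin ((m : ℝ) * (2 * Real.pi)) = 0 := by
      have := Real.sin_int_mul_pi (2 * m)
      push_cast at this
      rw [← this]; congr 1; ring
    rw [this]; simp

theorem cmean_cos_mul_cos (k m : ℤ) : cmean (fun ν => Real.cos (k * ν) * Real.cos (m * ν))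
    = 1 / 2 * ((if k + m = 0 then 1 else 0) + (if k - m = 0 then 1 else 0)) := by
  have h : ∀ ν : ℝ, Real.cos (k * ν) * Real.cos (m * ν)
      = 1 / 2 * (Real.cos (((k + m : ℤ) : ℝ) * ν) + Real.cos (((k - m : ℤ) : ℝ) * ν)) := by
    intro ν
    push_cast
    rw [add_mul, sub_mul, Real.cos_add, Real.cos_sub]; ring
  simp_rw [h]
  rw [cmean_const_mul, cmean_add (by fun_prop) (by fun_prop), cmean_cos, cmean_cos]

end CircleMean

/-! ### Finite blocks: transforms, empirical correlations, Toeplitz forms and filters. -/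

section Blocks

variable {n : ℕ}

/-- The discrete-time Fourier transform of a block. -/
def dft (x : Fin n → ℝ) (ν : ℝ) : ℂ :=
  ∑ t : Fin n, (x t : ℂ) * Complex.exp (-(Complex.I * (t : ℕ) * ν))

/-- The empirical correlation `∑_t x_t x_{t-k}`. -/
def lagCorr (x : Fin n → ℝ) (k : ℕ) : ℝ := ∑ t, x t * delay x k t

theorem fourier_eq_dft {K : ℕ} (a : Fin (K + 1) → ℝ) : fourier a = dft a := rfl

@[fun_prop]
theorem continuous_dft (x : Fin n → ℝ) : Continuous (dft x) := by
  unfold dft; fun_prop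

@[fun_prop]
theorem continuous_fourier {K : ℕ} (a : Fin (K + 1) → ℝ) : Continuous (fourier a) :=
  continuous_dft a

theorem re_exp_mul_conj_exp (s t : ℕ) (ν : ℝ) :
    (Complex.exp (-(Complex.I * (s : ℕ) * ν)) *
      (starRingEnd ℂ) (Complex.exp (-(Complex.I * (t : ℕ) * ν)))).re
      = Real.cos (((s : ℤ) - (t : ℤ) : ℤ) * ν) := by
  rw [← Complex.exp_conj, ← Complex.exp_add]
  have : -(Complex.I * (s : ℂ) * (ν : ℂ)) + (starRingEnd ℂ) (-(Complex.I * (t : ℂ) * (ν : ℂ)))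
      = ((-((s : ℝ) - t) * ν : ℝ) : ℂ) * Complex.I := by
    simp; ring
  rw [this, Complex.exp_ofReal_mul_I_re]
  push_cast
  rw [neg_mul, Real.cos_neg]

theorem re_dft_mul_conj_dft (x y : Fin n → ℝ) (ν : ℝ) :
    (dft x ν * (starRingEnd ℂ) (dft y ν)).re
      = ∑ s, ∑ t, x s * y t * Real.cos ((((s : ℕ) : ℤ) - ((t : ℕ) : ℤ) : ℤ) * ν) := by
  unfold dft
  rw [map_sum, Finset.sum_mul_sum, Complex.re_sum]
  refine Finset.sum_congr rfl fun s _ => ?_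
  rw [Complex.re_sum]
  refine Finset.sum_congr rfl fun t _ => ?_
  rw [← re_exp_mul_conj_exp, map_mul, Complex.conj_ofReal]
  have : ∀ a b : ℝ, ∀ u v : ℂ, ((a : ℂ) * u * (b * v)) = ((a * b : ℝ) : ℂ) * (u * v) := by
    intros; push_cast; ring
  rw [this, Complex.re_ofReal_mul]

theorem normSq_dft (x : Fin n → ℝ) (ν : ℝ) :
    ‖dft x ν‖ ^ 2
      = ∑ s, ∑ t, x s * x t * Real.cos ((((s : ℕ) : ℤ) - ((t : ℕ) : ℤ) : ℤ) * ν) := by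
  rw [← re_dft_mul_conj_dft, Complex.mul_conj, Complex.ofReal_re, Complex.normSq_eq_norm_sq]

/-- Parseval's identity: the mean of `cos ((s - t) ν)` vanishes off the diagonal. -/
theorem cmean_re_dft_mul_conj_dft (x y : Fin n → ℝ) :
    cmean (fun ν => (dft x ν * (starRingEnd ℂ) (dft y ν)).re) = ∑ t, x t * y t := by
  simp_rw [re_dft_mul_conj_dft]
  rw [cmean_sum _ (fun s _ => by fun_prop)]
  refine Finset.sum_congr rfl fun s _ => ?_
  rw [cmean_sum _ (fun s _ => by fun_prop)]
  simp_rw [cmean_const_mul, cmean_cos]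
  rw [Finset.sum_eq_single s]
  · simp
  · intro t _ hts
    rw [if_neg, mul_zero]
    intro h
    exact hts (Fin.ext (by omega))
  · simp

/-- With the shift written as an indicator sum over all positions, boundary cases become index
conditions and double sums can be exchanged freely. -/
theorem delay_eq_sum (x : Fin n → ℝ) (i : ℕ) (t : Fin n) :
    delay x i t = ∑ s : Fin n, if (s : ℕ) + i = t then x s else 0 := by
  unfold delay
  split_ifs with h
  · rw [Finset.sum_eq_single (⟨(t : ℕ) - i, lt_of_le_of_lt (Nat.sub_le _ _) t.2⟩ : Fin n)]
    · simp [h]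
    · intro s _ hs
      rw [if_neg]
      intro h'
      exact hs (Fin.ext (by simp; omega))
    · simp
  · symm
    apply Finset.sum_eq_zero
    intro s _
    rw [if_neg (by omega)]

theorem lagCorr_eq_sum (x : Fin n → ℝ) (k : ℕ) :
    lagCorr x k = ∑ s : Fin n, ∑ t : Fin n, if (s : ℕ) + k = t then x s * x t else 0 := by
  unfold lagCorr
  simp_rw [delay_eq_sum, Finset.mul_sum]
  rw [Finset.sum_comm]
  refine Finset.sum_congr rfl fun s _ => Finset.sum_congr rfl fun t _ => ?_
  split_ifs <;> ring

theorem lagCorr_eq_sum' (x : Fin n → ℝ) (k : ℕ) :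
    lagCorr x k = ∑ s : Fin n, ∑ t : Fin n, if (t : ℕ) + k = s then x s * x t else 0 := by
  rw [lagCorr_eq_sum, Finset.sum_comm]
  refine Finset.sum_congr rfl fun s _ => Finset.sum_congr rfl fun t _ => ?_
  split_ifs <;> ring

theorem lagCorr_zero (x : Fin n → ℝ) : lagCorr x 0 = ∑ t, x t ^ 2 := by
  unfold lagCorr delay
  simp [sq]

/-- The quadratic form of the Toeplitz matrix with symbol `f`. -/
def toepForm (f : ℝ → ℝ) (x : Fin n → ℝ) : ℝ := cmean fun ν => f ν * ‖dft x ν‖ ^ 2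

/-- The Toeplitz matrix with (even) symbol `f`. -/
def toepMat (f : ℝ → ℝ) (n : ℕ) : Matrix (Fin n) (Fin n) ℝ :=
  Matrix.of fun s t => cmean fun ν => f ν * Real.cos ((((s : ℕ) : ℤ) - ((t : ℕ) : ℤ) : ℤ) * ν)

open Matrix in
theorem toepForm_eq_quadForm {f : ℝ → ℝ} (hf : Continuous f) (x : Fin n → ℝ) :
    toepForm f x = x ⬝ᵥ (toepMat f n *ᵥ x) := by
  unfold toepForm
  simp_rw [normSq_dft, Finset.mul_sum]
  rw [cmean_sum _ (fun s _ => by fun_prop)]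
  refine Finset.sum_congr rfl fun s _ => ?_
  rw [cmean_sum _ (fun s _ => by fun_prop), Matrix.mulVec, dotProduct, Finset.mul_sum]
  refine Finset.sum_congr rfl fun t _ => ?_
  simp only [toepMat, Matrix.of_apply]
  rw [← cmean_mul_const, ← cmean_const_mul]
  congr 1; ext ν; ring

theorem toepMat_isHermitian (f : ℝ → ℝ) (n : ℕ) : (toepMat f n).IsHermitian := by
  refine Matrix.IsHermitian.ext fun s t => ?_
  simp only [toepMat, Matrix.of_apply, star_trivial]
  congr 1; ext ν
  congr 1
  rw [← Real.cos_neg]; congr 1; push_cast; ring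

/-- This is the dictionary used throughout: a cosine polynomial as symbol gives the same linear
combination of empirical correlations. -/
theorem toepForm_cos (k : ℕ) (x : Fin n → ℝ) :
    toepForm (fun ν => Real.cos (k * ν)) x = lagCorr x k := by
  -- The product formula for cosines yields two half contributions, from `s - t = k` and `t - s =
  -- k`; the correlation is split into halves to match them.
  have h2 : lagCorr x k = 1 / 2 * (lagCorr x k + lagCorr x k) := by ring
  rw [h2]
  nth_rewrite 1 [lagCorr_eq_sum]
  rw [lagCorr_eq_sum', ← Finset.sum_add_distrib, Finset.mul_sum]
  unfold toepForm
  simp_rw [normSq_dft, Finset.mul_sum]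
  rw [cmean_sum _ (fun s _ => by fun_prop)]
  refine Finset.sum_congr rfl fun s _ => ?_
  rw [cmean_sum _ (fun s _ => by fun_prop), ← Finset.sum_add_distrib, Finset.mul_sum]
  refine Finset.sum_congr rfl fun t _ => ?_
  have h : (fun ν : ℝ => Real.cos (k * ν) * (x s * x t *
        Real.cos ((((s : ℕ) : ℤ) - ((t : ℕ) : ℤ) : ℤ) * ν)))
      = fun ν => (x s * x t) * (Real.cos (((k : ℤ) : ℝ) * ν) *
        Real.cos ((((s : ℕ) : ℤ) - ((t : ℕ) : ℤ) : ℤ) * ν)) := by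
    ext ν; push_cast; ring
  rw [h, cmean_const_mul, cmean_cos_mul_cos]
  have e1 : ((k : ℤ) + (((s : ℕ) : ℤ) - ((t : ℕ) : ℤ)) = 0) ↔ ((s : ℕ) + k = t) := by omega
  have e2 : ((k : ℤ) - (((s : ℕ) : ℤ) - ((t : ℕ) : ℤ)) = 0) ↔ ((t : ℕ) + k = s) := by omega
  simp only [e1, e2]
  split_ifs <;> ring

theorem toepForm_add {f g : ℝ → ℝ} (hf : Continuous f) (hg : Continuous g) (x : Fin n → ℝ) :
    toepForm (fun ν => f ν + g ν) x = toepForm f x + toepForm g x := by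
  unfold toepForm
  rw [← cmean_add (by fun_prop) (by fun_prop)]
  congr 1; ext ν; ring

theorem toepForm_const_mul (c : ℝ) (f : ℝ → ℝ) (x : Fin n → ℝ) :
    toepForm (fun ν => c * f ν) x = c * toepForm f x := by
  unfold toepForm
  rw [← cmean_const_mul]
  congr 1; ext ν; ring

theorem toepForm_sum {ι : Type*} (s : Finset ι) {f : ι → ℝ → ℝ} (hf : ∀ i ∈ s, Continuous (f i))
    (x : Fin n → ℝ) :
    toepForm (fun ν => ∑ i ∈ s, f i ν) x = ∑ i ∈ s, toepForm (f i) x := by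
  unfold toepForm
  rw [← cmean_sum _ (fun i hi => by have := hf i hi; fun_prop)]
  congr 1; ext ν; rw [Finset.sum_mul]

theorem toepForm_mono {f g : ℝ → ℝ} (hf : Continuous f) (hg : Continuous g) (h : ∀ ν, f ν ≤ g ν)
    (x : Fin n → ℝ) : toepForm f x ≤ toepForm g x :=
  cmean_mono (by fun_prop) (by fun_prop) fun ν =>
    mul_le_mul_of_nonneg_right (h ν) (sq_nonneg _)

theorem toepForm_const (c : ℝ) (x : Fin n → ℝ) : toepForm (fun _ => c) x = c * ∑ t, x t ^ 2 := by
  have h := toepForm_cos 0 x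
  simp only [Nat.cast_zero, zero_mul, Real.cos_zero] at h
  have h2 := toepForm_const_mul c (fun _ => 1) x
  simp only [mul_one] at h2
  rw [h2, h, lagCorr_zero]

/-- The symbol `cos (k ν)` lies between `-1` and `1`, and Toeplitz forms are monotone in the symbol.
-/
theorem abs_lagCorr_le (x : Fin n → ℝ) (k : ℕ) : |lagCorr x k| ≤ ∑ t, x t ^ 2 := by
  rw [← toepForm_cos, abs_le]
  have h1 := toepForm_const 1 x
  have h2 := toepForm_const (-1) x
  have h3 := toepForm_mono (f := fun ν => Real.cos (k * ν)) (g := fun _ => 1) (by fun_prop)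
    (by fun_prop) (fun ν => Real.cos_le_one _) x
  have h4 := toepForm_mono (f := fun _ => -1) (g := fun ν => Real.cos (k * ν)) (by fun_prop)
    (by fun_prop) (fun ν => Real.neg_one_le_cos _) x
  constructor <;> linarith

/-- `|dft x|²` as a cosine polynomial. -/
theorem normSq_dft_eq_lagCorr (x : Fin n → ℝ) {N : ℕ} (hN : n ≤ N + 1) (ν : ℝ) :
    ‖dft x ν‖ ^ 2 = lagCorr x 0 + 2 * ∑ m ∈ Finset.Icc 1 N, lagCorr x m * Real.cos (m * ν) := by
  have h2 : ∀ m, 2 * (lagCorr x m * Real.cos (m * ν))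
      = lagCorr x m * Real.cos (m * ν) + lagCorr x m * Real.cos (m * ν) := fun m => by ring
  rw [Finset.mul_sum]
  simp_rw [h2]
  rw [normSq_dft, Finset.sum_add_distrib, lagCorr_eq_sum x 0]
  conv_rhs => enter [2, 1]; simp only [lagCorr_eq_sum x]
  conv_rhs => enter [2, 2]; simp only [lagCorr_eq_sum' x]
  simp_rw [Finset.sum_mul]
  rw [Finset.sum_comm (s := Finset.Icc 1 N), Finset.sum_comm (s := Finset.Icc 1 N),
    ← Finset.sum_add_distrib, ← Finset.sum_add_distrib]
  refine Finset.sum_congr rfl fun s _ => ?_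
  rw [Finset.sum_comm (s := Finset.Icc 1 N), Finset.sum_comm (s := Finset.Icc 1 N),
    ← Finset.sum_add_distrib, ← Finset.sum_add_distrib]
  refine Finset.sum_congr rfl fun t _ => ?_
  have hs := s.2
  have ht := t.2
  -- An off-diagonal pair is counted once, at `m = |s - t|`, by one of the two halves of the doubled
  -- sum; a diagonal pair appears only in the term of lag `0`.
  rcases lt_trichotomy (s : ℕ) t with h | h | h
  · rw [if_neg (by omega), Finset.sum_eq_single_of_mem ((t : ℕ) - s) (by simp; omega),
      Finset.sum_eq_zero]
    · rw [if_pos (by omega), Nat.cast_sub h.le, ← Real.cos_neg]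
      push_cast
      rw [zero_add, add_zero]; congr 2; ring
    · intro m hm
      simp only [Finset.mem_Icc] at hm
      rw [if_neg (by omega), zero_mul]
    · intro m hm hmne
      rw [if_neg (by omega), zero_mul]
  · rw [if_pos (by omega), Finset.sum_eq_zero, Finset.sum_eq_zero]
    · rw [h]; simp
    · intro m hm
      simp only [Finset.mem_Icc] at hm
      rw [if_neg (by omega), zero_mul]
    · intro m hm
      simp only [Finset.mem_Icc] at hm
      rw [if_neg (by omega), zero_mul]
  · rw [if_neg (by omega), Finset.sum_eq_zero,
      Finset.sum_eq_single_of_mem ((s : ℕ) - t) (by simp; omega)]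
    · rw [if_pos (by omega), Nat.cast_sub h.le]
      push_cast
      rw [zero_add, zero_add]
    · intro m hm hmne
      rw [if_neg (by omega), zero_mul]
    · intro m hm
      simp only [Finset.mem_Icc] at hm
      rw [if_neg (by omega), zero_mul]

theorem tapCorr_eq_lagCorr {K : ℕ} (a : Fin (K + 1) → ℝ) (m : ℕ) : tapCorr a m = lagCorr a m := by
  rw [lagCorr_eq_sum]
  unfold tapCorr
  have h1 : ∀ s : Fin (K + 1), (∑ t : Fin (K + 1), if (s : ℕ) + m = t then a s * a t else 0)
      = if (s : ℕ) < K + 1 - m then zeroExt a s * zeroExt a (s + m) else 0 := by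
    intro s
    split_ifs with h
    · rw [Finset.sum_eq_single (⟨s + m, by omega⟩ : Fin (K + 1))]
      · simp only [if_true, zeroExt]
        rw [dif_pos (by omega), dif_pos (by omega)]
      · intro t _ ht
        rw [if_neg]
        intro h'
        exact ht (Fin.ext (by simp; omega))
      · simp
    · apply Finset.sum_eq_zero
      intro t _
      have := t.2
      rw [if_neg (by omega)]
  simp_rw [h1]
  rw [Fin.sum_univ_eq_sum_range (fun s => if s < K + 1 - m then zeroExt a s * zeroExt a (s + m) else 0),
    ← Finset.sum_filter]
  congr 1
  ext s; simp; omega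

theorem dft_zeroPad (L : ℕ) (x : Fin n → ℝ) : dft (zeroPad L x) = dft x := by
  ext ν
  unfold dft zeroPad
  rw [Fin.sum_univ_add]
  simp

theorem zeroPad_eq_zero {L : ℕ} (x : Fin n → ℝ) (t : Fin (n + L)) (ht : n ≤ t) :
    zeroPad L x t = 0 := by
  unfold zeroPad
  obtain ⟨j, rfl⟩ : ∃ j : Fin L, t = Fin.natAdd n j := ⟨⟨t - n, by omega⟩, Fin.ext (by simp; omega)⟩
  simp

/-- With at least `K` trailing zeros the whole convolution fits in the block, so nothing is cut off
at the end and the convolution theorem is exact. This is what the guard interval is for. -/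
theorem dft_filterOut_zeroPad {K L : ℕ} (hL : K ≤ L) (a : Fin (K + 1) → ℝ) (x : Fin n → ℝ) (ν : ℝ) :
    dft (filterOut a (zeroPad L x)) ν = fourier a ν * dft x ν := by
  rw [← dft_zeroPad L x]
  unfold dft fourier filterOut
  rw [Finset.sum_mul_sum]
  simp_rw [delay_eq_sum]
  push_cast
  simp_rw [Finset.sum_mul]
  rw [Finset.sum_comm]
  refine Finset.sum_congr rfl fun i _ => ?_
  simp_rw [Finset.mul_sum, Finset.sum_mul]
  rw [Finset.sum_comm]
  refine Finset.sum_congr rfl fun s _ => ?_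
  by_cases hs : (s : ℕ) < n
  · have hi := i.2
    rw [Finset.sum_eq_single (⟨s + i, by omega⟩ : Fin (n + L))]
    · simp only [if_true]
      push_cast
      have : -(Complex.I * ((s : ℕ) + (i : ℕ) : ℂ) * ν) = -(Complex.I * (i : ℕ) * ν) + -(Complex.I * (s : ℕ) * ν) := by
        ring
      rw [this, Complex.exp_add]; ring
    · intro t _ ht
      rw [if_neg]
      · simp
      · intro h'
        exact ht (Fin.ext (by simp; omega))
    · simp
  · rw [zeroPad_eq_zero x s (by omega)]
    simp

theorem toepForm_normSq_fourier {K : ℕ} (a : Fin (K + 1) → ℝ) (x : Fin n → ℝ) :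
    toepForm (fun ν => ‖fourier a ν‖ ^ 2) x
      = lagCorr a 0 * lagCorr x 0 + 2 * ∑ m ∈ Finset.Icc 1 K, lagCorr a m * lagCorr x m := by
  simp_rw [fourier_eq_dft, normSq_dft_eq_lagCorr a le_rfl]
  rw [toepForm_add (by fun_prop) (by fun_prop), toepForm_const, toepForm_const_mul,
    toepForm_sum _ (fun i _ => by fun_prop), ← lagCorr_zero]
  simp_rw [toepForm_const_mul, toepForm_cos]

theorem sum_filterOut_zeroPad_mul {K L : ℕ} (hL : K ≤ L) (a : Fin (K + 1) → ℝ) (x : Fin n → ℝ)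
    (y : Fin (n + L) → ℝ) :
    ∑ t, y t * filterOut a (zeroPad L x) t
      = cmean fun ν => (dft y ν * (starRingEnd ℂ) (fourier a ν * dft x ν)).re := by
  rw [← cmean_re_dft_mul_conj_dft]
  simp_rw [dft_filterOut_zeroPad hL]

theorem sum_filterOut_zeroPad_sq {K L : ℕ} (hL : K ≤ L) (a : Fin (K + 1) → ℝ) (x : Fin n → ℝ) :
    ∑ t, filterOut a (zeroPad L x) t ^ 2
      = lagCorr a 0 * lagCorr x 0 + 2 * ∑ m ∈ Finset.Icc 1 K, lagCorr a m * lagCorr x m := by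
  rw [← toepForm_normSq_fourier]
  simp_rw [sq]
  rw [← cmean_re_dft_mul_conj_dft]
  simp_rw [dft_filterOut_zeroPad hL, Complex.mul_conj, Complex.ofReal_re, Complex.normSq_mul]
  unfold toepForm
  simp_rw [Complex.normSq_eq_norm_sq, sq]

end Blocks

/-! ### Toeplitz determinants: the lower half of Szegő's theorem. -/

section Szego

open Matrix

variable {n : ℕ} {f : ℝ → ℝ} {m : ℝ}

theorem eigenvalues_toepMat (hf : Continuous f) (i : Fin n) :
    (toepMat_isHermitian f n).eigenvalues i
      = toepForm f fun j => ((toepMat_isHermitian f n).eigenvectorUnitary : Matrix (Fin n) (Fin n) ℝ) j i := by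
  obtain ⟨e, he, -, h2⟩ := eigenvalues_eq_quadForm (toepMat_isHermitian f n) i
  rw [h2, ← toepForm_eq_quadForm hf, he]

theorem sum_sq_eigenvector {B : Matrix (Fin n) (Fin n) ℝ} (hB : B.IsHermitian) (i : Fin n) :
    ∑ t, (hB.eigenvectorUnitary : Matrix (Fin n) (Fin n) ℝ) t i ^ 2 = 1 := by
  obtain ⟨e, he, h1, -⟩ := eigenvalues_eq_quadForm hB i
  rw [← h1, he]
  simp [dotProduct, sq]

theorem eigenvalues_toepMat_ge (hf : Continuous f) (hm : ∀ ν, m ≤ f ν) (i : Fin n) :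
    m ≤ (toepMat_isHermitian f n).eigenvalues i := by
  rw [eigenvalues_toepMat hf]
  have := toepForm_mono continuous_const hf hm
    (fun j => ((toepMat_isHermitian f n).eigenvectorUnitary : Matrix (Fin n) (Fin n) ℝ) j i)
  rwa [toepForm_const, sum_sq_eigenvector, mul_one] at this

/-- The sum is the squared length of the vector of exponentials in an orthonormal basis. Its
independence of `ν` lets the eigenvectors partition the mean of `log f` in Jensen's inequality. -/
theorem sum_normSq_dft_eigenvector {B : Matrix (Fin n) (Fin n) ℝ} (hB : B.IsHermitian) (ν : ℝ) :
    ∑ i, ‖dft (fun j => (hB.eigenvectorUnitary : Matrix (Fin n) (Fin n) ℝ) j i) ν‖ ^ 2 = n := by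
  simp_rw [normSq_dft]
  rw [Finset.sum_comm]
  have h : (hB.eigenvectorUnitary : Matrix (Fin n) (Fin n) ℝ) * (hB.eigenvectorUnitary : Matrix (Fin n) (Fin n) ℝ)ᵀ = 1 := by
    have := Unitary.coe_mul_star_self hB.eigenvectorUnitary
    rwa [Unitary.coe_star, Matrix.star_eq_conjTranspose, Matrix.conjTranspose_eq_transpose_of_trivial] at this
  have h2 : ∀ s : Fin n, ∑ i, ∑ t, (hB.eigenvectorUnitary : Matrix (Fin n) (Fin n) ℝ) s i *
      (hB.eigenvectorUnitary : Matrix (Fin n) (Fin n) ℝ) t i *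
        Real.cos ((((s : ℕ) : ℤ) - ((t : ℕ) : ℤ) : ℤ) * ν) = 1 := by
    intro s
    rw [Finset.sum_comm]
    simp_rw [← Finset.sum_mul]
    have h3 : ∀ t, ∑ i, (hB.eigenvectorUnitary : Matrix (Fin n) (Fin n) ℝ) s i *
      (hB.eigenvectorUnitary : Matrix (Fin n) (Fin n) ℝ) t i = (1 : Matrix (Fin n) (Fin n) ℝ) s t := by
      intro t
      rw [← h, Matrix.mul_apply]; rfl
    simp_rw [h3, Matrix.one_apply]
    simp
  simp_rw [h2]
  simp

/-- The lower bound in Szegő's theorem, from Jensen's inequality in the eigenbasis. -/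
theorem sum_log_eigenvalues_toepMat_ge (hf : Continuous f) (hm0 : 0 < m) (hm : ∀ ν, m ≤ f ν) :
    n * cmean (fun ν => Real.log (f ν))
      ≤ ∑ i, Real.log ((toepMat_isHermitian f n).eigenvalues i) := by
  have hfpos : ∀ ν, 0 < f ν := fun ν => hm0.trans_le (hm ν)
  have hlog : Continuous fun ν => Real.log (f ν) := hf.log fun ν => (hfpos ν).ne'
  have h1 : n * cmean (fun ν => Real.log (f ν)) = ∑ i : Fin n, cmean fun ν => Real.log (f ν) *
      ‖dft (fun j => ((toepMat_isHermitian f n).eigenvectorUnitary : Matrix (Fin n) (Fin n) ℝ) j i) ν‖ ^ 2 := by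
    rw [← cmean_sum _ (fun i _ => by fun_prop), ← cmean_const_mul]
    congr 1; ext ν
    rw [← Finset.mul_sum, sum_normSq_dft_eigenvector, mul_comm]
  rw [h1]
  refine Finset.sum_le_sum fun i _ => ?_
  set l := (toepMat_isHermitian f n).eigenvalues i with hl
  set e : Fin n → ℝ := fun j => ((toepMat_isHermitian f n).eigenvectorUnitary : Matrix (Fin n) (Fin n) ℝ) j i
  have hlpos : 0 < l := hm0.trans_le (eigenvalues_toepMat_ge hf hm i)
  have h2 : toepForm f e = l := (eigenvalues_toepMat hf i).symm
  have h3 : ∑ t, e t ^ 2 = 1 := sum_sq_eigenvector _ i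
  -- The tangent line of the logarithm at the eigenvalue `l`, averaged against the probability
  -- weight `‖dft e ν‖ ^ 2`, is Jensen's inequality for this eigenvector.
  have h4 := toepForm_mono (f := fun ν => Real.log (f ν)) (g := fun ν => (Real.log l - 1) + l⁻¹ * f ν)
    hlog (by fun_prop) (fun ν => by
      have := Real.log_le_sub_one_of_pos (div_pos (hfpos ν) hlpos)
      rw [Real.log_div (hfpos ν).ne' hlpos.ne'] at this
      have e : l⁻¹ * f ν = f ν / l := by ring
      rw [e]; linarith) e
  rw [toepForm_add (by fun_prop) (by fun_prop), toepForm_const, toepForm_const_mul, h2, h3,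
    inv_mul_cancel₀ hlpos.ne'] at h4
  unfold toepForm at h4
  linarith

theorem exp_le_det_toepMat (hf : Continuous f) (hm0 : 0 < m) (hm : ∀ ν, m ≤ f ν) :
    Real.exp (n * cmean (fun ν => Real.log (f ν))) ≤ (toepMat f n).det := by
  have h := sum_log_eigenvalues_toepMat_ge (n := n) hf hm0 hm
  rw [(toepMat_isHermitian f n).det_eq_prod_eigenvalues]
  have hpos := fun i => hm0.trans_le (eigenvalues_toepMat_ge (n := n) hf hm i)
  have h2 : ∏ i, (((toepMat_isHermitian f n).eigenvalues i : ℝ) : ℝ)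
      = Real.exp (∑ i, Real.log ((toepMat_isHermitian f n).eigenvalues i)) := by
    rw [Real.exp_sum]
    exact Finset.prod_congr rfl fun i _ => (Real.exp_log (hpos i)).symm
  simp only [RCLike.ofReal_real_eq_id, id_eq]
  rw [h2]
  exact Real.exp_le_exp.2 h

/-- The exact value is `π^(n/2) det^(-1/2)`, so the lower bound on the determinant is the only
direction of Szegő's theorem that is needed. -/
theorem lintegral_exp_neg_toepForm_le (hf : Continuous f) (hm0 : 0 < m) (hm : ∀ ν, m ≤ f ν) :
    ∫⁻ x : Fin n → ℝ, ENNReal.ofReal (Real.exp (-toepForm f x))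
      ≤ ENNReal.ofReal (Real.exp (n * (1 / 2 * Real.log Real.pi
          - 1 / 2 * cmean (fun ν => Real.log (f ν))))) := by
  have hpos := fun i => hm0.trans_le (eigenvalues_toepMat_ge (n := n) hf hm i)
  have h1 := lintegral_exp_neg_quadForm (toepMat_isHermitian f n) 0 1 (by simpa using hpos)
  simp only [zero_mul, one_mul, zero_add] at h1
  simp_rw [toepForm_eq_quadForm hf]
  rw [h1]
  refine ENNReal.ofReal_le_ofReal ?_
  have h2 : ∀ i, Real.sqrt (Real.pi / (toepMat_isHermitian f n).eigenvalues i)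
      = Real.exp (1 / 2 * Real.log Real.pi
        - 1 / 2 * Real.log ((toepMat_isHermitian f n).eigenvalues i)) := by
    intro i
    have hq : 0 < Real.pi / (toepMat_isHermitian f n).eigenvalues i := div_pos Real.pi_pos (hpos i)
    rw [Real.sqrt_eq_rpow, Real.rpow_def_of_pos hq, Real.log_div Real.pi_ne_zero (hpos i).ne']
    congr 1; ring
  simp_rw [h2]
  rw [← Real.exp_sum, Real.exp_le_exp, Finset.sum_sub_distrib, ← Finset.mul_sum,
    ← Finset.mul_sum]
  have := sum_log_eigenvalues_toepMat_ge (n := n) hf hm0 hm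
  simp only [Finset.sum_const, Finset.card_univ, Fintype.card_fin, nsmul_eq_mul]
  linarith

/-- A Gaussian integral with a linear term, bounded through the maximum of its exponent. -/
theorem lintegral_exp_sub_toepForm_le (hf : Continuous f) (hm0 : 0 < m) (hm : ∀ ν, m ≤ f ν)
    (b : Fin n → ℝ) {D : ℝ} (hD : ∀ x : Fin n → ℝ, b ⬝ᵥ x - toepForm f x ≤ D) :
    ∫⁻ x : Fin n → ℝ, ENNReal.ofReal (Real.exp (b ⬝ᵥ x - toepForm f x))
      ≤ ENNReal.ofReal (Real.exp (D + n * (1 / 2 * Real.log Real.pi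
          - 1 / 2 * cmean (fun ν => Real.log (f ν))))) := by
  have hdet : (toepMat f n).det ≠ 0 :=
    ((Real.exp_pos _).trans_le (exp_le_det_toepMat hf hm0 hm)).ne'
  have hsymm : (toepMat f n)ᵀ = toepMat f n := by
    rw [← Matrix.conjTranspose_eq_transpose_of_trivial]; exact toepMat_isHermitian f n
  -- The stationary point of the exponent. Completing the square there and using translation
  -- invariance reduces the integral to the centred one, and `D` bounds the value at `x₀`.
  set x₀ : Fin n → ℝ := (toepMat f n)⁻¹ *ᵥ ((1 / 2 : ℝ) • b) with hx₀
  have hG : toepMat f n *ᵥ x₀ = (1 / 2 : ℝ) • b := by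
    rw [hx₀, Matrix.mulVec_mulVec, Matrix.mul_nonsing_inv _ hdet.isUnit, Matrix.one_mulVec]
  have hexp : ∀ x : Fin n → ℝ, b ⬝ᵥ x - toepForm f x
      = (b ⬝ᵥ x₀ - toepForm f x₀) + -toepForm f (x - x₀) := by
    intro x
    simp only [toepForm_eq_quadForm hf]
    have e1 : x₀ ⬝ᵥ (toepMat f n *ᵥ x) = (1 / 2 : ℝ) * (b ⬝ᵥ x) := by
      rw [Matrix.dotProduct_mulVec, ← Matrix.mulVec_transpose, hsymm, hG, smul_dotProduct, smul_eq_mul]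
    have e2 : x ⬝ᵥ (toepMat f n *ᵥ x₀) = (1 / 2 : ℝ) * (b ⬝ᵥ x) := by
      rw [hG, dotProduct_smul, smul_eq_mul, dotProduct_comm]
    have e3 : x₀ ⬝ᵥ (toepMat f n *ᵥ x₀) = (1 / 2 : ℝ) * (b ⬝ᵥ x₀) := by
      rw [hG, dotProduct_smul, smul_eq_mul, dotProduct_comm]
    rw [Matrix.mulVec_sub, sub_dotProduct, dotProduct_sub, dotProduct_sub, e1, e2, e3]
    ring
  calc ∫⁻ x : Fin n → ℝ, ENNReal.ofReal (Real.exp (b ⬝ᵥ x - toepForm f x))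
      = ∫⁻ x : Fin n → ℝ, ENNReal.ofReal (Real.exp (b ⬝ᵥ x₀ - toepForm f x₀)) *
          ENNReal.ofReal (Real.exp (-toepForm f (x - x₀))) := by
        refine lintegral_congr fun x => ?_
        rw [hexp x, Real.exp_add, ENNReal.ofReal_mul (Real.exp_pos _).le]
    _ = ENNReal.ofReal (Real.exp (b ⬝ᵥ x₀ - toepForm f x₀)) *
          ∫⁻ x : Fin n → ℝ, ENNReal.ofReal (Real.exp (-toepForm f x)) := by
        rw [lintegral_const_mul' _ _ ENNReal.ofReal_ne_top]
        congr 1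
        exact lintegral_sub_right_eq_self (fun x => ENNReal.ofReal (Real.exp (-toepForm f x))) x₀
    _ ≤ _ := by
        rw [Real.exp_add, ENNReal.ofReal_mul (Real.exp_pos _).le]
        exact mul_le_mul' (ENNReal.ofReal_le_ofReal (Real.exp_le_exp.2 (hD x₀)))
          (lintegral_exp_neg_toepForm_le hf hm0 hm)

/-- A square root of a positive Toeplitz matrix. -/
theorem exists_factor_toepMat (hf : Continuous f) (hm0 : 0 < m) (hm : ∀ ν, m ≤ f ν) (n : ℕ) :
    ∃ C : Matrix (Fin n) (Fin n) ℝ, C * Cᵀ = toepMat f n ∧ C.det ≠ 0 ∧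
      Real.exp (n * (1 / 2 * cmean (fun ν => Real.log (f ν)))) ≤ |C.det| := by
  have hpos := fun i => hm0.trans_le (eigenvalues_toepMat_ge (n := n) hf hm i)
  set hB := toepMat_isHermitian f n
  have hfac : ((hB.eigenvectorUnitary : Matrix (Fin n) (Fin n) ℝ) * diagonal fun i => Real.sqrt (hB.eigenvalues i)) *
      ((hB.eigenvectorUnitary : Matrix (Fin n) (Fin n) ℝ) * diagonal fun i => Real.sqrt (hB.eigenvalues i))ᵀ
      = toepMat f n := by
    have h := hB.spectral_theorem
    rw [Unitary.conjStarAlgAut_apply] at h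
    conv_rhs => rw [h]
    rw [Matrix.transpose_mul, Matrix.diagonal_transpose, Matrix.mul_assoc, ← Matrix.mul_assoc (diagonal _),
      Matrix.diagonal_mul_diagonal, ← Matrix.mul_assoc, Matrix.star_eq_conjTranspose,
      Matrix.conjTranspose_eq_transpose_of_trivial]
    congr 3
    ext i
    simp [Real.mul_self_sqrt (hpos i).le]
  have hdet := congrArg Matrix.det hfac
  rw [Matrix.det_mul, Matrix.det_transpose] at hdet
  have hge := exp_le_det_toepMat (n := n) hf hm0 hm
  rw [← hdet] at hge
  refine ⟨_, hfac, ?_, ?_⟩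
  · intro h0
    rw [h0] at hge
    have := Real.exp_pos (n * cmean (fun ν => Real.log (f ν)))
    linarith
  · rw [← abs_of_pos (Real.exp_pos _)]
    refine sq_le_sq.1 ?_
    rw [sq, sq, ← Real.exp_add]
    refine le_trans (le_of_eq ?_) hge
    congr 1; ring

end Szego

/-! ### Yule–Walker equations: location of the zeros and uniqueness. -/

section YuleWalker

/-- Positive definiteness of the Toeplitz form of `g` on sequences indexed by `0, …, p`. -/
def ToepPos (g : ℤ → ℝ) (p : ℕ) : Prop :=
  ∀ x : ℕ → ℝ, (∃ i ≤ p, x i ≠ 0) →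
    0 < ∑ i ∈ Finset.range (p + 1), ∑ j ∈ Finset.range (p + 1), x i * x j * g (i - j)

/-- The Yule-Walker equations `∑_j a_j g_{m-j} = 0`, `1 ≤ m ≤ p`. -/
def YuleWalkerEq (a : ℕ → ℝ) (g : ℤ → ℝ) (p : ℕ) : Prop :=
  ∀ m : ℕ, 1 ≤ m → m ≤ p → ∑ j ∈ Finset.range (p + 1), a j * g (m - j) = 0

variable {g d : ℤ → ℝ} {p : ℕ} {a : ℕ → ℝ}

theorem ToepPos.nonneg (h : ToepPos g p) (x : ℕ → ℝ) :
    0 ≤ ∑ i ∈ Finset.range (p + 1), ∑ j ∈ Finset.range (p + 1), x i * x j * g (i - j) := by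
  by_cases hx : ∃ i ≤ p, x i ≠ 0
  · exact (h x hx).le
  · push Not at hx
    refine le_of_eq (Finset.sum_eq_zero fun i hi => Finset.sum_eq_zero fun j _ => ?_).symm
    rw [hx i (by simp at hi; omega)]; ring

theorem ToepPos.of_succ (h : ToepPos g (p + 1)) : ToepPos g p := by
  intro x ⟨i, hi, hxi⟩
  have := h (fun k => if k ≤ p then x k else 0) ⟨i, by omega, by simpa [hi] using hxi⟩
  rw [Finset.sum_range_succ] at this
  simp only [show ¬ (p + 1 ≤ p) by omega, if_false, zero_mul, Finset.sum_const_zero, add_zero] at this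
  refine lt_of_lt_of_eq this (Finset.sum_congr rfl fun i hi => ?_)
  rw [Finset.sum_range_succ]
  simp only [show ¬ (p + 1 ≤ p) by omega, if_false, mul_zero, zero_mul, add_zero]
  refine Finset.sum_congr rfl fun j hj => ?_
  simp only [Finset.mem_range] at hi hj
  rw [if_pos (by omega), if_pos (by omega)]

/-- The sesquilinear Toeplitz form. -/
def toepSesq (g : ℤ → ℝ) (p : ℕ) (x y : ℕ → ℂ) : ℂ :=
  ∑ i ∈ Finset.range (p + 1), ∑ j ∈ Finset.range (p + 1), x i * (starRingEnd ℂ) (y j) * (g (i - j) : ℂ)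

theorem toepSesq_sub_smul_left (x y z : ℕ → ℂ) (c : ℂ) :
    toepSesq g p (fun k => x k - c * y k) z = toepSesq g p x z - c * toepSesq g p y z := by
  unfold toepSesq
  rw [Finset.mul_sum, ← Finset.sum_sub_distrib]
  refine Finset.sum_congr rfl fun i _ => ?_
  rw [Finset.mul_sum, ← Finset.sum_sub_distrib]
  exact Finset.sum_congr rfl fun j _ => by ring

theorem toepSesq_conj (hg : ∀ m, g (-m) = g m) (x y : ℕ → ℂ) :
    (starRingEnd ℂ) (toepSesq g p x y) = toepSesq g p y x := by
  unfold toepSesq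
  simp only [map_sum, map_mul, Complex.conj_conj, Complex.conj_ofReal]
  rw [Finset.sum_comm]
  refine Finset.sum_congr rfl fun i _ => Finset.sum_congr rfl fun j _ => ?_
  rw [← hg, neg_sub]; ring

theorem toepSesq_self_re_nonneg (h : ToepPos g p) (x : ℕ → ℂ) : 0 ≤ (toepSesq g p x x).re := by
  have h1 := h.nonneg fun k => (x k).re
  have h2 := h.nonneg fun k => (x k).im
  refine (add_nonneg h1 h2).trans (le_of_eq ?_)
  unfold toepSesq
  rw [Complex.re_sum, ← Finset.sum_add_distrib]
  refine Finset.sum_congr rfl fun i _ => ?_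
  rw [Complex.re_sum, ← Finset.sum_add_distrib]
  refine Finset.sum_congr rfl fun j _ => ?_
  simp [Complex.mul_re]
  ring

/-- The prediction error filter of a positive definite Toeplitz form has no zero in the closed
unit disc. -/
theorem predictor_ne_zero (hg : ∀ m, g (-m) = g m) (hpos : ToepPos g p) (ha0 : a 0 = 1)
    (hyw : YuleWalkerEq a g p) {z : ℂ} (hz : ‖z‖ ≤ 1) :
    ∑ k ∈ Finset.range (p + 1), (a k : ℂ) * z ^ k ≠ 0 := by
  intro hzero
  have hz0 : z ≠ 0 := by
    rintro rfl
    rw [Finset.sum_range_succ'] at hzero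
    simp [ha0] at hzero
  -- If the polynomial vanished at `z`, it would factor as `(1 - ζ / z) U(ζ)`. Here `u` holds the
  -- coefficients of `U` and `v` is `u` shifted by one; `u p = 0` expresses that `z` is a root.
  set u : ℕ → ℂ := fun k => (z⁻¹) ^ k * ∑ j ∈ Finset.range (k + 1), (a j : ℂ) * z ^ j with hu
  set v : ℕ → ℂ := fun k => if k = 0 then 0 else u (k - 1) with hv
  have hup : u p = 0 := by simp only [hu, hzero, mul_zero]
  have ha : (fun k => (a k : ℂ)) = fun k => u k - z⁻¹ * v k := by
    ext k
    rcases k with _ | k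
    · simp [hu, hv]
    · simp only [hu, hv, Nat.add_one_sub_one, Nat.succ_ne_zero, if_false]
      rw [Finset.sum_range_succ _ (k + 1)]
      have : (z⁻¹) ^ (k + 1) * z ^ (k + 1) = 1 := by rw [← mul_pow, inv_mul_cancel₀ hz0, one_pow]
      rw [mul_add, mul_left_comm, this, pow_succ]; ring
  -- The Yule–Walker equations say that `a` is orthogonal to every vector whose entry at `0`
  -- vanishes; `v` is such a vector.
  have hav : toepSesq g p (fun k => (a k : ℂ)) v = 0 := by
    unfold toepSesq
    rw [Finset.sum_comm]
    refine Finset.sum_eq_zero fun j hj => ?_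
    by_cases hj0 : j = 0
    · simp [hv, hj0]
    · have h := hyw j (by omega) (by simp at hj; omega)
      have h' : (∑ i ∈ Finset.range (p + 1), (a i : ℂ) * (g (i - j) : ℂ)) = 0 := by
        rw [← Complex.ofReal_zero, ← h]
        push_cast
        refine Finset.sum_congr rfl fun i _ => ?_
        rw [← hg, neg_sub]
      rw [← mul_zero ((starRingEnd ℂ) (v j)), ← h', Finset.mul_sum]
      exact Finset.sum_congr rfl fun i _ => by ring
  -- Toeplitz forms are invariant under shifts, and nothing falls off the end because `u p = 0`.
  have hvv : toepSesq g p v v = toepSesq g p u u := by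
    unfold toepSesq
    rw [Finset.sum_range_succ', Finset.sum_range_succ (fun i => ∑ j ∈ Finset.range (p + 1), u i * _ * _)]
    simp only [hup, hv, if_true, zero_mul, Finset.sum_const_zero, add_zero]
    refine Finset.sum_congr rfl fun i _ => ?_
    rw [Finset.sum_range_succ', Finset.sum_range_succ]
    simp [hup]
  have huv : toepSesq g p u v = z⁻¹ * toepSesq g p u u := by
    rw [ha, toepSesq_sub_smul_left, hvv] at hav
    linear_combination hav
  have hau : toepSesq g p (fun k => (a k : ℂ)) u
      = toepSesq g p u u - z⁻¹ * ((starRingEnd ℂ) z⁻¹ * toepSesq g p u u) := by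
    rw [ha, toepSesq_sub_smul_left, ← toepSesq_conj hg u v, huv, map_mul, toepSesq_conj hg]
  have haa : toepSesq g p (fun k => (a k : ℂ)) (fun k => (a k : ℂ))
      = toepSesq g p (fun k => (a k : ℂ)) u := by
    rw [← toepSesq_conj hg]
    conv_lhs => enter [2]; rw [ha]
    rw [toepSesq_sub_smul_left, ← ha, map_sub, map_mul, toepSesq_conj hg, toepSesq_conj hg, hav]
    simp
  have hre : (toepSesq g p (fun k => (a k : ℂ)) (fun k => (a k : ℂ))).re
      = ∑ i ∈ Finset.range (p + 1), ∑ j ∈ Finset.range (p + 1), a i * a j * g (i - j) := by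
    unfold toepSesq
    simp only [Complex.conj_ofReal, ← Complex.ofReal_mul, ← Complex.ofReal_sum, Complex.ofReal_re]
  have h1 : 0 < (toepSesq g p (fun k => (a k : ℂ)) (fun k => (a k : ℂ))).re := by
    rw [hre]; exact hpos a ⟨0, by omega, by simp [ha0]⟩
  rw [haa, hau] at h1
  -- Thus the form at `a` is `(1 - |z|⁻²)` times the form at `u`. For `|z| ≤ 1` this is at most
  -- zero, against positive definiteness.
  have h2 : toepSesq g p u u - z⁻¹ * ((starRingEnd ℂ) z⁻¹ * toepSesq g p u u)
      = ((1 - ‖z⁻¹‖ ^ 2 : ℝ) : ℂ) * toepSesq g p u u := by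
    rw [← mul_assoc, Complex.mul_conj, Complex.normSq_eq_norm_sq]
    push_cast; ring
  rw [h2, Complex.re_ofReal_mul] at h1
  have h3 := toepSesq_self_re_nonneg hpos u
  have h4 : 1 ≤ ‖z⁻¹‖ := by
    rw [norm_inv]
    exact (one_le_inv₀ (norm_pos_iff.2 hz0)).2 hz
  have h5 : 1 - ‖z⁻¹‖ ^ 2 ≤ 0 := by nlinarith
  exact absurd h1 (not_lt.2 (mul_nonpos_of_nonpos_of_nonneg h5 h3))

/-- A positive definite sequence is determined, up to scaling, by its prediction error filter. -/
theorem eq_zero_of_yuleWalkerEq (hg : ∀ m, g (-m) = g m) (hd : ∀ m, d (-m) = d m) (hd0 : d 0 = 0) :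
    ∀ (p : ℕ) (a : ℕ → ℝ), ToepPos g p → a 0 ≠ 0 → YuleWalkerEq a g p → YuleWalkerEq a d p →
      ∀ m : ℕ, m ≤ p → d m = 0 := by
  intro p
  induction p with
  | zero =>
    intro a _ _ _ _ m hm
    obtain rfl : m = 0 := by omega
    simpa using hd0
  | succ p ih =>
    intro a hpos ha0 hag had
    have hrev : ∀ f : ℤ → ℝ, (∀ m, f (-m) = f m) → ∀ m : ℕ, m ≤ p + 1 →
        ∑ j ∈ Finset.range (p + 1 + 1), a (p + 1 - j) * f (m - j)
          = ∑ j ∈ Finset.range (p + 1 + 1), a j * f ((p + 1 - m : ℕ) - j) := by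
      intro f hf m hm
      rw [← Finset.sum_range_reflect]
      refine Finset.sum_congr rfl fun j hj => ?_
      simp only [Finset.mem_range] at hj
      have e1 : p + 1 - (p + 1 + 1 - 1 - j) = j := by omega
      rw [e1, ← hf]
      congr 2
      omega
    -- The step-down of the Levinson recursion: combining the filter with its reversal cancels the
    -- last coefficient and keeps the equations of orders `1` to `p`, for `g` and for `d` alike.
    set b : ℕ → ℝ := fun j => a 0 * a j - a (p + 1) * a (p + 1 - j) with hb
    have hbp : b (p + 1) = 0 := by simp [hb]; ring
    have hbf : ∀ f : ℤ → ℝ, (∀ m, f (-m) = f m) → YuleWalkerEq a f (p + 1) → ∀ m : ℕ, 1 ≤ m → m ≤ p →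
        ∑ j ∈ Finset.range (p + 1 + 1), b j * f (m - j) = 0 := by
      intro f hf haf m hm1 hmp
      have h1 := haf m hm1 (by omega)
      have h2 := haf (p + 1 - m) (by omega) (by omega)
      have h3 := hrev f hf m (by omega)
      rw [h2] at h3
      have : ∑ j ∈ Finset.range (p + 1 + 1), b j * f (m - j)
          = a 0 * ∑ j ∈ Finset.range (p + 1 + 1), a j * f (m - j)
            - a (p + 1) * ∑ j ∈ Finset.range (p + 1 + 1), a (p + 1 - j) * f (m - j) := by
        rw [Finset.mul_sum, Finset.mul_sum, ← Finset.sum_sub_distrib]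
        exact Finset.sum_congr rfl fun j _ => by simp only [hb]; ring
      rw [this, h1, h3]; ring
    have hbYW : ∀ f : ℤ → ℝ, (∀ m, f (-m) = f m) → YuleWalkerEq a f (p + 1) → YuleWalkerEq b f p := by
      intro f hf haf m hm1 hmp
      have := hbf f hf haf m hm1 hmp
      rw [Finset.sum_range_succ, hbp, zero_mul, add_zero] at this
      exact this
    have hform : ∀ x : ℕ → ℝ, ∑ i ∈ Finset.range (p + 1 + 1), ∑ j ∈ Finset.range (p + 1 + 1),
        x i * x j * g (i - j)
        = ∑ i ∈ Finset.range (p + 1 + 1), x i * ∑ j ∈ Finset.range (p + 1 + 1), x j * g (i - j) := by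
      intro x
      refine Finset.sum_congr rfl fun i _ => ?_
      rw [Finset.mul_sum]
      exact Finset.sum_congr rfl fun j _ => by ring
    -- If `b 0 = 0`, the form of `g` vanishes at `b`, so `b` is zero by definiteness. Then `a` is
    -- proportional to its reversal, and the equation of order `p + 1` makes the form vanish at `a`
    -- too.
    have hb0 : b 0 ≠ 0 := by
      intro hb0
      have hbz : ∀ i ≤ p + 1, b i = 0 := by
        by_contra hne
        push Not at hne
        have h := hpos b hne
        rw [hform] at h
        refine h.ne' (Finset.sum_eq_zero fun i hi => ?_)
        simp only [Finset.mem_range] at hi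
        by_cases hi0 : i = 0
        · rw [hi0, hb0, zero_mul]
        · by_cases hip : i = p + 1
          · rw [hip, hbp, zero_mul]
          · rw [hbf g hg hag i (by omega) (by omega), mul_zero]
      have h := hpos a ⟨0, by omega, ha0⟩
      rw [hform, Finset.sum_range_succ'] at h
      have h1 : ∑ i ∈ Finset.range (p + 1), a (i + 1) *
          ∑ j ∈ Finset.range (p + 1 + 1), a j * g ((i + 1 : ℕ) - j) = 0 := by
        refine Finset.sum_eq_zero fun i hi => ?_
        simp only [Finset.mem_range] at hi
        rw [hag (i + 1) (by omega) (by omega), mul_zero]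
      rw [h1, zero_add] at h
      refine h.ne' ?_
      have h2 := hag (p + 1) (by omega) le_rfl
      have h3 := hrev g hg 0 (by omega)
      rw [Nat.sub_zero, h2] at h3
      rw [Finset.mul_sum]
      calc _ = ∑ j ∈ Finset.range (p + 1 + 1), a (p + 1) * (a (p + 1 - j) * g ((0 : ℕ) - j)) := by
            refine Finset.sum_congr rfl fun j hj => ?_
            simp only [Finset.mem_range] at hj
            have := hbz j (by omega)
            simp only [hb] at this
            linear_combination g ((0 : ℕ) - j) * this
        _ = 0 := by rw [← Finset.mul_sum, h3, mul_zero]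
    have hlow := ih b hpos.of_succ hb0 (hbYW g hg hag) (hbYW d hd had)
    intro m hm
    by_cases hmp : m ≤ p
    · exact hlow m hmp
    · obtain rfl : m = p + 1 := by omega
      -- The last equation now involves only the top lag, with coefficient `a 0`.
      have h := had (p + 1) (by omega) le_rfl
      rw [Finset.sum_range_succ'] at h
      have h1 : ∑ j ∈ Finset.range (p + 1), a (j + 1) * d ((p + 1 : ℕ) - (j + 1 : ℕ)) = 0 := by
        refine Finset.sum_eq_zero fun j hj => ?_
        simp only [Finset.mem_range] at hj
        have e : ((p + 1 : ℕ) : ℤ) - ((j + 1 : ℕ) : ℤ) = ((p - j : ℕ) : ℤ) := by omega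
        rw [e, hlow (p - j) (by omega), mul_zero]
      rw [h1, zero_add] at h
      simpa [ha0] using h

end YuleWalker

/-! ### The autoregressive spectrum and its Fourier coefficients. -/

section Autoregression

theorem exists_pos_lower_bound {f : ℝ → ℝ} (hf : Continuous f) (hper : Function.Periodic f (2 * Real.pi))
    (hpos : ∀ ν, 0 < f ν) : ∃ m, 0 < m ∧ ∀ ν, m ≤ f ν := by
  have hc := hper.compact_of_continuous (by have := Real.pi_pos; positivity) hf
  obtain ⟨y, ⟨ν₀, rfl⟩, hy⟩ := hc.exists_isLeast (Set.range_nonempty f)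
  exact ⟨f ν₀, hpos ν₀, fun ν => hy ⟨ν, rfl⟩⟩

theorem exists_upper_bound {f : ℝ → ℝ} (hf : Continuous f) (hper : Function.Periodic f (2 * Real.pi)) :
    ∃ M, 0 < M ∧ ∀ ν, f ν ≤ M := by
  have hc := hper.compact_of_continuous (by have := Real.pi_pos; positivity) hf
  obtain ⟨M, hM⟩ := hc.bddAbove
  exact ⟨max M 1, by positivity, fun ν => (hM ⟨ν, rfl⟩).trans (le_max_left _ _)⟩

theorem dft_periodic {n : ℕ} (x : Fin n → ℝ) : Function.Periodic (dft x) (2 * Real.pi) := by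
  intro ν
  unfold dft
  refine Finset.sum_congr rfl fun t _ => ?_
  congr 1
  rw [Complex.exp_eq_exp_iff_exists_int]
  refine ⟨-(t : ℕ), ?_⟩
  push_cast; ring

theorem normSq_fourier_periodic {K : ℕ} (a : Fin (K + 1) → ℝ) :
    Function.Periodic (fun ν => ‖fourier a ν‖ ^ 2) (2 * Real.pi) := by
  intro ν
  simp only [fourier_eq_dft, dft_periodic a ν]

theorem normSq_dft_neg {n : ℕ} (x : Fin n → ℝ) (ν : ℝ) : ‖dft x (-ν)‖ ^ 2 = ‖dft x ν‖ ^ 2 := by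
  rw [normSq_dft, normSq_dft]
  refine Finset.sum_congr rfl fun s _ => Finset.sum_congr rfl fun t _ => ?_
  rw [mul_neg, Real.cos_neg]

variable {p : ℕ} {P : ℝ} {γ : Fin (p + 1) → ℝ}

/-- The lag sequence `γ_{|m|}`, zero beyond lag `p`. -/
def lagSeq (γ : Fin (p + 1) → ℝ) (m : ℤ) : ℝ := zeroExt γ m.natAbs

/-- The coefficients `(1, -φ_1, …, -φ_p)` of the prediction error filter. -/
def arCoef (γ : Fin (p + 1) → ℝ) : Fin (p + 1) → ℝ := Fin.cons 1 fun k => -yuleWalker γ k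

/-- The polynomial with coefficients `a`, as a function on `ℂ`. -/
def polyFun (a : ℕ → ℝ) (p : ℕ) (z : ℂ) : ℂ := ∑ k ∈ Finset.range (p + 1), (a k : ℂ) * z ^ k

theorem lagSeq_neg (m : ℤ) : lagSeq γ (-m) = lagSeq γ m := by simp [lagSeq]

theorem zeroExt_val {m : ℕ} (a : Fin m → ℝ) (k : Fin m) : zeroExt a k = a k := by
  simp [zeroExt]

theorem fourier_eq_polyFun (a : Fin (p + 1) → ℝ) (ν : ℝ) :
    fourier a ν = polyFun (zeroExt a) p (Complex.exp (-(Complex.I * ν))) := by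
  unfold fourier polyFun
  rw [← Fin.sum_univ_eq_sum_range (fun k => (zeroExt a k : ℂ) * (Complex.exp (-(Complex.I * ν))) ^ k)]
  refine Finset.sum_congr rfl fun k _ => ?_
  rw [zeroExt_val, ← Complex.exp_nat_mul]
  congr 2; ring

theorem arGain_eq (γ : Fin (p + 1) → ℝ) (ν : ℝ) : arGain γ ν = ‖fourier (arCoef γ) ν‖ ^ 2 := by
  unfold arGain
  congr 2
  unfold fourier arCoef
  rw [Fin.sum_univ_succ, Fin.sum_univ_succ]
  simp [Finset.sum_neg_distrib, sub_eq_add_neg]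

theorem toepPos_of_posDef (h : (toeplitz γ (p + 1)).PosDef) : ToepPos (lagSeq γ) p := by
  intro x ⟨i, hi, hxi⟩
  have h1 := (Matrix.posDef_iff_dotProduct_mulVec.1 h).2 (x := fun k : Fin (p + 1) => x k)
    (fun h0 => hxi (congrFun h0 ⟨i, by omega⟩))
  rw [← Fin.sum_univ_eq_sum_range (fun i => ∑ j ∈ Finset.range (p + 1), x i * x j * lagSeq γ (i - j))]
  refine lt_of_lt_of_eq h1 ?_
  simp only [dotProduct, Matrix.mulVec, star_trivial]
  refine Finset.sum_congr rfl fun i _ => ?_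
  rw [← Fin.sum_univ_eq_sum_range (fun j => x i * x j * lagSeq γ ((i : ℕ) - j)), Finset.mul_sum]
  refine Finset.sum_congr rfl fun j _ => ?_
  simp only [toeplitz, Matrix.of_apply, lagSeq]
  ring

theorem toeplitz_posDef_of_succ (h : (toeplitz γ (p + 1)).PosDef) : (toeplitz γ p).PosDef := by
  have := h.submatrix (e := Fin.castSucc) (Fin.castSucc_injective p)
  exact this

theorem toeplitz_mulVec_yuleWalker (h : (toeplitz γ (p + 1)).PosDef) (m : Fin p) :
    ∑ k : Fin p, lagSeq γ ((m : ℕ) - (k : ℕ)) * yuleWalker γ k = γ m.succ := by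
  have hdet : IsUnit (toeplitz γ p).det := (toeplitz_posDef_of_succ h).det_pos.ne'.isUnit
  have h1 : (toeplitz γ p).mulVec (yuleWalker γ) = fun m => γ m.succ := by
    unfold yuleWalker
    rw [Matrix.mulVec_mulVec, Matrix.mul_nonsing_inv _ hdet, Matrix.one_mulVec]
  exact congrFun h1 m

theorem yuleWalkerEq_arCoef (h : (toeplitz γ (p + 1)).PosDef) :
    YuleWalkerEq (zeroExt (arCoef γ)) (lagSeq γ) p := by
  intro m hm1 hmp
  obtain ⟨m, rfl⟩ : ∃ m', m = m' + 1 := ⟨m - 1, by omega⟩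
  have h1 := toeplitz_mulVec_yuleWalker h ⟨m, by omega⟩
  rw [← Fin.sum_univ_eq_sum_range (fun j => zeroExt (arCoef γ) j * lagSeq γ ((m + 1 : ℕ) - j)),
    Fin.sum_univ_succ]
  simp only [zeroExt_val]
  have h2 : lagSeq γ ((m + 1 : ℕ) - ((0 : Fin (p + 1)) : ℕ)) = γ (Fin.succ ⟨m, by omega⟩) := by
    have : (((m + 1 : ℕ) : ℤ) - (((0 : Fin (p + 1)) : ℕ) : ℤ)).natAbs = m + 1 := by simp; omega
    rw [lagSeq, this, zeroExt, dif_pos (by omega)]; rfl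
  rw [h2, ← h1]
  simp only [arCoef, Fin.cons_zero, Fin.cons_succ, one_mul, neg_mul, Finset.sum_neg_distrib]
  rw [← sub_eq_add_neg, sub_eq_zero]
  refine Finset.sum_congr rfl fun k _ => ?_
  rw [mul_comm]
  congr 2
  simp

theorem polyFun_ne_zero (h : (toeplitz γ (p + 1)).PosDef) {z : ℂ} (hz : ‖z‖ ≤ 1) :
    polyFun (zeroExt (arCoef γ)) p z ≠ 0 :=
  predictor_ne_zero lagSeq_neg (toepPos_of_posDef h) (by simp [zeroExt, arCoef])
    (yuleWalkerEq_arCoef h) hz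

theorem norm_exp_neg_I_mul (ν : ℝ) : ‖Complex.exp (-(Complex.I * ν))‖ = 1 := by
  have : -(Complex.I * (ν : ℂ)) = ((-ν : ℝ) : ℂ) * Complex.I := by push_cast; ring
  rw [this, Complex.norm_exp_ofReal_mul_I]

theorem arGain_pos (h : (toeplitz γ (p + 1)).PosDef) (ν : ℝ) : 0 < arGain γ ν := by
  rw [arGain_eq, fourier_eq_polyFun]
  have := polyFun_ne_zero h (norm_exp_neg_I_mul ν).le
  positivity

@[fun_prop]
theorem continuous_arGain (γ : Fin (p + 1) → ℝ) : Continuous (arGain γ) := by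
  have : arGain γ = fun ν => ‖fourier (arCoef γ) ν‖ ^ 2 := funext (arGain_eq γ)
  rw [this]; fun_prop

theorem arGain_periodic (γ : Fin (p + 1) → ℝ) : Function.Periodic (arGain γ) (2 * Real.pi) := by
  have : arGain γ = fun ν => ‖fourier (arCoef γ) ν‖ ^ 2 := funext (arGain_eq γ)
  rw [this]; exact normSq_fourier_periodic _

theorem continuous_inv_arGain (h : (toeplitz γ (p + 1)).PosDef) :
    Continuous fun ν => 1 / arGain γ ν :=
  continuous_const.div (continuous_arGain γ) fun ν => (arGain_pos h ν).ne'

theorem cmean_inv_arGain_pos (h : (toeplitz γ (p + 1)).PosDef) : 0 < cmean fun ν => 1 / arGain γ ν :=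
  cmean_pos (continuous_inv_arGain h) fun ν => one_div_pos.2 (arGain_pos h ν)

theorem posDef_zero_pos (h : (toeplitz γ (p + 1)).PosDef) : 0 < γ 0 := by
  have := h.diag_pos (i := 0)
  simpa [toeplitz, zeroExt] using this

theorem etaSq_eq (γ : Fin (p + 1) → ℝ) : etaSq γ = γ 0 * (cmean fun ν => 1 / arGain γ ν)⁻¹ := rfl

theorem etaSq_pos (h : (toeplitz γ (p + 1)).PosDef) : 0 < etaSq γ :=
  mul_pos (posDef_zero_pos h) (inv_pos.2 (cmean_inv_arGain_pos h))

theorem specX_pos (h : (toeplitz γ (p + 1)).PosDef) (ν : ℝ) : 0 < specX γ ν :=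
  div_pos (etaSq_pos h) (arGain_pos h ν)

theorem continuous_specX (h : (toeplitz γ (p + 1)).PosDef) : Continuous (specX γ) :=
  continuous_const.div (continuous_arGain γ) fun ν => (arGain_pos h ν).ne'

theorem specX_periodic (γ : Fin (p + 1) → ℝ) : Function.Periodic (specX γ) (2 * Real.pi) := by
  intro ν
  simp only [specX, arGain_periodic γ ν]

theorem cmean_specX (h : (toeplitz γ (p + 1)).PosDef) : cmean (specX γ) = γ 0 := by
  have h1 : specX γ = fun ν => etaSq γ * (1 / arGain γ ν) := by ext ν; simp [specX]; ring
  rw [h1, cmean_const_mul, etaSq_eq, mul_assoc, inv_mul_cancel₀ (cmean_inv_arGain_pos h).ne', mul_one]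

open InnerProductSpace Metric in
/-- The mean value property of harmonic functions, along `ν ↦ e^{-jν}`. -/
theorem cmean_harmonic {F : ℂ → ℝ} (hF : HarmonicOnNhd F (closedBall 0 1))
    (hconj : ∀ z, F ((starRingEnd ℂ) z) = F z) :
    cmean (fun ν => F (Complex.exp (-(Complex.I * ν)))) = F 0 := by
  have h1 : Real.circleAverage F 0 1 = F 0 := by
    apply InnerProductSpace.HarmonicOnNhd.circleAverage_eq
    simpa using hF
  rw [← h1, Real.circleAverage_def]
  unfold cmean
  rw [one_div, smul_eq_mul]
  congr 1
  refine intervalIntegral.integral_congr fun ν _ => ?_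
  -- The transform runs through the circle clockwise, `circleMap` counterclockwise; conjugation
  -- symmetry of `F` reconciles them.
  rw [← hconj, ← Complex.exp_conj]
  congr 1
  simp [circleMap, mul_comm]

theorem polyFun_conj (a : ℕ → ℝ) (p : ℕ) (z : ℂ) :
    polyFun a p ((starRingEnd ℂ) z) = (starRingEnd ℂ) (polyFun a p z) := by
  simp [polyFun, map_sum]

theorem analyticAt_polyFun (a : ℕ → ℝ) (p : ℕ) (z : ℂ) : AnalyticAt ℂ (polyFun a p) z := by
  unfold polyFun
  fun_prop

/-- The logarithm of the modulus of a polynomial without zeros in the closed disc is harmonic there,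
so its mean is its value at the origin, where the prediction polynomial equals `1`. -/
theorem cmean_log_arGain (h : (toeplitz γ (p + 1)).PosDef) :
    cmean (fun ν => Real.log (arGain γ ν)) = 0 := by
  have h1 := cmean_harmonic (F := fun z => Real.log ‖polyFun (zeroExt (arCoef γ)) p z‖)
    (fun z hz => (analyticAt_polyFun _ _ z).harmonicAt_log_norm
      (polyFun_ne_zero h (by simpa using hz))) (fun z => by rw [polyFun_conj, Complex.norm_conj])
  have h2 : (fun ν => Real.log (arGain γ ν))
      = fun ν : ℝ => 2 * Real.log ‖polyFun (zeroExt (arCoef γ)) p (Complex.exp (-(Complex.I * ν)))‖ := by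
    ext ν
    rw [arGain_eq, fourier_eq_polyFun, Real.log_pow]; simp
  rw [h2, cmean_const_mul, h1]
  have h3 : polyFun (zeroExt (arCoef γ)) p 0 = 1 := by
    unfold polyFun
    rw [Finset.sum_range_succ']
    simp [zeroExt, arCoef]
  rw [h3]; simp

/-- Kolmogorov's formula: the geometric mean of the spectrum is the prediction error variance. This
is where `η²` enters the rate. -/
theorem cmean_log_specX (h : (toeplitz γ (p + 1)).PosDef) :
    cmean (fun ν => Real.log (specX γ ν)) = Real.log (etaSq γ) := by
  have h1 : (fun ν => Real.log (specX γ ν)) = fun ν => Real.log (etaSq γ) - Real.log (arGain γ ν) := by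
    ext ν
    rw [specX, Real.log_div (etaSq_pos h).ne' (arGain_pos h ν).ne']
  rw [h1, cmean_sub (by fun_prop) ((continuous_arGain γ).log fun ν => (arGain_pos h ν).ne'),
    cmean_const, cmean_log_arGain h, sub_zero]

/-- The Fourier coefficients of `S_X`. -/
def covX (γ : Fin (p + 1) → ℝ) (m : ℤ) : ℝ := cmean fun ν => specX γ ν * Real.cos (m * ν)

theorem covX_neg (m : ℤ) : covX γ (-m) = covX γ m := by
  unfold covX
  congr 1; ext ν
  push_cast
  rw [neg_mul, Real.cos_neg]

theorem covX_zero (h : (toeplitz γ (p + 1)).PosDef) : covX γ 0 = γ 0 := by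
  simp [covX, cmean_specX h]

/-- Since `S_X = η² / |A|²` on the circle, the sum is `η²` times the mean of the real part of `z^m /
A(z)`. This function is holomorphic near the closed disc and vanishes at `0` when `m ≥ 1`. -/
theorem covX_recursion (h : (toeplitz γ (p + 1)).PosDef) (m : ℕ) (hm : 1 ≤ m) :
    ∑ j ∈ Finset.range (p + 1), zeroExt (arCoef γ) j * covX γ (m - j) = 0 := by
  have hc := continuous_specX h
  unfold covX
  simp_rw [← cmean_const_mul]
  rw [← cmean_sum _ (fun j _ => by fun_prop)]
  have h1 := cmean_harmonic (F := fun z => (z ^ m / polyFun (zeroExt (arCoef γ)) p z).re)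
    (fun z hz => AnalyticAt.harmonicAt_re (AnalyticAt.div (by fun_prop) (analyticAt_polyFun _ _ z)
      (polyFun_ne_zero h (by simpa using hz)))) (fun z => by
        rw [polyFun_conj, ← map_pow, ← map_div₀, Complex.conj_re])
  have h2 : (fun ν => ∑ j ∈ Finset.range (p + 1), zeroExt (arCoef γ) j *
      (specX γ ν * Real.cos (((m : ℤ) - (j : ℤ) : ℤ) * ν)))
      = fun ν : ℝ => etaSq γ * (Complex.exp (-(Complex.I * ν)) ^ m /
        polyFun (zeroExt (arCoef γ)) p (Complex.exp (-(Complex.I * ν)))).re := by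
    ext ν
    have e1 : ∑ j ∈ Finset.range (p + 1), zeroExt (arCoef γ) j *
      (specX γ ν * Real.cos (((m : ℤ) - (j : ℤ) : ℤ) * ν))
        = specX γ ν * (Complex.exp (-(Complex.I * ν)) ^ m *
          (starRingEnd ℂ) (fourier (arCoef γ) ν)).re := by
      rw [fourier_eq_polyFun, polyFun, map_sum, Finset.mul_sum, Complex.re_sum, Finset.mul_sum]
      refine Finset.sum_congr rfl fun j _ => ?_
      rw [← re_exp_mul_conj_exp, map_mul, Complex.conj_ofReal,
        mul_left_comm (Complex.exp _ ^ m), Complex.re_ofReal_mul, ← Complex.exp_nat_mul, ← Complex.exp_nat_mul]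
      have : ∀ k : ℕ, (k : ℂ) * -(Complex.I * ν) = -(Complex.I * k * ν) := fun k => by ring
      rw [this, this]; ring
    rw [e1, specX, arGain_eq, ← fourier_eq_polyFun]
    have hne : fourier (arCoef γ) ν ≠ 0 := by
      rw [fourier_eq_polyFun]; exact polyFun_ne_zero h (norm_exp_neg_I_mul ν).le
    rw [div_mul_eq_mul_div, mul_div_assoc]
    congr 1
    rw [div_eq_mul_inv (Complex.exp _ ^ m), Complex.inv_def, ← mul_assoc, mul_comm _ (((Complex.normSq _)⁻¹ : ℝ) : ℂ),
      Complex.re_ofReal_mul, Complex.normSq_eq_norm_sq]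
    ring
  rw [h2, cmean_const_mul, h1]
  simp [show m ≠ 0 by omega]

/-- The difference of the two sequences satisfies the same Yule–Walker equations and is zero at lag
`0`, so the uniqueness result kills it. -/
theorem covX_eq_of_le (h : (toeplitz γ (p + 1)).PosDef) (m : Fin (p + 1)) : covX γ (m : ℕ) = γ m := by
  have h1 := eq_zero_of_yuleWalkerEq (g := lagSeq γ) (d := fun m => lagSeq γ m - covX γ m) lagSeq_neg
    (fun m => by rw [lagSeq_neg, covX_neg]) (by
      rw [covX_zero h]; simp [lagSeq, zeroExt]) p (zeroExt (arCoef γ)) (toepPos_of_posDef h)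
    (by simp [zeroExt, arCoef]) (yuleWalkerEq_arCoef h) (fun m hm1 hmp => by
      have e1 := yuleWalkerEq_arCoef h m hm1 hmp
      have e2 := covX_recursion h m hm1
      simp only [mul_sub, Finset.sum_sub_distrib]
      rw [e1, e2, sub_zero]) m (by omega)
  have h2 : lagSeq γ ((m : ℕ) : ℤ) = γ m := zeroExt_val γ m
  rw [h2] at h1
  linarith

/-- The continued autocovariances are the Fourier coefficients of the autoregressive spectrum. -/
theorem covX_eq_autocov (h : (toeplitz γ (p + 1)).PosDef) (m : ℕ) : covX γ m = autocov γ m := by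
  induction m using Nat.strong_induction_on with
  | _ m ih =>
    rw [autocov]
    split_ifs with hm
    · exact covX_eq_of_le h ⟨m, hm⟩
    · have h1 := covX_recursion h m (by omega)
      rw [← Fin.sum_univ_eq_sum_range (fun j => zeroExt (arCoef γ) j * covX γ (m - j)),
        Fin.sum_univ_succ] at h1
      simp only [zeroExt_val] at h1
      simp only [arCoef, Fin.cons_zero, Fin.cons_succ, one_mul, neg_mul,
        Finset.sum_neg_distrib, Fin.val_zero, Nat.cast_zero, sub_zero] at h1
      rw [← sub_eq_add_neg, sub_eq_zero] at h1
      rw [h1]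
      refine Finset.sum_congr rfl fun k _ => ?_
      have hk := k.2
      rw [← ih (m - (k + 1)) (by omega)]
      congr 2
      simp; omega

end Autoregression

/-! ### Fejér's theorem for the mean periodogram. -/

section Fejer

variable {n : ℕ} {S : ℝ → ℝ}

theorem sum_ite_lag (n k : ℕ) :
    ∑ s : Fin n, ∑ t : Fin n, (if (t : ℕ) + k = s then (1 : ℝ) else 0) = ((n - k : ℕ) : ℝ) := by
  have h1 := lagCorr_eq_sum' (fun _ : Fin n => (1 : ℝ)) k
  simp only [mul_one] at h1
  rw [← h1]
  simp only [lagCorr, delay, one_mul]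
  rw [Fin.sum_univ_eq_sum_range (fun t => if k ≤ t then (1 : ℝ) else 0), ← Finset.sum_filter,
    Finset.sum_const, nsmul_eq_mul, mul_one]
  congr 1
  have : Finset.filter (fun t => k ≤ t) (Finset.range n) = Finset.Ico k n := by
    ext t; simp; omega
  rw [this, Nat.card_Ico]

theorem sum_toepMat_lag (S : ℝ → ℝ) (n k : ℕ) :
    ∑ s : Fin n, ∑ t : Fin n, (if (t : ℕ) + k = s then toepMat S n s t else 0)
      = ((n - k : ℕ) : ℝ) * cmean fun ν => S ν * Real.cos (k * ν) := by
  rw [← sum_ite_lag, Finset.sum_mul]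
  refine Finset.sum_congr rfl fun s _ => ?_
  rw [Finset.sum_mul]
  refine Finset.sum_congr rfl fun t _ => ?_
  split_ifs with h
  · rw [one_mul, toepMat, Matrix.of_apply]
    congr 1; ext ν
    rw [← h]; push_cast; congr 3; ring
  · simp

/-- The expected periodogram of a stationary block with spectrum `S`. -/
def meanPeriodogram (S : ℝ → ℝ) (n : ℕ) (ν : ℝ) : ℝ :=
  ∑ s : Fin n, ∑ t : Fin n, toepMat S n s t * Real.cos ((((s : ℕ) : ℤ) - ((t : ℕ) : ℤ) : ℤ) * ν)

@[fun_prop]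
theorem continuous_meanPeriodogram (S : ℝ → ℝ) (n : ℕ) : Continuous (meanPeriodogram S n) := by
  unfold meanPeriodogram; fun_prop

/-- This is the expected correlation of `C z` for a standard Gaussian `z`. The weight is `n - k`
because only `n - k` pairs of positions differ by `k`. -/
theorem sum_lagCorr_factor {C : Matrix (Fin n) (Fin n) ℝ} (hC : C * C.transpose = toepMat S n) (k : ℕ) :
    ∑ i, lagCorr (fun j => C j i) k = ((n - k : ℕ) : ℝ) * cmean fun ν => S ν * Real.cos (k * ν) := by
  simp_rw [lagCorr_eq_sum']
  rw [← sum_toepMat_lag, Finset.sum_comm]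
  refine Finset.sum_congr rfl fun s _ => ?_
  rw [Finset.sum_comm]
  refine Finset.sum_congr rfl fun t _ => ?_
  split_ifs with h
  · rw [← hC, Matrix.mul_apply]; rfl
  · simp

theorem sum_normSq_dft_factor {C : Matrix (Fin n) (Fin n) ℝ} (hC : C * C.transpose = toepMat S n) (ν : ℝ) :
    ∑ i, ‖dft (fun j => C j i) ν‖ ^ 2 = meanPeriodogram S n ν := by
  simp_rw [normSq_dft]
  rw [Finset.sum_comm]
  refine Finset.sum_congr rfl fun s _ => ?_
  rw [Finset.sum_comm]
  refine Finset.sum_congr rfl fun t _ => ?_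
  rw [← Finset.sum_mul, ← hC, Matrix.mul_apply]; rfl

theorem meanPeriodogram_nonneg {m : ℝ} (hS : Continuous S) (hm0 : 0 < m) (hm : ∀ ν, m ≤ S ν) (n : ℕ)
    (ν : ℝ) : 0 ≤ meanPeriodogram S n ν := by
  obtain ⟨C, hC, -, -⟩ := exists_factor_toepMat hS hm0 hm n
  rw [← sum_normSq_dft_factor hC]
  exact Finset.sum_nonneg fun i _ => sq_nonneg _

theorem cmean_cos_mul_meanPeriodogram (S : ℝ → ℝ) (n k : ℕ) :
    cmean (fun ν => Real.cos (k * ν) * meanPeriodogram S n ν)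
      = ((n - k : ℕ) : ℝ) * cmean fun ν => S ν * Real.cos (k * ν) := by
  have h2 : ∀ r : ℝ, r = 1 / 2 * (r + r) := fun r => by ring
  have hsymm : ∀ s t : Fin n, toepMat S n s t = toepMat S n t s := fun s t => by
    simpa using (toepMat_isHermitian S n).apply t s
  have h3 : ∑ s : Fin n, ∑ t : Fin n, (if (s : ℕ) + k = t then toepMat S n s t else 0)
      = ((n - k : ℕ) : ℝ) * cmean fun ν => S ν * Real.cos (k * ν) := by
    rw [← sum_toepMat_lag, Finset.sum_comm]
    refine Finset.sum_congr rfl fun s _ => Finset.sum_congr rfl fun t _ => ?_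
    rw [hsymm]
  rw [h2 (((n - k : ℕ) : ℝ) * cmean fun ν => S ν * Real.cos (k * ν))]
  nth_rewrite 1 [← h3]
  rw [← sum_toepMat_lag, ← Finset.sum_add_distrib, Finset.mul_sum]
  unfold meanPeriodogram
  simp_rw [Finset.mul_sum]
  rw [cmean_sum _ (fun s _ => by fun_prop)]
  refine Finset.sum_congr rfl fun s _ => ?_
  rw [cmean_sum _ (fun s _ => by fun_prop), ← Finset.sum_add_distrib, Finset.mul_sum]
  refine Finset.sum_congr rfl fun t _ => ?_
  have h : (fun ν : ℝ => Real.cos (k * ν) * (toepMat S n s t *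
        Real.cos ((((s : ℕ) : ℤ) - ((t : ℕ) : ℤ) : ℤ) * ν)))
      = fun ν => toepMat S n s t * (Real.cos (((k : ℤ) : ℝ) * ν) *
        Real.cos ((((s : ℕ) : ℤ) - ((t : ℕ) : ℤ) : ℤ) * ν)) := by
    ext ν; push_cast; ring
  rw [h, cmean_const_mul, cmean_cos_mul_cos]
  have e1 : ((k : ℤ) + (((s : ℕ) : ℤ) - ((t : ℕ) : ℤ)) = 0) ↔ ((s : ℕ) + k = t) := by omega
  have e2 : ((k : ℤ) - (((s : ℕ) : ℤ) - ((t : ℕ) : ℤ)) = 0) ↔ ((t : ℕ) + k = s) := by omega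
  simp only [e1, e2]
  split_ifs <;> ring

/-- Weak convergence of the mean periodogram against the test function `h`. -/
def PeriodogramLim (S h : ℝ → ℝ) : Prop :=
  Tendsto (fun n : ℕ => 1 / (n : ℝ) * cmean fun ν => h ν * meanPeriodogram S n ν) atTop
    (𝓝 (cmean fun ν => h ν * S ν))

/-- The Fejér weight `(n - k) / n` of a fixed frequency tends to `1`. -/
theorem periodogramLim_cos (S : ℝ → ℝ) (k : ℤ) : PeriodogramLim S fun ν => Real.cos (k * ν) := by
  have hk : ∀ ν : ℝ, Real.cos (k * ν) = Real.cos ((k.natAbs : ℕ) * ν) := by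
    intro ν
    rw [Nat.cast_natAbs, Int.cast_abs]
    rcases abs_choice (k : ℝ) with h | h
    · rw [h]
    · rw [h, neg_mul, Real.cos_neg]
  unfold PeriodogramLim
  simp_rw [hk, cmean_cos_mul_meanPeriodogram]
  set c := cmean fun ν => S ν * Real.cos ((k.natAbs : ℕ) * ν) with hc
  have e : (cmean fun ν => Real.cos ((k.natAbs : ℕ) * ν) * S ν) = c := by
    rw [hc]; congr 1; ext ν; ring
  rw [e]
  have h1 : Tendsto (fun n : ℕ => c - ((k.natAbs : ℕ) : ℝ) * c * (1 / (n : ℝ))) atTop (𝓝 (c - ((k.natAbs : ℕ) : ℝ) * c * 0)) :=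
    tendsto_const_nhds.sub (tendsto_const_nhds.mul tendsto_one_div_atTop_nhds_zero_nat)
  rw [mul_zero, sub_zero] at h1
  refine h1.congr' ?_
  filter_upwards [eventually_ge_atTop (k.natAbs + 1)] with n hn
  have hn0 : (n : ℝ) ≠ 0 := by
    have : n ≠ 0 := by omega
    exact_mod_cast this
  rw [Nat.cast_sub (by omega)]
  field_simp

theorem PeriodogramLim.add {S h₁ h₂ : ℝ → ℝ} (hS : Continuous S) (c₁ : Continuous h₁) (c₂ : Continuous h₂)
    (H₁ : PeriodogramLim S h₁) (H₂ : PeriodogramLim S h₂) : PeriodogramLim S fun ν => h₁ ν + h₂ ν := by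
  unfold PeriodogramLim at *
  simp_rw [add_mul]
  rw [cmean_add (by fun_prop) (by fun_prop)]
  refine (H₁.add H₂).congr fun n => ?_
  rw [cmean_add (by fun_prop) (by fun_prop), mul_add]

theorem PeriodogramLim.const_mul {S h : ℝ → ℝ} (c : ℝ) (H : PeriodogramLim S h) :
    PeriodogramLim S fun ν => c * h ν := by
  unfold PeriodogramLim at *
  simp_rw [mul_assoc, cmean_const_mul]
  refine (H.const_mul c).congr fun n => ?_
  ring

/-- Induction on the power by the product formula, which shifts `k` both ways; the frequency is
therefore an arbitrary integer. -/
theorem periodogramLim_cos_pow_mul_cos (hS : Continuous S) (j : ℕ) :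
    ∀ k : ℤ, PeriodogramLim S fun ν => Real.cos ν ^ j * Real.cos (k * ν) := by
  induction j with
  | zero => intro k; simpa using periodogramLim_cos S k
  | succ j ih =>
    intro k
    have h := ((ih (k + 1)).add hS (by fun_prop) (by fun_prop) (ih (k - 1))).const_mul (1 / 2)
    convert h using 2 with ν
    push_cast
    rw [add_mul, sub_mul, one_mul, Real.cos_add, Real.cos_sub]
    ring

theorem periodogramLim_polynomial_cos (hS : Continuous S) (q : Polynomial ℝ) :
    PeriodogramLim S fun ν => q.eval (Real.cos ν) := by
  induction q using Polynomial.induction_on' with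
  | add q₁ q₂ h₁ h₂ =>
    simp only [Polynomial.eval_add]
    exact h₁.add hS (q₁.continuous.comp Real.continuous_cos) (q₂.continuous.comp Real.continuous_cos) h₂
  | monomial j c =>
    have h := (periodogramLim_cos_pow_mul_cos hS j 0).const_mul c
    simpa using h

/-- An even periodic function is a function of `cos ν` on `[-1, 1]`, so the Weierstrass theorem for
ordinary polynomials serves for trigonometric approximation. -/
theorem eq_comp_arccos_cos {f : ℝ → ℝ} (hper : Function.Periodic f (2 * Real.pi))
    (heven : ∀ ν, f (-ν) = f ν) (ν : ℝ) : f ν = f (Real.arccos (Real.cos ν)) := by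
  have h : Real.cos (Real.arccos (Real.cos ν)) = Real.cos ν :=
    Real.cos_arccos (Real.neg_one_le_cos ν) (Real.cos_le_one ν)
  obtain ⟨k, hk | hk⟩ := Real.cos_eq_cos_iff.1 h
  · conv_lhs => rw [hk, add_comm, show 2 * (k : ℝ) * Real.pi = k * (2 * Real.pi) by ring]
    exact hper.int_mul k _
  · conv_lhs => rw [hk, sub_eq_neg_add, show 2 * (k : ℝ) * Real.pi = k * (2 * Real.pi) by ring]
    rw [hper.int_mul k _, heven]

/-- The mean periodogram converges weakly to the spectrum: upper bound for even test functions. -/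
theorem cmean_mul_meanPeriodogram_le {m : ℝ} (hS : Continuous S) (hm0 : 0 < m) (hm : ∀ ν, m ≤ S ν)
    {f : ℝ → ℝ} (hf : Continuous f) (hper : Function.Periodic f (2 * Real.pi))
    (heven : ∀ ν, f (-ν) = f ν) {κ : ℝ} (hκ : 0 < κ) :
    ∀ᶠ n : ℕ in atTop, cmean (fun ν => f ν * meanPeriodogram S n ν)
      ≤ n * (cmean (fun ν => f ν * S ν) + κ) := by
  set c := cmean S with hc
  have hc0 : 0 < c := cmean_pos hS fun ν => hm0.trans_le (hm ν)
  -- The spectrum has mass `c` and the mean periodogram mass `n * c`, so this accuracy costs `κ / 4`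
  -- on each side and leaves room for the limit.
  obtain ⟨q, hq⟩ := exists_polynomial_near_of_continuousOn (-1) 1 (fun u => f (Real.arccos u))
    (hf.comp Real.continuous_arccos).continuousOn (κ / (4 * c)) (by positivity)
  have hq' : ∀ ν, |q.eval (Real.cos ν) - f ν| ≤ κ / (4 * c) := by
    intro ν
    rw [eq_comp_arccos_cos hper heven ν]
    exact (hq _ ⟨Real.neg_one_le_cos ν, Real.cos_le_one ν⟩).le
  have hqc : Continuous fun ν => q.eval (Real.cos ν) := q.continuous.comp Real.continuous_cos
  have hlim := periodogramLim_polynomial_cos hS q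
  have hub : (cmean fun ν => q.eval (Real.cos ν) * S ν) ≤ cmean (fun ν => f ν * S ν) + κ / 4 := by
    have : cmean (fun ν => q.eval (Real.cos ν) * S ν) ≤ cmean (fun ν => f ν * S ν + κ / (4 * c) * S ν) := by
      refine cmean_mono (by fun_prop) (by fun_prop) fun ν => ?_
      rw [← add_mul]
      refine mul_le_mul_of_nonneg_right ?_ (hm0.le.trans (hm ν))
      have := (abs_le.1 (hq' ν)).2
      linarith
    rw [cmean_add (by fun_prop) (by fun_prop), cmean_const_mul, ← hc] at this
    have e : κ / (4 * c) * c = κ / 4 := by field_simp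
    rw [e] at this
    exact this
  have hev := hlim.eventually (eventually_lt_nhds (lt_of_le_of_lt hub
    (show cmean (fun ν => f ν * S ν) + κ / 4 < cmean (fun ν => f ν * S ν) + κ / 2 by linarith)))
  filter_upwards [hev, eventually_gt_atTop 0] with n hn hn0
  have hn0' : (0 : ℝ) < n := by exact_mod_cast hn0
  rw [one_div, inv_mul_lt_iff₀ hn0'] at hn
  have h1 : cmean (fun ν => f ν * meanPeriodogram S n ν)
      ≤ cmean (fun ν => q.eval (Real.cos ν) * meanPeriodogram S n ν + κ / (4 * c) * meanPeriodogram S n ν) := by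
    refine cmean_mono (by fun_prop) (by fun_prop) fun ν => ?_
    rw [← add_mul]
    refine mul_le_mul_of_nonneg_right ?_ (meanPeriodogram_nonneg hS hm0 hm n ν)
    have := (abs_le.1 (hq' ν)).1
    linarith
  rw [cmean_add (by fun_prop) (by fun_prop), cmean_const_mul] at h1
  have h2 : cmean (meanPeriodogram S n) = n * c := by
    have := cmean_cos_mul_meanPeriodogram S n 0
    simpa using this
  rw [h2] at h1
  have e : κ / (4 * c) * (n * c) = n * (κ / 4) := by field_simp
  rw [e] at h1
  nlinarith

end Fejer

/-! ### Homogeneous quadratic functions of Gaussian vectors and their tails. -/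

section Quadratic

open Matrix

variable {ι : Type*} [Fintype ι]

/-- `S` is a homogeneous quadratic polynomial. -/
def IsQuad (S : (ι → ℝ) → ℝ) : Prop := ∃ B : Matrix ι ι ℝ, ∀ v, S v = v ⬝ᵥ (B *ᵥ v)

theorem IsQuad.add {S T : (ι → ℝ) → ℝ} (hS : IsQuad S) (hT : IsQuad T) :
    IsQuad fun v => S v + T v := by
  obtain ⟨A, hA⟩ := hS
  obtain ⟨B, hB⟩ := hT
  exact ⟨A + B, fun v => by simp only [hA, hB, Matrix.add_mulVec, dotProduct_add]⟩

theorem IsQuad.const_mul {S : (ι → ℝ) → ℝ} (c : ℝ) (hS : IsQuad S) : IsQuad fun v => c * S v := by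
  obtain ⟨A, hA⟩ := hS
  exact ⟨c • A, fun v => by simp only [hA, Matrix.smul_mulVec, dotProduct_smul, smul_eq_mul]⟩

theorem IsQuad.sub {S T : (ι → ℝ) → ℝ} (hS : IsQuad S) (hT : IsQuad T) :
    IsQuad fun v => S v - T v := by
  have := hS.add (hT.const_mul (-1))
  simpa [sub_eq_add_neg] using this

theorem IsQuad.sum {κ : Type*} (s : Finset κ) {S : κ → (ι → ℝ) → ℝ} (hS : ∀ k ∈ s, IsQuad (S k)) :
    IsQuad fun v => ∑ k ∈ s, S k v := by
  classical
  induction s using Finset.induction_on with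
  | empty => exact ⟨0, fun v => by simp⟩
  | insert k s hk ih =>
    simp only [Finset.sum_insert hk]
    exact (hS k (by simp)).add (ih fun j hj => hS j (by simp [hj]))

theorem IsQuad.measurable {S : (ι → ℝ) → ℝ} (hS : IsQuad S) : Measurable S := by
  obtain ⟨A, hA⟩ := hS
  have : S = fun v => v ⬝ᵥ (A *ᵥ v) := funext hA
  rw [this]
  unfold Matrix.mulVec dotProduct
  fun_prop

variable [DecidableEq ι]

theorem isLinearMap_eq_dotProduct {l : (ι → ℝ) → ℝ} (hl : IsLinearMap ℝ l) (v : ι → ℝ) :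
    l v = (fun i => l (Pi.single i 1)) ⬝ᵥ v := by
  have h1 : v = ∑ i, v i • (Pi.single i 1 : ι → ℝ) := by
    ext j; simp [Finset.sum_apply, Pi.single_apply]
  conv_lhs => rw [h1]
  have := map_sum (hl.mk' l) (fun i => v i • (Pi.single i 1 : ι → ℝ)) Finset.univ
  simp only [IsLinearMap.mk'_apply] at this
  rw [this]
  simp only [dotProduct, hl.map_smul, smul_eq_mul]
  exact Finset.sum_congr rfl fun i _ => mul_comm _ _

theorem isQuad_mul {l₁ l₂ : (ι → ℝ) → ℝ} (h₁ : IsLinearMap ℝ l₁) (h₂ : IsLinearMap ℝ l₂) :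
    IsQuad fun v => l₁ v * l₂ v := by
  refine ⟨Matrix.vecMulVec (fun i => l₁ (Pi.single i 1)) (fun i => l₂ (Pi.single i 1)), fun v => ?_⟩
  beta_reduce
  rw [isLinearMap_eq_dotProduct h₁, isLinearMap_eq_dotProduct h₂, Matrix.vecMulVec_mulVec]
  simp [dotProduct_comm v, mul_comm]

/-- Symmetrizing the matrix does not change the form. Its trace, the expectation, is read off from
the values at the unit vectors, so later no matrix has to be written down. -/
theorem lintegral_exp_isQuad_le {S : (ι → ℝ) → ℝ} (hS : IsQuad S) {C s : ℝ}
    (hC : ∀ v, |S v| ≤ C * ∑ i, v i ^ 2) (hs : |s| * C ≤ 1 / 4) :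
    ∫⁻ v, ENNReal.ofReal (Real.exp (s * S v)) ∂(stdGauss ι)
      ≤ ENNReal.ofReal (Real.exp (s * ∑ i, S (Pi.single i 1) + 2 * s ^ 2 * C ^ 2 * Fintype.card ι)) := by
  obtain ⟨A, hA⟩ := hS
  set B : Matrix ι ι ℝ := (1 / 2 : ℝ) • (A + Aᵀ) with hB
  have hBh : B.IsHermitian := by
    rw [Matrix.IsHermitian, Matrix.conjTranspose_eq_transpose_of_trivial, hB, Matrix.transpose_smul,
      Matrix.transpose_add, Matrix.transpose_transpose, add_comm]
  have hSB : ∀ v, S v = v ⬝ᵥ (B *ᵥ v) := by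
    intro v
    have h1 : v ⬝ᵥ (Aᵀ *ᵥ v) = v ⬝ᵥ (A *ᵥ v) := by
      rw [Matrix.mulVec_transpose, dotProduct_comm, ← Matrix.dotProduct_mulVec]
    rw [hB, Matrix.smul_mulVec, dotProduct_smul, Matrix.add_mulVec, dotProduct_add, h1, hA, smul_eq_mul]
    ring
  have htr : ∑ i, S (Pi.single i 1) = B.trace := by
    simp only [Matrix.trace, Matrix.diag]
    refine Finset.sum_congr rfl fun i _ => ?_
    rw [hSB]
    simp
  rw [htr]
  simp_rw [hSB]
  refine lintegral_exp_quadForm_le hBh (fun v => ?_) hs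
  rw [← hSB]
  refine (hC v).trans (le_of_eq ?_)
  simp [dotProduct, sq]

/-- Upper tail of a bounded quadratic form under the standard Gaussian measure. -/
theorem stdGauss_isQuad_ge_le {S : (ι → ℝ) → ℝ} (hS : IsQuad S) {C κ a : ℝ}
    (hC : ∀ v, |S v| ≤ C * ∑ i, v i ^ 2) (hκ : 0 < κ) (hκC : κ ≤ C)
    (ha : ∑ i, S (Pi.single i 1) + Fintype.card ι * κ ≤ a) :
    stdGauss ι {v | a ≤ S v} ≤ ENNReal.ofReal (Real.exp (-(Fintype.card ι * (κ ^ 2 / (8 * C ^ 2))))) := by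
  have hC0 : 0 < C := hκ.trans_le hκC
  -- The minimizer of `-s κ + 2 s² C²`, with value `-κ² / (8 C²)`; `κ ≤ C` keeps `s` in the range of
  -- the moment bound.
  set s := κ / (4 * C ^ 2) with hs
  have hs0 : 0 < s := by positivity
  have h1 := lintegral_exp_isQuad_le hS hC (s := s) (by
    rw [abs_of_pos hs0, hs]
    rw [div_mul_eq_mul_div, div_le_div_iff₀ (by positivity) (by norm_num)]
    nlinarith)
  have h2 : stdGauss ι {v | a ≤ S v} * ENNReal.ofReal (Real.exp (s * a))
      ≤ ∫⁻ v, ENNReal.ofReal (Real.exp (s * S v)) ∂(stdGauss ι) := by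
    rw [mul_comm, ← lintegral_indicator_const (measurableSet_le measurable_const hS.measurable)]
    refine lintegral_mono fun v => ?_
    by_cases hv : v ∈ {v | a ≤ S v}
    swap
    · rw [Set.indicator_of_notMem hv]; exact zero_le
    rw [Set.indicator_of_mem hv]
    exact ENNReal.ofReal_le_ofReal (Real.exp_le_exp.2 (mul_le_mul_of_nonneg_left hv hs0.le))
  have h3 := h2.trans h1
  have hpos : 0 < Real.exp (s * a) := Real.exp_pos _
  rw [← ENNReal.le_div_iff_mul_le (by left; simpa using hpos) (by left; simp),
    ← ENNReal.ofReal_div_of_pos hpos, ← Real.exp_sub] at h3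
  refine h3.trans (ENNReal.ofReal_le_ofReal (Real.exp_le_exp.2 ?_))
  have h4 : s * (∑ i, S (Pi.single i 1) + Fintype.card ι * κ) ≤ s * a :=
    mul_le_mul_of_nonneg_left ha hs0.le
  have h5 : 2 * s ^ 2 * C ^ 2 * Fintype.card ι = Fintype.card ι * (κ ^ 2 / (8 * C ^ 2)) := by
    rw [hs]; field_simp; ring
  have h6 : s * (Fintype.card ι * κ) = 2 * (Fintype.card ι * (κ ^ 2 / (8 * C ^ 2))) := by
    rw [hs]; field_simp; ring
  rw [h5]
  linarith

/-- Lower tail of a bounded quadratic form under the standard Gaussian measure. -/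
theorem stdGauss_isQuad_le_le {S : (ι → ℝ) → ℝ} (hS : IsQuad S) {C κ a : ℝ}
    (hC : ∀ v, |S v| ≤ C * ∑ i, v i ^ 2) (hκ : 0 < κ) (hκC : κ ≤ C)
    (ha : a ≤ ∑ i, S (Pi.single i 1) - Fintype.card ι * κ) :
    stdGauss ι {v | S v ≤ a} ≤ ENNReal.ofReal (Real.exp (-(Fintype.card ι * (κ ^ 2 / (8 * C ^ 2))))) := by
  have h := stdGauss_isQuad_ge_le (S := fun v => (-1) * S v) (hS.const_mul (-1)) (C := C) (κ := κ) (a := -a)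
    (fun v => by simpa using hC v) hκ hκC (by
      rw [← Finset.mul_sum]; linarith)
  convert h using 3
  ext v; constructor <;> intro hv <;> linarith

end Quadratic

/-! ### Comparing a Gaussian block with its whitened coordinates. -/

section Factor

open Matrix

variable {n : ℕ} {S : ℝ → ℝ} {C : Matrix (Fin n) (Fin n) ℝ}

/-- Young's inequality at one frequency, from `(‖x‖ - s ‖u‖)² ≥ 0`. It passes from a symbol to its
reciprocal without inverting a Toeplitz matrix. -/
theorem two_re_mul_conj_le {s : ℝ} (hs : 0 < s) (u x : ℂ) :
    2 * (u * (starRingEnd ℂ) x).re - s * ‖u‖ ^ 2 ≤ 1 / s * ‖x‖ ^ 2 := by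
  have h1 : (u * (starRingEnd ℂ) x).re ≤ ‖u‖ * ‖x‖ := by
    refine (Complex.re_le_norm _).trans (le_of_eq ?_)
    rw [norm_mul, Complex.norm_conj]
  have h2 : 1 / s * ‖x‖ ^ 2 - 2 * (‖u‖ * ‖x‖) + s * ‖u‖ ^ 2 = 1 / s * (‖x‖ - s * ‖u‖) ^ 2 := by
    field_simp; ring
  have h3 : 0 ≤ 1 / s * (‖x‖ - s * ‖u‖) ^ 2 := by positivity
  linarith

theorem toepForm_eq_sum_sq_transpose (hS : Continuous S) (hC : C * Cᵀ = toepMat S n) (u : Fin n → ℝ) :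
    toepForm S u = ∑ i, (Cᵀ *ᵥ u) i ^ 2 := by
  rw [toepForm_eq_quadForm hS, ← hC, ← Matrix.mulVec_mulVec, Matrix.dotProduct_mulVec,
    ← Matrix.mulVec_transpose]
  simp [dotProduct, sq]

/-- In coordinates that whiten the covariance `S`, the square norm is at most the Toeplitz form
of `1/S`. -/
theorem sum_sq_le_toepForm_inv (hS : Continuous S) (hpos : ∀ ν, 0 < S ν) (hC : C * Cᵀ = toepMat S n)
    (hdet : C.det ≠ 0) (z : Fin n → ℝ) :
    ∑ i, z i ^ 2 ≤ toepForm (fun ν => 1 / S ν) (C *ᵥ z) := by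
  set u := (Cᵀ)⁻¹ *ᵥ z with hu
  have hCu : Cᵀ *ᵥ u = z := by
    rw [hu, Matrix.mulVec_mulVec, Matrix.mul_nonsing_inv _ (by rw [Matrix.det_transpose]; exact hdet.isUnit),
      Matrix.one_mulVec]
  have h1 := toepForm_eq_sum_sq_transpose hS hC u
  rw [hCu] at h1
  have h2 : ∑ t, u t * (C *ᵥ z) t = ∑ i, z i ^ 2 := by
    have : u ⬝ᵥ (C *ᵥ z) = z ⬝ᵥ z := by
      rw [Matrix.dotProduct_mulVec, ← Matrix.mulVec_transpose, hCu]
    simpa [dotProduct, sq] using this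
  have hinv : Continuous fun ν => 1 / S ν := continuous_const.div hS fun ν => (hpos ν).ne'
  -- Both `⟨u, C z⟩` and the form of `S` at `u` equal `|z|²`; integrating Young's inequality over
  -- the frequencies gives the bound.
  have h3 : 2 * ∑ i, z i ^ 2 - ∑ i, z i ^ 2 ≤ toepForm (fun ν => 1 / S ν) (C *ᵥ z) := by
    nth_rewrite 1 [← h2]
    rw [← cmean_re_dft_mul_conj_dft, ← h1]
    unfold toepForm
    have c1 : Continuous fun ν => (dft u ν * (starRingEnd ℂ) (dft (C *ᵥ z) ν)).re :=
      Complex.continuous_re.comp ((continuous_dft u).mul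
        (Complex.continuous_conj.comp (continuous_dft _)))
    rw [← cmean_const_mul, ← cmean_sub (by fun_prop) (by fun_prop)]
    exact cmean_mono (by fun_prop) (by fun_prop) fun ν => two_re_mul_conj_le (hpos ν) _ _
  linarith

/-- The bound holds for `Cᵀ` by monotonicity of Toeplitz forms and passes to `C` through `|C z|² =
⟨Cᵀ C z, z⟩` and Young's inequality. -/
theorem sum_sq_factor_le (hS : Continuous S) {M : ℝ} (hM0 : 0 < M) (hM : ∀ ν, S ν ≤ M)
    (hC : C * Cᵀ = toepMat S n) (z : Fin n → ℝ) :
    ∑ t, (C *ᵥ z) t ^ 2 ≤ M * ∑ i, z i ^ 2 := by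
  set x := C *ᵥ z with hx
  have h1 : ∑ i, (Cᵀ *ᵥ x) i ^ 2 ≤ M * ∑ t, x t ^ 2 := by
    rw [← toepForm_eq_sum_sq_transpose hS hC, ← toepForm_const]
    exact toepForm_mono hS continuous_const hM x
  have h2 : ∑ t, x t ^ 2 = ∑ i, (Cᵀ *ᵥ x) i * z i := by
    have : x ⬝ᵥ x = (Cᵀ *ᵥ x) ⬝ᵥ z := by
      conv_lhs => rw [hx, Matrix.dotProduct_mulVec, ← Matrix.mulVec_transpose]
    simpa [dotProduct, sq] using this
  have h3 : ∑ i, (Cᵀ *ᵥ x) i * z i ≤ ∑ i, (1 / (2 * M) * (Cᵀ *ᵥ x) i ^ 2 + M / 2 * z i ^ 2) := by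
    refine Finset.sum_le_sum fun i _ => ?_
    have : 1 / (2 * M) * (Cᵀ *ᵥ x) i ^ 2 + M / 2 * z i ^ 2 - (Cᵀ *ᵥ x) i * z i
        = 1 / (2 * M) * ((Cᵀ *ᵥ x) i - M * z i) ^ 2 := by
      field_simp; ring
    have h : 0 ≤ 1 / (2 * M) * ((Cᵀ *ᵥ x) i - M * z i) ^ 2 := by positivity
    linarith
  rw [Finset.sum_add_distrib, ← Finset.mul_sum, ← Finset.mul_sum] at h3
  have h4 : 1 / (2 * M) * ∑ i, (Cᵀ *ᵥ x) i ^ 2 ≤ 1 / 2 * ∑ t, x t ^ 2 := by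
    calc _ ≤ 1 / (2 * M) * (M * ∑ t, x t ^ 2) := mul_le_mul_of_nonneg_left h1 (by positivity)
      _ = _ := by field_simp
  nlinarith

end Factor

/-! ### Type classes compared with the autoregressive Gaussian density. -/

section TypeClass

open Matrix

variable {p n : ℕ} {γ : Fin (p + 1) → ℝ}

/-- Because `1 / S_X` is a trigonometric polynomial of degree `p`, the form sees the block only
through the lags that the type class prescribes. This makes the autoregressive process the right
reference measure. -/
theorem toepForm_inv_specX (γ : Fin (p + 1) → ℝ) (x : Fin n → ℝ) :
    toepForm (fun ν => 1 / specX γ ν) x = 1 / etaSq γ * (lagCorr (arCoef γ) 0 * lagCorr x 0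
      + 2 * ∑ m ∈ Finset.Icc 1 p, lagCorr (arCoef γ) m * lagCorr x m) := by
  rw [← toepForm_normSq_fourier, ← toepForm_const_mul]
  congr 1; ext ν
  rw [specX, arGain_eq, one_div_div]; ring

/-- Expand `|1 - Φ|²` in `|1 - Φ|² S_X = η²` and take the mean. At the prescribed correlations the
form of `1 / S_X` thus equals `n`. -/
theorem sum_lagCorr_arCoef_mul_covX (h : (toeplitz γ (p + 1)).PosDef) :
    lagCorr (arCoef γ) 0 * covX γ 0 + 2 * ∑ m ∈ Finset.Icc 1 p, lagCorr (arCoef γ) m * covX γ m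
      = etaSq γ := by
  have hc := continuous_specX h
  have h1 : etaSq γ = cmean fun ν => (lagCorr (arCoef γ) 0 +
      2 * ∑ m ∈ Finset.Icc 1 p, lagCorr (arCoef γ) m * Real.cos (m * ν)) * specX γ ν := by
    rw [← cmean_const (etaSq γ)]
    congr 1; ext ν
    rw [← normSq_dft_eq_lagCorr _ le_rfl, ← fourier_eq_dft, ← arGain_eq, specX,
      mul_div_cancel₀ _ (arGain_pos h ν).ne']
  rw [h1]
  simp_rw [add_mul, mul_assoc, Finset.sum_mul]
  rw [cmean_add (by fun_prop) (by fun_prop), cmean_const_mul, cmean_const_mul,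
    cmean_sum _ (fun m _ => by fun_prop)]
  congr 2
  · simp [covX]
  · refine Finset.sum_congr rfl fun m _ => ?_
    simp_rw [mul_assoc]
    rw [cmean_const_mul]
    congr 1
    unfold covX
    congr 1; ext ν; push_cast; ring

theorem abs_lagCorr_sub_lt (h : (toeplitz γ (p + 1)).PosDef) {ε : ℝ} (hn : 0 < n) {x : Fin n → ℝ}
    (hx : x ∈ typeClass n ε γ) {k : ℕ} (hk : k ≤ p) : |lagCorr x k - n * covX γ k| < n * ε := by
  have h1 : |1 / (n : ℝ) * lagCorr x k - γ ⟨k, by omega⟩| < ε := hx ⟨k, by omega⟩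
  have h2 := covX_eq_of_le h ⟨k, by omega⟩
  have hn' : (0 : ℝ) < n := by exact_mod_cast hn
  rw [← h2] at h1
  have h3 : lagCorr x k - n * covX γ k = n * (1 / (n : ℝ) * lagCorr x k - covX γ k) := by
    field_simp
  rw [h3, abs_mul, abs_of_pos hn']
  exact mul_lt_mul_of_pos_left h1 hn'

theorem mem_typeClass_of_abs_lt (h : (toeplitz γ (p + 1)).PosDef) {ε : ℝ} (hn : 0 < n) {x : Fin n → ℝ}
    (hx : ∀ k : ℕ, k ≤ p → |lagCorr x k - n * covX γ k| < n * ε) : x ∈ typeClass n ε γ := by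
  intro k
  have h1 := hx k (by omega)
  have hn' : (0 : ℝ) < n := by exact_mod_cast hn
  rw [covX_eq_of_le h k] at h1
  have h3 : 1 / (n : ℝ) * (∑ t, x t * delay x k t) - γ k = 1 / (n : ℝ) * (lagCorr x k - n * γ k) := by
    rw [lagCorr]; field_simp
  rw [h3, abs_mul, abs_of_pos (by positivity : 0 < 1 / (n : ℝ))]
  calc _ < 1 / (n : ℝ) * (n * ε) := mul_lt_mul_of_pos_left h1 (by positivity)
    _ = ε := by field_simp

theorem continuous_delay (i : ℕ) (t : Fin n) : Continuous fun x : Fin n → ℝ => delay x i t := by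
  unfold delay
  split_ifs <;> fun_prop

theorem continuous_lagCorr (k : ℕ) : Continuous fun x : Fin n → ℝ => lagCorr x k := by
  unfold lagCorr
  exact continuous_finsetSum _ fun t _ => (continuous_apply t).mul (continuous_delay k t)

theorem measurableSet_typeClass (n : ℕ) (ε : ℝ) (γ : Fin (p + 1) → ℝ) :
    MeasurableSet (typeClass n ε γ) := by
  have : typeClass n ε γ = ⋂ k : Fin (p + 1), {x | |1 / (n : ℝ) * lagCorr x k - γ k| < ε} := by
    ext x; simp [typeClass, lagCorr]
  rw [this]
  refine MeasurableSet.iInter fun k => ?_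
  have := continuous_lagCorr (n := n) k
  exact (isOpen_lt (by fun_prop) continuous_const).measurableSet

/-- The factor by which a deviation `ε` of the lags changes the exponent of the autoregressive
density. -/
def lagSens (γ : Fin (p + 1) → ℝ) : ℝ :=
  1 / etaSq γ * (|lagCorr (arCoef γ) 0| + 2 * ∑ m ∈ Finset.Icc 1 p, |lagCorr (arCoef γ) m|)

theorem lagSens_nonneg (h : (toeplitz γ (p + 1)).PosDef) : 0 ≤ lagSens γ := by
  have := etaSq_pos h
  unfold lagSens
  have : 0 ≤ ∑ m ∈ Finset.Icc 1 p, |lagCorr (arCoef γ) m| := Finset.sum_nonneg fun _ _ => abs_nonneg _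
  positivity

theorem toepForm_inv_specX_le (h : (toeplitz γ (p + 1)).PosDef) {ε : ℝ} (hn : 0 < n) {x : Fin n → ℝ}
    (hx : x ∈ typeClass n ε γ) :
    toepForm (fun ν => 1 / specX γ ν) x ≤ n * (1 + lagSens γ * ε) := by
  have hη := etaSq_pos h
  have key : ∀ m : ℕ, m ≤ p → lagCorr (arCoef γ) m * lagCorr x m
      ≤ lagCorr (arCoef γ) m * (n * covX γ m) + |lagCorr (arCoef γ) m| * (n * ε) := by
    intro m hm
    have h1 := abs_lagCorr_sub_lt h hn hx hm
    have h2 : lagCorr (arCoef γ) m * (lagCorr x m - n * covX γ m)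
        ≤ |lagCorr (arCoef γ) m| * (n * ε) := by
      refine (le_abs_self _).trans ?_
      rw [abs_mul]
      exact mul_le_mul_of_nonneg_left h1.le (abs_nonneg _)
    linarith
  have h0 := key 0 (by omega)
  have hs : ∑ m ∈ Finset.Icc 1 p, lagCorr (arCoef γ) m * lagCorr x m
      ≤ n * ∑ m ∈ Finset.Icc 1 p, lagCorr (arCoef γ) m * covX γ m
        + (∑ m ∈ Finset.Icc 1 p, |lagCorr (arCoef γ) m|) * (n * ε) := by
    rw [Finset.mul_sum, Finset.sum_mul, ← Finset.sum_add_distrib]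
    refine Finset.sum_le_sum fun m hm => ?_
    have := key m (Finset.mem_Icc.1 hm).2
    linarith
  rw [toepForm_inv_specX]
  have hid := sum_lagCorr_arCoef_mul_covX h
  have e : (n : ℝ) * (1 + lagSens γ * ε) = 1 / etaSq γ * (n * etaSq γ + (|lagCorr (arCoef γ) 0| +
      2 * ∑ m ∈ Finset.Icc 1 p, |lagCorr (arCoef γ) m|) * (n * ε)) := by
    unfold lagSens; field_simp
  rw [e]
  refine mul_le_mul_of_nonneg_left ?_ (by positivity)
  rw [← hid]
  simp only [Nat.cast_zero] at h0
  linarith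

/-- Integrals over a type class are dominated by Gaussian integrals. -/
theorem setLIntegral_typeClass_le (h : (toeplitz γ (p + 1)).PosDef) {ε : ℝ} (hn : 0 < n)
    {C : Matrix (Fin n) (Fin n) ℝ} (hC : C * Cᵀ = toepMat (specX γ) n) (hdet : C.det ≠ 0)
    (f : (Fin n → ℝ) → ENNReal) :
    ∫⁻ x in typeClass n ε γ, f x
      ≤ ENNReal.ofReal (|C.det| * Real.sqrt (2 * Real.pi) ^ n * Real.exp (n * (1 + lagSens γ * ε) / 2)) *
        ∫⁻ z, f (C *ᵥ z) ∂(stdGauss (Fin n)) := by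
  have hpi := Real.pi_pos
  rw [← lintegral_indicator (measurableSet_typeClass n ε γ), ← lintegral_comp_mulVec C hdet,
    lintegral_stdGauss, Fintype.card_fin, ← mul_assoc, ← ENNReal.ofReal_mul (by positivity)]
  have e : |C.det| * Real.sqrt (2 * Real.pi) ^ n * Real.exp (n * (1 + lagSens γ * ε) / 2) *
      (Real.sqrt (2 * Real.pi))⁻¹ ^ n = |C.det| * Real.exp (n * (1 + lagSens γ * ε) / 2) := by
    rw [inv_pow]
    have : Real.sqrt (2 * Real.pi) ^ n ≠ 0 := by positivity
    field_simp
  rw [e, ENNReal.ofReal_mul (by positivity), mul_assoc]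
  refine mul_le_mul_right ?_ _
  rw [← lintegral_const_mul' _ _ ENNReal.ofReal_ne_top]
  refine lintegral_mono fun z => ?_
  by_cases hz : C *ᵥ z ∈ typeClass n ε γ
  · rw [Set.indicator_of_mem hz, ← mul_assoc, ← ENNReal.ofReal_mul (by positivity), ← Real.exp_add]
    refine le_mul_of_one_le_left' ?_
    rw [ENNReal.one_le_ofReal, Real.one_le_exp_iff]
    -- On the type class the whitened square norm is at most about `n`, so the prefactor compensates
    -- the Gaussian density.
    have h1 := sum_sq_le_toepForm_inv (continuous_specX h) (specX_pos h) hC hdet z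
    have h2 := toepForm_inv_specX_le h hn hz
    have h3 : z ⬝ᵥ z = ∑ i, z i ^ 2 := by simp [dotProduct, sq]
    rw [h3]; linarith
  · rw [Set.indicator_of_notMem hz]; exact zero_le

/-- On the set in question the square norm is at least `n (1 - ε')`, which bounds the Gaussian
density from above. Gaussian probability thus gives a lower bound on volume. -/
theorem volume_typeClass_ge (γ : Fin (p + 1) → ℝ) {ε ε' : ℝ}
    {C : Matrix (Fin n) (Fin n) ℝ} (hdet : C.det ≠ 0) :
    ENNReal.ofReal (|C.det| * Real.sqrt (2 * Real.pi) ^ n * Real.exp (n * (1 - ε') / 2)) *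
        stdGauss (Fin n) {z | C *ᵥ z ∈ typeClass n ε γ ∧ n * (1 - ε') ≤ ∑ i, z i ^ 2}
      ≤ volume (typeClass n ε γ) := by
  have hpi := Real.pi_pos
  have hmeas : MeasurableSet {z : Fin n → ℝ | C *ᵥ z ∈ typeClass n ε γ ∧ n * (1 - ε') ≤ ∑ i, z i ^ 2} := by
    have h1 : MeasurableSet {z : Fin n → ℝ | C *ᵥ z ∈ typeClass n ε γ} :=
      (measurableSet_typeClass n ε γ).preimage
        (Continuous.matrix_mulVec continuous_const continuous_id).measurable
    have h2 : MeasurableSet {z : Fin n → ℝ | n * (1 - ε') ≤ ∑ i, z i ^ 2} :=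
      measurableSet_le measurable_const (by fun_prop)
    exact h1.inter h2
  rw [← setLIntegral_one (typeClass n ε γ), ← lintegral_indicator (measurableSet_typeClass n ε γ),
    ← lintegral_comp_mulVec C hdet, ← lintegral_indicator_one hmeas,
    lintegral_stdGauss, Fintype.card_fin, ← mul_assoc, ← ENNReal.ofReal_mul (by positivity)]
  have e : |C.det| * Real.sqrt (2 * Real.pi) ^ n * Real.exp (n * (1 - ε') / 2) *
      (Real.sqrt (2 * Real.pi))⁻¹ ^ n = |C.det| * Real.exp (n * (1 - ε') / 2) := by
    rw [inv_pow]
    have : Real.sqrt (2 * Real.pi) ^ n ≠ 0 := by positivity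
    field_simp
  rw [e, ENNReal.ofReal_mul (by positivity), mul_assoc]
  refine mul_le_mul_right ?_ _
  rw [← lintegral_const_mul' _ _ ENNReal.ofReal_ne_top]
  refine lintegral_mono fun z => ?_
  by_cases hz : z ∈ {z : Fin n → ℝ | C *ᵥ z ∈ typeClass n ε γ ∧ n * (1 - ε') ≤ ∑ i, z i ^ 2}
  · rw [Set.indicator_of_mem hz.1, Set.indicator_of_mem hz, Pi.one_apply, mul_one,
      ← ENNReal.ofReal_mul (by positivity), ← Real.exp_add]
    rw [ENNReal.ofReal_le_one, Real.exp_le_one_iff]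
    have h3 : z ⬝ᵥ z = ∑ i, z i ^ 2 := by simp [dotProduct, sq]
    rw [h3]; linarith [hz.2]
  · rw [Set.indicator_of_notMem hz]; simp

end TypeClass

/-! ### Linearity of filters and padding. -/

section LinearBlocks

variable {ι : Type*} {n : ℕ}

theorem isLinearMap_delay {x : (ι → ℝ) → Fin n → ℝ} (hx : ∀ t, IsLinearMap ℝ fun v => x v t) (i : ℕ)
    (t : Fin n) : IsLinearMap ℝ fun v => delay (x v) i t := by
  unfold delay
  split_ifs
  · exact hx _
  · exact ⟨fun _ _ => by simp, fun _ _ => by simp⟩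

theorem isLinearMap_filterOut {K : ℕ} (a : Fin (K + 1) → ℝ) {x : (ι → ℝ) → Fin n → ℝ}
    (hx : ∀ t, IsLinearMap ℝ fun v => x v t) (t : Fin n) :
    IsLinearMap ℝ fun v => filterOut a (x v) t := by
  unfold filterOut
  constructor
  · intro v w
    rw [← Finset.sum_add_distrib]
    refine Finset.sum_congr rfl fun i _ => ?_
    rw [(isLinearMap_delay hx i t).map_add]; ring
  · intro c v
    rw [Finset.smul_sum]
    refine Finset.sum_congr rfl fun i _ => ?_
    rw [(isLinearMap_delay hx i t).map_smul, smul_eq_mul, smul_eq_mul]; ring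

theorem isLinearMap_zeroPad {x : (ι → ℝ) → Fin n → ℝ} (hx : ∀ t, IsLinearMap ℝ fun v => x v t) (L : ℕ)
    (t : Fin (n + L)) : IsLinearMap ℝ fun v => zeroPad L (x v) t := by
  unfold zeroPad
  refine Fin.addCases (fun i => ?_) (fun j => ?_) t
  · simpa using hx i
  · simp only [Fin.append_right]
    exact ⟨fun _ _ => by simp, fun _ _ => by simp⟩

theorem isLinearMap_mulVec [Fintype ι] {κ : Type*} (C : Matrix κ ι ℝ) (t : κ) :
    IsLinearMap ℝ fun v => (C.mulVec v) t :=
  ⟨fun v w => by rw [Matrix.mulVec_add]; rfl, fun c v => by rw [Matrix.mulVec_smul]; rfl⟩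

variable [Fintype ι] [DecidableEq ι]

theorem isQuad_lagCorr {x : (ι → ℝ) → Fin n → ℝ} (hx : ∀ t, IsLinearMap ℝ fun v => x v t) (k : ℕ) :
    IsQuad fun v => lagCorr (x v) k := by
  unfold lagCorr
  exact IsQuad.sum _ fun t _ => isQuad_mul (hx t) (isLinearMap_delay hx k t)

theorem isQuad_toepForm {f : ℝ → ℝ} (hf : Continuous f) {x : (ι → ℝ) → Fin n → ℝ}
    (hx : ∀ t, IsLinearMap ℝ fun v => x v t) : IsQuad fun v => toepForm f (x v) := by
  simp_rw [toepForm_eq_quadForm hf, dotProduct, Matrix.mulVec, dotProduct, Finset.mul_sum]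
  refine IsQuad.sum _ fun s _ => IsQuad.sum _ fun t _ => ?_
  have := (isQuad_mul (hx s) (hx t)).const_mul (toepMat f n s t)
  convert this using 2
  ring

end LinearBlocks

/-! ### Typical autoregressive blocks and the volume of a type class. -/

section TypicalSet

open Matrix

variable {p n : ℕ} {γ : Fin (p + 1) → ℝ}

theorem mulVec_single_eq_col {n : ℕ} (C : Matrix (Fin n) (Fin n) ℝ) (i : Fin n) :
    C *ᵥ (Pi.single i 1) = fun j => C j i := by
  ext j; simp

theorem tendsto_ofReal_exp_neg_mul {r : ℝ} (hr : 0 < r) :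
    Tendsto (fun n : ℕ => ENNReal.ofReal (Real.exp (-(n * r)))) atTop (𝓝 0) := by
  rw [← ENNReal.ofReal_zero]
  refine ENNReal.tendsto_ofReal (Real.tendsto_exp_neg_atTop_nhds_zero.comp ?_)
  exact tendsto_natCast_atTop_atTop.atTop_mul_const hr

/-- The complement is covered by two tails for each of the `p + 1` lags and one lower tail of the
square norm, all exponentially small. -/
theorem eventually_typical (h : (toeplitz γ (p + 1)).PosDef) {ε : ℝ} (hε : 0 < ε) :
    ∀ᶠ n : ℕ in atTop, ∀ C : Matrix (Fin n) (Fin n) ℝ, C * Cᵀ = toepMat (specX γ) n →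
      1 / 2 ≤ stdGauss (Fin n) {z | C *ᵥ z ∈ typeClass n ε γ ∧ n * (1 - ε) ≤ ∑ i, z i ^ 2} := by
  obtain ⟨M₀, hM₀, hSM₀⟩ := exists_upper_bound (continuous_specX h) (specX_periodic γ)
  -- One norm bound for all the forms: the spectrum bound controls the lags, `1` controls the plain
  -- square norm, and `ε` ensures the side condition of the tail bounds.
  set M := max (max M₀ ε) 1 with hM
  have hM1 : 1 ≤ M := le_max_right _ _
  have hεM : ε ≤ M := (le_max_right _ _).trans (le_max_left _ _)
  have hSM : ∀ ν, specX γ ν ≤ M := fun ν => (hSM₀ ν).trans ((le_max_left _ _).trans (le_max_left _ _))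
  set r := (ε / 2) ^ 2 / (8 * M ^ 2) with hr
  have hr0 : 0 < r := by positivity
  have hlim : Tendsto (fun n : ℕ => ((p + 1 : ℕ) * 2 + 1 : ENNReal) * ENNReal.ofReal (Real.exp (-(n * r))))
      atTop (𝓝 0) := by
    have := ENNReal.Tendsto.const_mul (a := ((p + 1 : ℕ) * 2 + 1 : ENNReal)) (tendsto_ofReal_exp_neg_mul hr0)
      (Or.inr (by
        exact ENNReal.add_ne_top.2 ⟨ENNReal.mul_ne_top (ENNReal.natCast_ne_top _) (by simp), by simp⟩))
    simpa using this
  have hev := hlim.eventually (eventually_le_nhds (show (0 : ENNReal) < 1 / 2 by simp))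
  -- Bounds the bias `k |γ_k|` due to the `n - k` terms in a lag sum; it is independent of `n` and
  -- absorbed by half of `n ε`.
  set b := ∑ k ∈ Finset.range (p + 1), (k : ℝ) * |covX γ k| with hb
  have hbig : ∀ᶠ n : ℕ in atTop, b ≤ n * (ε / 2) :=
    (tendsto_natCast_atTop_atTop.atTop_mul_const (by positivity : 0 < ε / 2)).eventually_ge_atTop b
  filter_upwards [hev, hbig, eventually_gt_atTop p] with n hn hbn hnp C hC
  have hn0 : 0 < n := by omega
  have hx : ∀ t, IsLinearMap ℝ fun v => (C *ᵥ v) t := isLinearMap_mulVec C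
  have hnorm : ∀ v : Fin n → ℝ, ∑ t, (C *ᵥ v) t ^ 2 ≤ M * ∑ i, v i ^ 2 :=
    sum_sq_factor_le (continuous_specX h) (by positivity) hSM hC
  have hRC : ∀ k, ∀ v : Fin n → ℝ, |lagCorr (C *ᵥ v) k| ≤ M * ∑ i, v i ^ 2 :=
    fun k v => (abs_lagCorr_le _ k).trans (hnorm v)
  have htr : ∀ k, ∑ i, lagCorr (C *ᵥ (Pi.single i 1)) k = ((n - k : ℕ) : ℝ) * covX γ k := by
    intro k
    simp_rw [mulVec_single_eq_col]
    rw [sum_lagCorr_factor hC]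
    simp [covX]
  have hlag : ∀ k ∈ Finset.range (p + 1), |((n - k : ℕ) : ℝ) * covX γ k - n * covX γ k| ≤ n * (ε / 2) := by
    intro k hk
    have h1 : (k : ℝ) * |covX γ k| ≤ b :=
      Finset.single_le_sum (f := fun k : ℕ => (k : ℝ) * |covX γ k|) (fun i _ => by positivity) hk
    simp only [Finset.mem_range] at hk
    rw [Nat.cast_sub (by omega), ← sub_mul, abs_mul, sub_sub_cancel_left, abs_neg, Nat.abs_cast]
    linarith
  have hup : ∀ k ∈ Finset.range (p + 1),
      stdGauss (Fin n) {v | n * (covX γ k + ε) ≤ lagCorr (C *ᵥ v) k} ≤ ENNReal.ofReal (Real.exp (-(n * r))) := by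
    intro k hk
    have := stdGauss_isQuad_ge_le (isQuad_lagCorr hx k) (hRC k) (κ := ε / 2) (by positivity) (by linarith)
      (a := n * (covX γ k + ε)) (by
        rw [htr, Fintype.card_fin]
        have := (abs_le.1 (hlag k hk)).2
        linarith)
    rwa [Fintype.card_fin] at this
  have hlo : ∀ k ∈ Finset.range (p + 1),
      stdGauss (Fin n) {v | lagCorr (C *ᵥ v) k ≤ n * (covX γ k - ε)} ≤ ENNReal.ofReal (Real.exp (-(n * r))) := by
    intro k hk
    have := stdGauss_isQuad_le_le (isQuad_lagCorr hx k) (hRC k) (κ := ε / 2) (by positivity) (by linarith)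
      (a := n * (covX γ k - ε)) (by
        rw [htr, Fintype.card_fin]
        have := (abs_le.1 (hlag k hk)).1
        linarith)
    rwa [Fintype.card_fin] at this
  have hsq : stdGauss (Fin n) {v | ∑ i, v i ^ 2 ≤ n * (1 - ε)} ≤ ENNReal.ofReal (Real.exp (-(n * r))) := by
    have hid : ∀ t : Fin n, IsLinearMap ℝ fun v : Fin n → ℝ => v t :=
      fun t => ⟨fun _ _ => rfl, fun _ _ => rfl⟩
    have := stdGauss_isQuad_le_le (S := fun v : Fin n → ℝ => ∑ i, v i ^ 2)
      (IsQuad.sum _ fun t _ => by simpa [sq] using isQuad_mul (hid t) (hid t))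
      (C := M) (κ := ε / 2) (fun v => by
        rw [abs_of_nonneg (Finset.sum_nonneg fun i _ => sq_nonneg _)]
        exact le_mul_of_one_le_left (Finset.sum_nonneg fun i _ => sq_nonneg _) hM1)
      (by positivity) (by linarith) (a := n * (1 - ε)) (by
        have e : ∀ i : Fin n, ∑ j, (Pi.single i 1 : Fin n → ℝ) j ^ 2 = 1 := by
          intro i; simp [Pi.single_apply]
        simp only [e, Finset.sum_const, Finset.card_univ, Fintype.card_fin, nsmul_eq_mul, mul_one]
        have hnn : (0 : ℝ) ≤ n := Nat.cast_nonneg n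
        nlinarith)
    rwa [Fintype.card_fin] at this
  set G := {z : Fin n → ℝ | C *ᵥ z ∈ typeClass n ε γ ∧ n * (1 - ε) ≤ ∑ i, z i ^ 2} with hG
  have hcov : (Set.univ : Set (Fin n → ℝ)) ⊆ G ∪ ((⋃ k ∈ Finset.range (p + 1),
      ({v | n * (covX γ k + ε) ≤ lagCorr (C *ᵥ v) k} ∪ {v | lagCorr (C *ᵥ v) k ≤ n * (covX γ k - ε)}))
      ∪ {v | ∑ i, v i ^ 2 ≤ n * (1 - ε)}) := by
    intro z _
    by_contra hz
    simp only [Set.mem_union, Set.mem_iUnion, Set.mem_ofPred_eq, not_or, not_exists, not_le] at hz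
    obtain ⟨hzG, hz1, hz2⟩ := hz
    refine hzG ⟨mem_typeClass_of_abs_lt h hn0 fun k hk => ?_, hz2.le⟩
    obtain ⟨a1, a2⟩ := hz1 k (by simp; omega)
    rw [abs_lt]
    constructor <;> linarith
  have h1 : (1 : ENNReal) ≤ stdGauss (Fin n) G +
      ((p + 1 : ℕ) * 2 + 1 : ENNReal) * ENNReal.ofReal (Real.exp (-(n * r))) := by
    calc (1 : ENNReal) = stdGauss (Fin n) Set.univ := measure_univ.symm
      _ ≤ _ := measure_mono hcov
      _ ≤ _ := measure_union_le _ _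
      _ ≤ _ := by
        refine add_le_add_right ?_ _
        refine (measure_union_le _ _).trans ?_
        rw [add_mul, one_mul]
        refine add_le_add ?_ hsq
        refine (measure_biUnion_finset_le _ _).trans ?_
        refine (Finset.sum_le_sum fun k hk => (measure_union_le _ _).trans
          (add_le_add (hup k hk) (hlo k hk))).trans (le_of_eq ?_)
        rw [Finset.sum_const, Finset.card_range, nsmul_eq_mul, ← two_mul, mul_assoc]
  have h2 : (1 : ENNReal) ≤ stdGauss (Fin n) G + 1 / 2 := h1.trans (add_le_add_right hn _)
  have h3 : (1 : ENNReal) / 2 + 1 / 2 ≤ stdGauss (Fin n) G + 1 / 2 := by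
    rwa [ENNReal.add_halves]
  exact (ENNReal.add_le_add_iff_right (by simp)).1 h3

/-- The volume of a type class is at least that of the typical set of the autoregressive
process. -/
theorem eventually_volume_typeClass_ge (h : (toeplitz γ (p + 1)).PosDef) {ε : ℝ} (hε : 0 < ε) :
    ∀ᶠ n : ℕ in atTop, ∀ C : Matrix (Fin n) (Fin n) ℝ, C * Cᵀ = toepMat (specX γ) n → C.det ≠ 0 →
      ENNReal.ofReal (|C.det| * Real.sqrt (2 * Real.pi) ^ n * Real.exp (n * (1 - ε) / 2) / 2)
        ≤ volume (typeClass n ε γ) := by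
  filter_upwards [eventually_typical h hε] with n hn C hC hdet
  refine le_trans ?_ (volume_typeClass_ge γ hdet (ε := ε) (ε' := ε))
  rw [ENNReal.ofReal_div_of_pos two_pos, div_eq_mul_inv]
  refine mul_le_mul_right ?_ _
  simpa using hn C hC

theorem sqrt_two_pi_pow (n : ℕ) :
    Real.sqrt (2 * Real.pi) ^ n = Real.exp (n * (1 / 2 * Real.log (2 * Real.pi))) := by
  have : 0 < 2 * Real.pi := by positivity
  rw [Real.exp_nat_mul, Real.sqrt_eq_rpow, Real.rpow_def_of_pos this]
  congr 2; ring

/-- The constant `1/2 log (2πe η²)` is the differential entropy rate of the autoregressive process;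
the determinant of the square root supplies its `η²`. -/
theorem eventually_volume_typeClass_ge_exp (h : (toeplitz γ (p + 1)).PosDef) {ε : ℝ} (hε : 0 < ε) :
    ∀ᶠ n : ℕ in atTop, ENNReal.ofReal (Real.exp (n * (1 / 2 * Real.log (2 * Real.pi * Real.exp 1 * etaSq γ)
      - ε / 2)) / 2) ≤ volume (typeClass n ε γ) := by
  obtain ⟨m, hm0, hm⟩ := exists_pos_lower_bound (continuous_specX h) (specX_periodic γ) (specX_pos h)
  filter_upwards [eventually_volume_typeClass_ge h hε] with n hn
  obtain ⟨C, hC, hdet, hge⟩ := exists_factor_toepMat (continuous_specX h) hm0 hm n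
  refine le_trans (ENNReal.ofReal_le_ofReal ?_) (hn C hC hdet)
  rw [cmean_log_specX h] at hge
  refine div_le_div_of_nonneg_right ?_ (by norm_num)
  have hη := etaSq_pos h
  have e : Real.exp (n * (1 / 2 * Real.log (2 * Real.pi * Real.exp 1 * etaSq γ) - ε / 2))
      = Real.exp (n * (1 / 2 * Real.log (etaSq γ))) * Real.sqrt (2 * Real.pi) ^ n
        * Real.exp (n * (1 - ε) / 2) := by
    rw [sqrt_two_pi_pow, ← Real.exp_add, ← Real.exp_add,
      Real.log_mul (by positivity) hη.ne', Real.log_mul (by positivity) (Real.exp_pos 1).ne', Real.log_exp]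
    congr 1; ring
  rw [e]
  gcongr

/-- Averages over a type class are dominated by Gaussian averages. -/
theorem eventually_lintegral_cond_typeClass_le (h : (toeplitz γ (p + 1)).PosDef) {ε : ℝ} (hε : 0 < ε) :
    ∀ᶠ n : ℕ in atTop, ∀ C : Matrix (Fin n) (Fin n) ℝ, C * Cᵀ = toepMat (specX γ) n → C.det ≠ 0 →
      ∀ f : (Fin n → ℝ) → ENNReal, ∫⁻ x, f x ∂(cond volume (typeClass n ε γ))
        ≤ ENNReal.ofReal (2 * Real.exp (n * ((lagSens γ + 1) / 2 * ε))) *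
          ∫⁻ z, f (C *ᵥ z) ∂(stdGauss (Fin n)) := by
  filter_upwards [eventually_volume_typeClass_ge h hε, eventually_gt_atTop 0] with n hn hn0 C hC hdet f
  have h1 := setLIntegral_typeClass_le h (ε := ε) hn0 hC hdet f
  have hpi := Real.pi_pos
  set D := |C.det| * Real.sqrt (2 * Real.pi) ^ n with hD
  have hD0 : 0 < D := by
    have := abs_pos.2 hdet
    positivity
  rw [ProbabilityTheory.cond, lintegral_smul_measure, smul_eq_mul]
  refine (mul_le_mul' (ENNReal.inv_le_inv.2 (hn C hC hdet)) h1).trans ?_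
  rw [← mul_assoc, ← ENNReal.ofReal_inv_of_pos (by positivity), ← ENNReal.ofReal_mul (by positivity)]
  refine mul_le_mul_left (ENNReal.ofReal_le_ofReal (le_of_eq ?_)) _
  have e : Real.exp (n * ((lagSens γ + 1) / 2 * ε)) = Real.exp (n * (1 + lagSens γ * ε) / 2) /
      Real.exp (n * (1 - ε) / 2) := by
    rw [← Real.exp_sub]; congr 1; ring
  rw [e]
  field_simp
  exact hD

end TypicalSet

/-! ### The channel as an affine image of Gaussian noise. -/

section Channel

variable {K n N : ℕ}

theorem channelLaw_eq_map (h : Fin (K + 1) → ℝ) (σ : ℝ) (x : Fin N → ℝ) :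
    channelLaw h σ x = (stdGauss (Fin N)).map fun w t => filterOut h x t + σ * w t := by
  unfold channelLaw stdGauss
  rw [Measure.pi_map_pi (f := fun t (w : ℝ) => filterOut h x t + σ * w) (fun t => by fun_prop)]
  congr 1
  ext1 t
  have h1 : (fun w : ℝ => filterOut h x t + σ * w) = (fun u => filterOut h x t + u) ∘ fun w => σ * w := rfl
  rw [h1, ← Measure.map_map (by fun_prop) (by fun_prop), gaussianReal_map_const_mul,
    gaussianReal_map_const_add]
  congr 1
  · simp
  · rw [mul_one]
    ext
    simp [Real.coe_toNNReal _ (sq_nonneg σ)]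

instance (h : Fin (K + 1) → ℝ) (σ : ℝ) (x : Fin N → ℝ) : IsProbabilityMeasure (channelLaw h σ x) := by
  unfold channelLaw; infer_instance

theorem continuous_filterOut (a : Fin (K + 1) → ℝ) (t : Fin N) :
    Continuous fun x : Fin N → ℝ => filterOut a x t := by
  unfold filterOut
  exact continuous_finsetSum _ fun i _ => continuous_const.mul (continuous_delay i t)

theorem continuous_zeroPad (L : ℕ) : Continuous fun x : Fin n → ℝ => zeroPad L x := by
  refine continuous_pi fun t => ?_
  unfold zeroPad
  refine Fin.addCases (fun i => ?_) (fun j => ?_) t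
  · simpa using continuous_apply i
  · simpa using continuous_const

/-- Input and noise become a single standard Gaussian vector, so the tail bounds for quadratic forms
apply to both at once. -/
theorem lintegral_stdGauss_prod {ι κ : Type*} [Fintype ι] [Fintype κ] {E : Set ((ι → ℝ) × (κ → ℝ))}
    (hE : MeasurableSet E) :
    ∫⁻ z, stdGauss κ {w | (z, w) ∈ E} ∂(stdGauss ι)
      = stdGauss (ι ⊕ κ) {v | (fun i => v (Sum.inl i), fun j => v (Sum.inr j)) ∈ E} := by
  have h1 := measurePreserving_sumPiEquivProdPi (fun _ : ι ⊕ κ => gaussianReal 0 1)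
  have h2 := h1.measure_preimage (s := E) hE.nullMeasurableSet
  have h3 : ((stdGauss ι).prod (stdGauss κ)) E = ∫⁻ z, stdGauss κ {w | (z, w) ∈ E} ∂(stdGauss ι) :=
    Measure.prod_apply hE
  rw [← h3]
  exact h2.symm

end Channel

/-! ### Scores and output statistics as quadratic forms. -/

section Scores

variable {K n L : ℕ}

/-- The part of the decoding metric that is not fixed by the type class. -/
def score (p : ℕ) (α : Fin (K + 1) → ℝ) (x : Fin n → ℝ) (y : Fin (n + L) → ℝ) : ℝ :=
  ∑ t, y t * filterOut α (zeroPad L x) t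
    - ∑ m ∈ Finset.Icc (1 + min p K) K, tapCorr α m * lagCorr x m

/-- The limit of the normalized score of the transmitted codeword. -/
def scoreMean {p : ℕ} (h α : Fin (K + 1) → ℝ) (γ : Fin (p + 1) → ℝ) : ℝ :=
  (∑ k : Fin (K + 1), ∑ i : Fin (K + 1),
      α k * h i * autocov γ (((k : ℕ) : ℤ) - ((i : ℕ) : ℤ)).natAbs)
    - ∑ l ∈ Finset.Icc (1 + min p K) K, tapCorr α l * autocov γ l

theorem sum_filterOut_sq_le (hL : K ≤ L) (a : Fin (K + 1) → ℝ) {M : ℝ} (hM : ∀ ν, ‖fourier a ν‖ ^ 2 ≤ M)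
    (x : Fin n → ℝ) : ∑ t, filterOut a (zeroPad L x) t ^ 2 ≤ M * ∑ t, x t ^ 2 := by
  rw [sum_filterOut_zeroPad_sq hL, ← toepForm_normSq_fourier, ← toepForm_const]
  exact toepForm_mono (by fun_prop) continuous_const hM x

theorem cos_natAbs_mul (k : ℤ) (ν : ℝ) : Real.cos ((k.natAbs : ℕ) * ν) = Real.cos (k * ν) := by
  rw [Nat.cast_natAbs, Int.cast_abs]
  rcases abs_choice (k : ℝ) with h | h
  · rw [h]
  · rw [h, neg_mul, Real.cos_neg]

/-- In the frequency domain both filters act by multiplication on the same `|dft x|²`, and the real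
part of their cross product is a cosine polynomial. -/
theorem sum_filterOut_mul_filterOut (hL : K ≤ L) (h α : Fin (K + 1) → ℝ) (x : Fin n → ℝ) :
    ∑ t, filterOut h (zeroPad L x) t * filterOut α (zeroPad L x) t
      = ∑ k : Fin (K + 1), ∑ i : Fin (K + 1),
        α k * h i * lagCorr x (((k : ℕ) : ℤ) - ((i : ℕ) : ℤ)).natAbs := by
  rw [sum_filterOut_zeroPad_mul hL]
  have h1 : ∀ ν, (dft (filterOut h (zeroPad L x)) ν * (starRingEnd ℂ) (fourier α ν * dft x ν)).re
      = (∑ k : Fin (K + 1), ∑ i : Fin (K + 1), α k * h i *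
          Real.cos ((((k : ℕ) : ℤ) - ((i : ℕ) : ℤ)).natAbs * ν)) * ‖dft x ν‖ ^ 2 := by
    intro ν
    rw [dft_filterOut_zeroPad hL, map_mul, mul_mul_mul_comm, Complex.mul_conj (dft x ν), mul_comm,
      Complex.re_ofReal_mul, mul_comm, Complex.normSq_eq_norm_sq, fourier_eq_dft, fourier_eq_dft]
    congr 1
    rw [← Complex.conj_re, map_mul, Complex.conj_conj, mul_comm, re_dft_mul_conj_dft]
    refine Finset.sum_congr rfl fun k _ => Finset.sum_congr rfl fun i _ => ?_
    rw [cos_natAbs_mul]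
  simp_rw [h1]
  change toepForm _ x = _
  rw [toepForm_sum _ (fun k _ => by fun_prop)]
  refine Finset.sum_congr rfl fun k _ => ?_
  rw [toepForm_sum _ (fun k _ => by fun_prop)]
  refine Finset.sum_congr rfl fun i _ => ?_
  rw [toepForm_const_mul, toepForm_cos]

theorem zeroPad_zero : zeroPad L (0 : Fin n → ℝ) = 0 := by
  ext t
  unfold zeroPad
  refine Fin.addCases (fun i => ?_) (fun j => ?_) t <;> simp

theorem filterOut_zero (a : Fin (K + 1) → ℝ) (t : Fin n) : filterOut a (0 : Fin n → ℝ) t = 0 := by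
  simp [filterOut, delay]

theorem lagCorr_of_zero (k : ℕ) : lagCorr (0 : Fin n → ℝ) k = 0 := by
  simp [lagCorr]

theorem normSq_dft_single (t : Fin n) (c ν : ℝ) : ‖dft (Pi.single t c) ν‖ ^ 2 = c ^ 2 := by
  rw [normSq_dft, Finset.sum_eq_single t, Finset.sum_eq_single t]
  · simp [sq]
  · intro s _ hs; simp [hs]
  · simp
  · intro s _ hs; simp [hs]
  · simp

open Matrix

variable {p : ℕ} {γ : Fin (p + 1) → ℝ}

/-- The channel input as a linear function of the Gaussian variables. -/
def inputOf (C : Matrix (Fin n) (Fin n) ℝ) (v : Fin n ⊕ Fin (n + L) → ℝ) : Fin n → ℝ :=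
  C *ᵥ fun i => v (Sum.inl i)

/-- The channel output as a linear function of the Gaussian variables. -/
def outputOf (h : Fin (K + 1) → ℝ) (σ : ℝ) (C : Matrix (Fin n) (Fin n) ℝ)
    (v : Fin n ⊕ Fin (n + L) → ℝ) : Fin (n + L) → ℝ :=
  fun t => filterOut h (zeroPad L (inputOf C v)) t + σ * v (Sum.inr t)

theorem isLinearMap_inputOf (C : Matrix (Fin n) (Fin n) ℝ) (t : Fin n) :
    IsLinearMap ℝ fun v : Fin n ⊕ Fin (n + L) → ℝ => inputOf C v t :=
  ⟨fun v w => by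
    have := (isLinearMap_mulVec C t).map_add (fun i => v (Sum.inl i)) (fun i => w (Sum.inl i))
    exact this, fun c v => by
    have := (isLinearMap_mulVec C t).map_smul c (fun i => v (Sum.inl i))
    exact this⟩

theorem isLinearMap_outputOf (h : Fin (K + 1) → ℝ) (σ : ℝ) (C : Matrix (Fin n) (Fin n) ℝ)
    (t : Fin (n + L)) : IsLinearMap ℝ fun v : Fin n ⊕ Fin (n + L) → ℝ => outputOf h σ C v t := by
  have h1 := isLinearMap_filterOut h (isLinearMap_zeroPad (isLinearMap_inputOf (L := L) C) L) t
  constructor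
  · intro v w
    simp only [outputOf]
    rw [h1.map_add, Pi.add_apply]; ring
  · intro c v
    simp only [outputOf]
    rw [h1.map_smul, Pi.smul_apply, smul_eq_mul, smul_eq_mul, smul_eq_mul]; ring

theorem inputOf_single_inl (C : Matrix (Fin n) (Fin n) ℝ) (i : Fin n) :
    inputOf (L := L) C (Pi.single (Sum.inl i) 1) = fun j => C j i := by
  rw [← mulVec_single_eq_col]
  unfold inputOf
  congr 1
  ext j
  simp [Pi.single_apply]

theorem inputOf_single_inr (C : Matrix (Fin n) (Fin n) ℝ) (t : Fin (n + L)) :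
    inputOf (L := L) C (Pi.single (Sum.inr t) 1) = 0 := by
  unfold inputOf
  have : (fun i => (Pi.single (Sum.inr t) 1 : Fin n ⊕ Fin (n + L) → ℝ) (Sum.inl i)) = 0 := by
    ext j; simp
  rw [this, Matrix.mulVec_zero]

theorem outputOf_single_inl (h : Fin (K + 1) → ℝ) (σ : ℝ) (C : Matrix (Fin n) (Fin n) ℝ) (i : Fin n) :
    outputOf (L := L) h σ C (Pi.single (Sum.inl i) 1) = filterOut h (zeroPad L fun j => C j i) := by
  ext t
  simp [outputOf, inputOf_single_inl]

theorem outputOf_single_inr (h : Fin (K + 1) → ℝ) (σ : ℝ) (C : Matrix (Fin n) (Fin n) ℝ)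
    (t : Fin (n + L)) : outputOf (L := L) h σ C (Pi.single (Sum.inr t) 1) = Pi.single t σ := by
  ext s
  simp [outputOf, inputOf_single_inr, zeroPad_zero, filterOut_zero, Pi.single_apply]

theorem isQuad_score (p : ℕ) (h α : Fin (K + 1) → ℝ) (σ : ℝ) (C : Matrix (Fin n) (Fin n) ℝ) :
    IsQuad fun v : Fin n ⊕ Fin (n + L) → ℝ => score p α (inputOf C v) (outputOf h σ C v) := by
  unfold score
  refine IsQuad.sub (IsQuad.sum _ fun t _ => ?_) (IsQuad.sum _ fun m _ => ?_)
  · exact isQuad_mul (isLinearMap_outputOf h σ C t)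
      (isLinearMap_filterOut α (isLinearMap_zeroPad (isLinearMap_inputOf C) L) t)
  · exact (isQuad_lagCorr (isLinearMap_inputOf C) m).const_mul _

/-- The trace is the mean score. A unit vector in a noise direction has zero input, so the noise
drops out, as it must for noise independent of the codeword. -/
theorem sum_score_single (hL : K ≤ L) (hγ : (toeplitz γ (p + 1)).PosDef) (h α : Fin (K + 1) → ℝ) (σ : ℝ)
    {C : Matrix (Fin n) (Fin n) ℝ} (hC : C * Cᵀ = toepMat (specX γ) n) :
    ∑ i, score p α (inputOf C (Pi.single i 1)) (outputOf (L := L) h σ C (Pi.single i 1))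
      = (∑ k : Fin (K + 1), ∑ i : Fin (K + 1), α k * h i *
          (((n - (((k : ℕ) : ℤ) - ((i : ℕ) : ℤ)).natAbs : ℕ) : ℝ) *
            autocov γ (((k : ℕ) : ℤ) - ((i : ℕ) : ℤ)).natAbs))
        - ∑ l ∈ Finset.Icc (1 + min p K) K, tapCorr α l * (((n - l : ℕ) : ℝ) * autocov γ l) := by
  have hlag : ∀ k : ℕ, ∑ i, lagCorr (fun j => C j i) k = ((n - k : ℕ) : ℝ) * autocov γ k := by
    intro k
    rw [sum_lagCorr_factor hC, ← covX_eq_autocov hγ]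
    simp [covX]
  rw [Fintype.sum_sum_type]
  have h2 : ∑ t : Fin (n + L), score p α (inputOf C (Pi.single (Sum.inr t) 1))
      (outputOf (L := L) h σ C (Pi.single (Sum.inr t) 1)) = 0 := by
    refine Finset.sum_eq_zero fun t _ => ?_
    simp [score, inputOf_single_inr, zeroPad_zero, filterOut_zero, lagCorr_of_zero]
  rw [h2, add_zero]
  simp_rw [score, inputOf_single_inl, outputOf_single_inl, sum_filterOut_mul_filterOut hL]
  rw [Finset.sum_sub_distrib]
  congr 1
  · rw [Finset.sum_comm]
    refine Finset.sum_congr rfl fun k _ => ?_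
    rw [Finset.sum_comm]
    refine Finset.sum_congr rfl fun i _ => ?_
    rw [← Finset.mul_sum, hlag]
  · rw [Finset.sum_comm]
    refine Finset.sum_congr rfl fun l _ => ?_
    rw [← Finset.mul_sum, hlag]

/-- Only lags up to `K` occur, so replacing each `n - k` by `n` changes the trace by a constant. -/
theorem exists_sum_score_single_ge (hL : K ≤ L) (hγ : (toeplitz γ (p + 1)).PosDef)
    (h α : Fin (K + 1) → ℝ) (σ : ℝ) :
    ∃ b : ℝ, ∀ n : ℕ, K ≤ n → ∀ C : Matrix (Fin n) (Fin n) ℝ, C * Cᵀ = toepMat (specX γ) n →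
      n * scoreMean h α γ - b
        ≤ ∑ i, score p α (inputOf C (Pi.single i 1)) (outputOf (L := L) h σ C (Pi.single i 1)) := by
  refine ⟨(∑ k : Fin (K + 1), ∑ i : Fin (K + 1), α k * h i *
          (((((k : ℕ) : ℤ) - ((i : ℕ) : ℤ)).natAbs : ℝ) *
            autocov γ (((k : ℕ) : ℤ) - ((i : ℕ) : ℤ)).natAbs))
        - ∑ l ∈ Finset.Icc (1 + min p K) K, tapCorr α l * ((l : ℝ) * autocov γ l), fun n hn C hC => ?_⟩
  rw [sum_score_single hL hγ h α σ hC]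
  refine le_of_eq ?_
  have e1 : (∑ k : Fin (K + 1), ∑ i : Fin (K + 1), α k * h i *
          (((n - (((k : ℕ) : ℤ) - ((i : ℕ) : ℤ)).natAbs : ℕ) : ℝ) *
            autocov γ (((k : ℕ) : ℤ) - ((i : ℕ) : ℤ)).natAbs))
      = n * (∑ k : Fin (K + 1), ∑ i : Fin (K + 1),
          α k * h i * autocov γ (((k : ℕ) : ℤ) - ((i : ℕ) : ℤ)).natAbs)
        - ∑ k : Fin (K + 1), ∑ i : Fin (K + 1), α k * h i *
          (((((k : ℕ) : ℤ) - ((i : ℕ) : ℤ)).natAbs : ℝ) *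
            autocov γ (((k : ℕ) : ℤ) - ((i : ℕ) : ℤ)).natAbs) := by
    rw [Finset.mul_sum, ← Finset.sum_sub_distrib]
    refine Finset.sum_congr rfl fun k _ => ?_
    rw [Finset.mul_sum, ← Finset.sum_sub_distrib]
    refine Finset.sum_congr rfl fun i _ => ?_
    rw [Nat.cast_sub (by have := k.2; have := i.2; omega)]
    ring
  have e2 : ∑ l ∈ Finset.Icc (1 + min p K) K, tapCorr α l * (((n - l : ℕ) : ℝ) * autocov γ l)
      = n * ∑ l ∈ Finset.Icc (1 + min p K) K, tapCorr α l * autocov γ l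
        - ∑ l ∈ Finset.Icc (1 + min p K) K, tapCorr α l * ((l : ℝ) * autocov γ l) := by
    rw [Finset.mul_sum, ← Finset.sum_sub_distrib]
    refine Finset.sum_congr rfl fun l hl => ?_
    rw [Nat.cast_sub (by have := (Finset.mem_Icc.1 hl).2; omega)]
    ring
  rw [e1, e2, scoreMean]
  ring

theorem sum_sq_inputOf_le (hγ : (toeplitz γ (p + 1)).PosDef) {M : ℝ} (hM0 : 0 < M) (hM : ∀ ν, specX γ ν ≤ M)
    {C : Matrix (Fin n) (Fin n) ℝ} (hC : C * Cᵀ = toepMat (specX γ) n) (v : Fin n ⊕ Fin (n + L) → ℝ) :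
    ∑ t, inputOf C v t ^ 2 ≤ M * ∑ i, v i ^ 2 := by
  refine (sum_sq_factor_le (continuous_specX hγ) hM0 hM hC _).trans ?_
  refine mul_le_mul_of_nonneg_left ?_ hM0.le
  rw [Fintype.sum_sum_type]
  exact le_add_of_nonneg_right (Finset.sum_nonneg fun _ _ => sq_nonneg _)

theorem exists_sum_sq_outputOf_le (hL : K ≤ L) (hγ : (toeplitz γ (p + 1)).PosDef) (h : Fin (K + 1) → ℝ)
    (σ : ℝ) : ∃ M : ℝ, 0 < M ∧ ∀ n : ℕ, ∀ C : Matrix (Fin n) (Fin n) ℝ, C * Cᵀ = toepMat (specX γ) n →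
      ∀ v : Fin n ⊕ Fin (n + L) → ℝ, ∑ t, outputOf h σ C v t ^ 2 ≤ M * ∑ i, v i ^ 2 := by
  obtain ⟨M₁, hM₁, hX⟩ := exists_upper_bound (continuous_specX hγ) (specX_periodic γ)
  obtain ⟨M₂, hM₂, hH⟩ := exists_upper_bound (f := fun ν => ‖fourier h ν‖ ^ 2) (by fun_prop)
    (normSq_fourier_periodic h)
  refine ⟨2 * (M₂ * M₁) + 2 * σ ^ 2, by positivity, fun n C hC v => ?_⟩
  have h1 : ∑ t, outputOf h σ C v t ^ 2
      ≤ 2 * ∑ t, filterOut h (zeroPad L (inputOf C v)) t ^ 2 + 2 * σ ^ 2 * ∑ t, v (Sum.inr t) ^ 2 := by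
    rw [Finset.mul_sum, Finset.mul_sum, ← Finset.sum_add_distrib]
    refine Finset.sum_le_sum fun t _ => ?_
    simp only [outputOf]
    nlinarith [sq_nonneg (filterOut h (zeroPad L (inputOf C v)) t - σ * v (Sum.inr t))]
  have h2 := sum_filterOut_sq_le hL h hH (inputOf C v)
  have h3 := sum_sq_inputOf_le hγ hM₁ hX hC v
  have h4 : ∑ t, v (Sum.inr t) ^ 2 ≤ ∑ i, v i ^ 2 := by
    rw [Fintype.sum_sum_type]
    exact le_add_of_nonneg_left (Finset.sum_nonneg fun _ _ => sq_nonneg _)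
  have h5 := mul_le_mul_of_nonneg_left h3 hM₂.le
  have h6 := mul_le_mul_of_nonneg_left h4 (by positivity : 0 ≤ 2 * σ ^ 2)
  nlinarith

theorem exists_abs_score_le (hL : K ≤ L) (hγ : (toeplitz γ (p + 1)).PosDef) (h α : Fin (K + 1) → ℝ)
    (σ : ℝ) : ∃ M : ℝ, 0 < M ∧ ∀ n : ℕ, ∀ C : Matrix (Fin n) (Fin n) ℝ, C * Cᵀ = toepMat (specX γ) n →
      ∀ v : Fin n ⊕ Fin (n + L) → ℝ,
        |score p α (inputOf C v) (outputOf h σ C v)| ≤ M * ∑ i, v i ^ 2 := by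
  obtain ⟨M₁, hM₁, hX⟩ := exists_upper_bound (continuous_specX hγ) (specX_periodic γ)
  obtain ⟨M₂, hM₂, hA⟩ := exists_upper_bound (f := fun ν => ‖fourier α ν‖ ^ 2) (by fun_prop)
    (normSq_fourier_periodic α)
  obtain ⟨M₃, hM₃, hY⟩ := exists_sum_sq_outputOf_le hL hγ h σ
  set B := ∑ m ∈ Finset.Icc (1 + min p K) K, |tapCorr α m| with hB
  have hB0 : 0 ≤ B := Finset.sum_nonneg fun _ _ => abs_nonneg _
  refine ⟨M₃ + M₂ * M₁ + B * M₁, by positivity, fun n C hC v => ?_⟩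
  set V := ∑ i, v i ^ 2 with hV
  have hV0 : 0 ≤ V := Finset.sum_nonneg fun _ _ => sq_nonneg _
  have h1 := hY n C hC v
  have h2 := sum_filterOut_sq_le hL α hA (inputOf C v)
  have h3 := sum_sq_inputOf_le hγ hM₁ hX hC v
  have h5 := mul_le_mul_of_nonneg_left h3 hM₂.le
  have h6 : |∑ t, outputOf h σ C v t * filterOut α (zeroPad L (inputOf C v)) t|
      ≤ ∑ t, outputOf h σ C v t ^ 2 + ∑ t, filterOut α (zeroPad L (inputOf C v)) t ^ 2 := by
    rw [← Finset.sum_add_distrib]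
    refine (Finset.abs_sum_le_sum_abs _ _).trans (Finset.sum_le_sum fun t _ => ?_)
    rw [abs_le]
    constructor <;>
    nlinarith [sq_nonneg (outputOf h σ C v t - filterOut α (zeroPad L (inputOf C v)) t),
      sq_nonneg (outputOf h σ C v t + filterOut α (zeroPad L (inputOf C v)) t),
      sq_nonneg (outputOf h σ C v t), sq_nonneg (filterOut α (zeroPad L (inputOf C v)) t)]
  have h7 : |∑ m ∈ Finset.Icc (1 + min p K) K, tapCorr α m * lagCorr (inputOf C v) m| ≤ B * (M₁ * V) := by
    rw [hB, Finset.sum_mul]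
    refine (Finset.abs_sum_le_sum_abs _ _).trans (Finset.sum_le_sum fun m _ => ?_)
    rw [abs_mul]
    exact mul_le_mul_of_nonneg_left ((abs_lagCorr_le _ m).trans h3) (abs_nonneg _)
  unfold score
  refine (abs_sub _ _).trans ?_
  nlinarith

theorem isQuad_toepForm_outputOf {f : ℝ → ℝ} (hf : Continuous f) (h : Fin (K + 1) → ℝ) (σ : ℝ)
    (C : Matrix (Fin n) (Fin n) ℝ) :
    IsQuad fun v : Fin n ⊕ Fin (n + L) → ℝ => toepForm f (outputOf h σ C v) :=
  isQuad_toepForm hf (isLinearMap_outputOf h σ C)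

/-- Input directions add up to the filtered mean periodogram. A noise direction is a single impulse,
whose transform has constant modulus. -/
theorem sum_toepForm_outputOf_single (hL : K ≤ L) {f : ℝ → ℝ} (hf : Continuous f) (h : Fin (K + 1) → ℝ)
    (σ : ℝ) {C : Matrix (Fin n) (Fin n) ℝ} (hC : C * Cᵀ = toepMat (specX γ) n) :
    ∑ i, toepForm f (outputOf (L := L) h σ C (Pi.single i 1))
      = cmean (fun ν => (f ν * ‖fourier h ν‖ ^ 2) * meanPeriodogram (specX γ) n ν)
        + (n + L) * (σ ^ 2 * cmean f) := by
  rw [Fintype.sum_sum_type]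
  congr 1
  · simp_rw [outputOf_single_inl, toepForm, dft_filterOut_zeroPad hL, ← sum_normSq_dft_factor hC,
      norm_mul, mul_pow, ← mul_assoc, Finset.mul_sum]
    rw [cmean_sum _ (fun i _ => by fun_prop)]
  · simp_rw [outputOf_single_inr, toepForm, normSq_dft_single, cmean_mul_const]
    rw [Finset.sum_const, Finset.card_univ, Fintype.card_fin, nsmul_eq_mul]
    push_cast; ring

end Scores

/-! ### Concentration of the score and of the output statistic. -/

section Concentration

open Matrix

variable {K L p : ℕ} {γ : Fin (p + 1) → ℝ}

theorem continuous_specY (hγ : (toeplitz γ (p + 1)).PosDef) (h : Fin (K + 1) → ℝ) (σ : ℝ) :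
    Continuous (specY h σ γ) := by
  have := continuous_specX hγ
  unfold specY
  fun_prop

theorem card_sum_bounds {n : ℕ} (hn : L ≤ n) : ((Fintype.card (Fin n ⊕ Fin (n + L)) : ℕ) : ℝ) ≤ 3 * n ∧
    (n : ℝ) ≤ ((Fintype.card (Fin n ⊕ Fin (n + L)) : ℕ) : ℝ) := by
  rw [Fintype.card_sum, Fintype.card_fin, Fintype.card_fin]
  constructor
  · have : n + (n + L) ≤ 3 * n := by omega
    exact_mod_cast this
  · push_cast
    have : (0 : ℝ) ≤ n := Nat.cast_nonneg n
    have : (0 : ℝ) ≤ L := Nat.cast_nonneg L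
    linarith

theorem exists_rate_score (hL : K ≤ L) (hγ : (toeplitz γ (p + 1)).PosDef) (h α : Fin (K + 1) → ℝ)
    (σ : ℝ) {κ : ℝ} (hκ : 0 < κ) :
    ∃ r : ℝ, 0 < r ∧ ∀ᶠ n : ℕ in atTop, ∀ C : Matrix (Fin n) (Fin n) ℝ, C * Cᵀ = toepMat (specX γ) n →
      stdGauss (Fin n ⊕ Fin (n + L))
        {v | score p α (inputOf C v) (outputOf h σ C v) ≤ n * (scoreMean h α γ - κ)}
        ≤ ENNReal.ofReal (Real.exp (-(n * r))) := by
  obtain ⟨b, hb⟩ := exists_sum_score_single_ge hL hγ h α σ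
  obtain ⟨M₀, hM₀, hS₀⟩ := exists_abs_score_le hL hγ h α σ
  set M := max M₀ κ with hM
  have hM0 : 0 < M := hM₀.trans_le (le_max_left _ _)
  -- There are at most `3 n` Gaussian coordinates, so a fluctuation of `κ / 6` per coordinate uses
  -- half of `n κ`; the other half covers the edge constant `b`.
  refine ⟨(κ / 6) ^ 2 / (8 * M ^ 2), by positivity, ?_⟩
  have hbig : ∀ᶠ n : ℕ in atTop, b ≤ n * (κ / 2) :=
    (tendsto_natCast_atTop_atTop.atTop_mul_const (by positivity : 0 < κ / 2)).eventually_ge_atTop b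
  filter_upwards [hbig, eventually_ge_atTop L] with n hbn hnL C hC
  obtain ⟨hc1, hc2⟩ := card_sum_bounds hnL
  have h1 := hb n (by omega) C hC
  refine (stdGauss_isQuad_le_le (isQuad_score p h α σ C) (C := M) (κ := κ / 6) (fun v => ?_)
    (by positivity) ((by linarith : κ / 6 ≤ κ).trans (le_max_right _ _)) ?_).trans ?_
  · exact (hS₀ n C hC v).trans (mul_le_mul_of_nonneg_right (le_max_left _ _)
      (Finset.sum_nonneg fun _ _ => sq_nonneg _))
  · nlinarith
  · refine ENNReal.ofReal_le_ofReal (Real.exp_le_exp.2 (neg_le_neg ?_))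
    exact mul_le_mul_of_nonneg_right hc2 (by positivity)

theorem exists_rate_toepForm (hL : K ≤ L) (hγ : (toeplitz γ (p + 1)).PosDef) (h : Fin (K + 1) → ℝ)
    (σ : ℝ) {f : ℝ → ℝ} (hf : Continuous f) (hper : Function.Periodic f (2 * Real.pi))
    (heven : ∀ ν, f (-ν) = f ν) (hnn : ∀ ν, 0 ≤ f ν) {κ : ℝ} (hκ : 0 < κ) :
    ∃ r : ℝ, 0 < r ∧ ∀ᶠ n : ℕ in atTop, ∀ C : Matrix (Fin n) (Fin n) ℝ, C * Cᵀ = toepMat (specX γ) n →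
      stdGauss (Fin n ⊕ Fin (n + L))
        {v | n * (cmean (fun ν => f ν * specY h σ γ ν) + κ) ≤ toepForm f (outputOf h σ C v)}
        ≤ ENNReal.ofReal (Real.exp (-(n * r))) := by
  have hSc := continuous_specX hγ
  obtain ⟨m, hm0, hm⟩ := exists_pos_lower_bound hSc (specX_periodic γ) (specX_pos hγ)
  obtain ⟨M₁, hM₁, hfM⟩ := exists_upper_bound hf hper
  obtain ⟨M₂, hM₂, hY⟩ := exists_sum_sq_outputOf_le hL hγ h σ
  set M := max (M₁ * M₂) κ with hM
  have hM0 : 0 < M := (mul_pos hM₁ hM₂).trans_le (le_max_left _ _)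
  -- Half of `n κ` goes to the fluctuation, a quarter to the error in Fejér's theorem and a quarter
  -- to the noise in the `L` guard positions.
  refine ⟨(κ / 6) ^ 2 / (8 * M ^ 2), by positivity, ?_⟩
  have hmean : cmean (fun ν => f ν * specY h σ γ ν)
      = cmean (fun ν => (f ν * ‖fourier h ν‖ ^ 2) * specX γ ν) + σ ^ 2 * cmean f := by
    rw [← cmean_const_mul, ← cmean_add (by fun_prop) (by fun_prop)]
    congr 1; ext ν; rw [specY]; ring
  have hfejer := cmean_mul_meanPeriodogram_le hSc hm0 hm (f := fun ν => f ν * ‖fourier h ν‖ ^ 2)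
    (by fun_prop) (fun ν => by simp only [hper ν, normSq_fourier_periodic h ν])
    (fun ν => by rw [heven, fourier_eq_dft, normSq_dft_neg]) (κ := κ / 4) (by positivity)
  have hbig : ∀ᶠ n : ℕ in atTop, L * (σ ^ 2 * cmean f) ≤ n * (κ / 4) :=
    (tendsto_natCast_atTop_atTop.atTop_mul_const (by positivity : 0 < κ / 4)).eventually_ge_atTop _
  filter_upwards [hfejer, hbig, eventually_ge_atTop L] with n hfn hbn hnL C hC
  obtain ⟨hc1, hc2⟩ := card_sum_bounds hnL
  have h1 := sum_toepForm_outputOf_single hL hf h σ hC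
  refine (stdGauss_isQuad_ge_le (isQuad_toepForm_outputOf hf h σ C) (C := M) (κ := κ / 6) (fun v => ?_)
    (by positivity) ((by linarith : κ / 6 ≤ κ).trans (le_max_right _ _)) ?_).trans ?_
  · have hnn' : 0 ≤ toepForm f (outputOf h σ C v) :=
      cmean_nonneg (by fun_prop) fun ν => mul_nonneg (hnn ν) (sq_nonneg _)
    rw [abs_of_nonneg hnn']
    have h2 := toepForm_mono hf continuous_const hfM (outputOf h σ C v)
    rw [toepForm_const] at h2
    refine h2.trans ((mul_le_mul_of_nonneg_left (hY n C hC v) hM₁.le).trans ?_)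
    rw [← mul_assoc]
    exact mul_le_mul_of_nonneg_right (le_max_left _ _) (Finset.sum_nonneg fun _ _ => sq_nonneg _)
  · rw [h1, hmean]
    nlinarith
  · refine ENNReal.ofReal_le_ofReal (Real.exp_le_exp.2 (neg_le_neg ?_))
    exact mul_le_mul_of_nonneg_right hc2 (by positivity)

/-- The pairs of input and output for which the score or the quadratic output statistic is atypical. -/
def atypical (L p : ℕ) (h α : Fin (K + 1) → ℝ) (σ : ℝ) (γ : Fin (p + 1) → ℝ) (f : ℝ → ℝ) (κ : ℝ) (n : ℕ) :
    Set ((Fin n → ℝ) × (Fin (n + L) → ℝ)) :=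
  {q | score p α q.1 q.2 ≤ n * (scoreMean h α γ - κ) ∨
    n * (cmean (fun ν => f ν * specY h σ γ ν) + κ) ≤ toepForm f q.2}

theorem continuous_filterOut_zeroPad {n : ℕ} (L : ℕ) (a : Fin (K + 1) → ℝ) (t : Fin (n + L)) :
    Continuous fun x : Fin n → ℝ => filterOut a (zeroPad L x) t :=
  (continuous_filterOut a t).comp (continuous_zeroPad L)

theorem continuous_score {n : ℕ} (p : ℕ) (α : Fin (K + 1) → ℝ) :
    Continuous fun q : (Fin n → ℝ) × (Fin (n + L) → ℝ) => score p α q.1 q.2 := by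
  unfold score
  refine Continuous.sub (continuous_finsetSum _ fun t _ => ?_) (continuous_finsetSum _ fun m _ => ?_)
  · exact ((continuous_apply t).comp continuous_snd).mul
      ((continuous_filterOut_zeroPad L α t).comp continuous_fst)
  · exact continuous_const.mul ((continuous_lagCorr m).comp continuous_fst)

theorem continuous_toepForm {n : ℕ} {f : ℝ → ℝ} (hf : Continuous f) :
    Continuous fun y : Fin n → ℝ => toepForm f y := by
  simp_rw [toepForm_eq_quadForm hf, dotProduct, Matrix.mulVec, dotProduct]
  fun_prop

theorem measurableSet_atypical (h α : Fin (K + 1) → ℝ) (σ : ℝ) (γ : Fin (p + 1) → ℝ) {f : ℝ → ℝ}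
    (hf : Continuous f) (κ : ℝ) (n : ℕ) : MeasurableSet (atypical L p h α σ γ f κ n) := by
  have h1 : MeasurableSet {q : (Fin n → ℝ) × (Fin (n + L) → ℝ) |
      score p α q.1 q.2 ≤ n * (scoreMean h α γ - κ)} :=
    (isClosed_le (continuous_score p α) continuous_const).measurableSet
  have h2 : MeasurableSet {q : (Fin n → ℝ) × (Fin (n + L) → ℝ) |
      n * (cmean (fun ν => f ν * specY h σ γ ν) + κ) ≤ toepForm f q.2} :=
    (isClosed_le continuous_const ((continuous_toepForm hf).comp continuous_snd)).measurableSet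
  exact h1.union h2

theorem measurable_output {n : ℕ} (h : Fin (K + 1) → ℝ) (σ : ℝ) :
    Measurable fun q : (Fin n → ℝ) × (Fin (n + L) → ℝ) =>
      (q.1, fun t => filterOut h (zeroPad L q.1) t + σ * q.2 t) := by
  refine Continuous.measurable ?_
  refine continuous_fst.prodMk (continuous_pi fun t => ?_)
  exact ((continuous_filterOut_zeroPad L h t).comp continuous_fst).add
    (continuous_const.mul ((continuous_apply t).comp continuous_snd))

theorem channelLaw_section {n : ℕ} (h : Fin (K + 1) → ℝ) (σ : ℝ)
    {E : Set ((Fin n → ℝ) × (Fin (n + L) → ℝ))} (hE : MeasurableSet E) (x : Fin n → ℝ) :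
    channelLaw h σ (zeroPad L x) {y | (x, y) ∈ E} = stdGauss (Fin (n + L))
      {w | (x, fun t => filterOut h (zeroPad L x) t + σ * w t) ∈ E} := by
  have hm : MeasurableSet {y | (x, y) ∈ E} := measurable_prodMk_left hE
  rw [channelLaw_eq_map, Measure.map_apply (by fun_prop) hm]
  rfl

theorem measurable_channelLaw_section {n : ℕ} (h : Fin (K + 1) → ℝ) (σ : ℝ)
    {E : Set ((Fin n → ℝ) × (Fin (n + L) → ℝ))} (hE : MeasurableSet E) :
    Measurable fun x => channelLaw h σ (zeroPad L x) {y | (x, y) ∈ E} := by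
  simp_rw [channelLaw_section h σ hE]
  exact measurable_measure_prodMk_left ((measurable_output h σ) hE)

/-- For a codeword drawn from a type class, atypical outputs have vanishing probability. -/
theorem exists_tendsto_atypical (hL : K ≤ L) (hγ : (toeplitz γ (p + 1)).PosDef) (h α : Fin (K + 1) → ℝ)
    (σ : ℝ) {f : ℝ → ℝ} (hf : Continuous f) (hper : Function.Periodic f (2 * Real.pi))
    (heven : ∀ ν, f (-ν) = f ν) (hnn : ∀ ν, 0 ≤ f ν) {κ : ℝ} (hκ : 0 < κ) :
    ∃ ε₀ : ℝ, 0 < ε₀ ∧ ∀ ε : ℝ, 0 < ε → ε < ε₀ →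
      Tendsto (fun n : ℕ => ∫⁻ x, channelLaw h σ (zeroPad L x) {y | (x, y) ∈ atypical L p h α σ γ f κ n}
        ∂(ProbabilityTheory.cond volume (typeClass n ε γ))) atTop (𝓝 0) := by
  obtain ⟨r₁, hr₁, h₁⟩ := exists_rate_score hL hγ h α σ hκ
  obtain ⟨r₂, hr₂, h₂⟩ := exists_rate_toepForm hL hγ h σ hf hper heven hnn hκ
  obtain ⟨m, hm0, hm⟩ := exists_pos_lower_bound (continuous_specX hγ) (specX_periodic γ) (specX_pos hγ)
  have hsens := lagSens_nonneg hγ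
  set r := min r₁ r₂ with hr
  have hr0 : 0 < r := lt_min hr₁ hr₂
  -- The change to the Gaussian model costs `exp (n (lagSens γ + 1) ε / 2)`; below this threshold
  -- the decay `exp (-n r)` still leaves `exp (-n r / 2)`.
  refine ⟨r / (lagSens γ + 1), by positivity, fun ε hε hεr => ?_⟩
  have hrate : (lagSens γ + 1) / 2 * ε < r / 2 := by
    rw [lt_div_iff₀ (by positivity)] at hεr
    linarith
  have hlim : Tendsto (fun n : ℕ => (4 : ENNReal) * ENNReal.ofReal (Real.exp (-(n * (r / 2))))) atTop (𝓝 0) := by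
    have := ENNReal.Tendsto.const_mul (a := (4 : ENNReal)) (tendsto_ofReal_exp_neg_mul (half_pos hr0))
      (Or.inr (by simp))
    simpa using this
  refine tendsto_of_tendsto_of_tendsto_of_le_of_le' tendsto_const_nhds hlim
    (Eventually.of_forall fun n => zero_le) ?_
  filter_upwards [h₁, h₂, eventually_lintegral_cond_typeClass_le hγ hε] with n h₁n h₂n hcn
  obtain ⟨C, hC, hdet, -⟩ := exists_factor_toepMat (continuous_specX hγ) hm0 hm n
  refine (hcn C hC hdet _).trans ?_
  have hEm := measurableSet_atypical (L := L) h α σ γ hf κ n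
  have hstep : ∫⁻ z, channelLaw h σ (zeroPad L (C *ᵥ z)) {y | (C *ᵥ z, y) ∈ atypical L p h α σ γ f κ n}
      ∂(stdGauss (Fin n)) ≤ 2 * ENNReal.ofReal (Real.exp (-(n * r))) := by
    simp_rw [channelLaw_section h σ hEm]
    have hE' : MeasurableSet {q : (Fin n → ℝ) × (Fin (n + L) → ℝ) | (C *ᵥ q.1, fun t =>
        filterOut h (zeroPad L (C *ᵥ q.1)) t + σ * q.2 t) ∈ atypical L p h α σ γ f κ n} := by
      refine ((measurable_output h σ) hEm).preimage (f := fun q : (Fin n → ℝ) × (Fin (n + L) → ℝ) =>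
        (C *ᵥ q.1, q.2)) ?_
      exact (Continuous.prodMk (Continuous.matrix_mulVec continuous_const continuous_fst)
        continuous_snd).measurable
    have hprod := lintegral_stdGauss_prod hE'
    refine (le_of_eq hprod).trans ?_
    have hsub : {v : Fin n ⊕ Fin (n + L) → ℝ | (fun i => v (Sum.inl i), fun j => v (Sum.inr j)) ∈
        {q : (Fin n → ℝ) × (Fin (n + L) → ℝ) | (C *ᵥ q.1, fun t =>
        filterOut h (zeroPad L (C *ᵥ q.1)) t + σ * q.2 t) ∈ atypical L p h α σ γ f κ n}}
        ⊆ {v | score p α (inputOf C v) (outputOf h σ C v) ≤ n * (scoreMean h α γ - κ)} ∪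
          {v | n * (cmean (fun ν => f ν * specY h σ γ ν) + κ) ≤ toepForm f (outputOf h σ C v)} :=
      fun v hv => hv
    refine (measure_mono hsub).trans ((measure_union_le _ _).trans ?_)
    rw [two_mul]
    refine add_le_add ((h₁n C hC).trans ?_) ((h₂n C hC).trans ?_)
    · refine ENNReal.ofReal_le_ofReal (Real.exp_le_exp.2 (neg_le_neg ?_))
      exact mul_le_mul_of_nonneg_left (min_le_left _ _) (Nat.cast_nonneg n)
    · refine ENNReal.ofReal_le_ofReal (Real.exp_le_exp.2 (neg_le_neg ?_))
      exact mul_le_mul_of_nonneg_left (min_le_right _ _) (Nat.cast_nonneg n)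
  refine (mul_le_mul_right hstep _).trans ?_
  have e2 : (2 : ENNReal) = ENNReal.ofReal 2 := by simp
  have e4 : (4 : ENNReal) = ENNReal.ofReal 4 := by simp
  rw [e2, e4, ← ENNReal.ofReal_mul (by norm_num), ← ENNReal.ofReal_mul (by positivity),
    ← ENNReal.ofReal_mul (by norm_num)]
  refine ENNReal.ofReal_le_ofReal ?_
  have e : 2 * Real.exp (n * ((lagSens γ + 1) / 2 * ε)) * (2 * Real.exp (-(n * r)))
      = 4 * Real.exp (n * ((lagSens γ + 1) / 2 * ε - r)) := by
    have : Real.exp (n * ((lagSens γ + 1) / 2 * ε - r))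
        = Real.exp (n * ((lagSens γ + 1) / 2 * ε)) * Real.exp (-(n * r)) := by
      rw [← Real.exp_add]; congr 1; ring
    rw [this]; ring
  rw [e]
  refine mul_le_mul_of_nonneg_left (Real.exp_le_exp.2 ?_) (by norm_num)
  have hn0 : (0 : ℝ) ≤ n := Nat.cast_nonneg n
  nlinarith

end Concentration

/-! ### Volume of the competing codewords. -/

section Competitor

open Matrix

variable {K L p n : ℕ} {γ : Fin (p + 1) → ℝ} {α : Fin (K + 1) → ℝ} {ω : Fin (p + 2) → ℝ}

@[fun_prop]
theorem continuous_gOmega (α : Fin (K + 1) → ℝ) (ω : Fin (p + 2) → ℝ) : Continuous (gOmega α ω) := by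
  unfold gOmega; fun_prop

theorem gOmega_periodic (α : Fin (K + 1) → ℝ) (ω : Fin (p + 2) → ℝ) :
    Function.Periodic (gOmega α ω) (2 * Real.pi) := by
  have hc : ∀ (k : ℕ) (ν : ℝ), Real.cos (k * (ν + 2 * Real.pi)) = Real.cos (k * ν) := fun k ν => by
    rw [mul_add]; exact Real.cos_add_nat_mul_two_pi _ _
  intro ν
  simp only [gOmega, hc]

theorem gOmega_neg (α : Fin (K + 1) → ℝ) (ω : Fin (p + 2) → ℝ) (ν : ℝ) :
    gOmega α ω (-ν) = gOmega α ω ν := by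
  simp only [gOmega, mul_neg, Real.cos_neg]

/-- The form combines the multipliers of the prescribed lags with `ω_{p+1}` times the correction
term of `score`. Hence only the part of the score linear in the codeword remains outside it. -/
theorem toepForm_gOmega (α : Fin (K + 1) → ℝ) (ω : Fin (p + 2) → ℝ) (x : Fin n → ℝ) :
    toepForm (gOmega α ω) x = (∑ k : Fin (p + 1), ω k.castSucc * lagCorr x k)
      + ω (Fin.last (p + 1)) * ∑ m ∈ Finset.Icc (1 + min p K) K, tapCorr α m * lagCorr x m := by
  unfold gOmega
  rw [toepForm_add (by fun_prop) (by fun_prop), toepForm_sum _ (fun k _ => by fun_prop),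
    toepForm_const_mul, toepForm_sum _ (fun k _ => by fun_prop)]
  simp_rw [toepForm_const_mul, toepForm_cos]

/-- The part of the decoding metric that is nearly constant on a type class. -/
def typeMetric (p : ℕ) (α : Fin (K + 1) → ℝ) (x : Fin n → ℝ) : ℝ :=
  1 / 2 * tapCorr α 0 * lagCorr x 0 + ∑ m ∈ Finset.Icc 1 (min p K), tapCorr α m * lagCorr x m

theorem sum_filterOut_sq_eq_typeMetric (hL : K ≤ L) (p : ℕ) (α : Fin (K + 1) → ℝ) (x : Fin n → ℝ) :
    1 / 2 * ∑ t, filterOut α (zeroPad L x) t ^ 2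
      = typeMetric p α x + ∑ m ∈ Finset.Icc (1 + min p K) K, tapCorr α m * lagCorr x m := by
  rw [sum_filterOut_zeroPad_sq hL, typeMetric]
  simp_rw [tapCorr_eq_lagCorr]
  have h1 : Finset.Icc 1 K = Finset.Icc 1 (min p K) ∪ Finset.Icc (1 + min p K) K := by
    ext i; simp only [Finset.mem_union, Finset.mem_Icc]; omega
  rw [h1, Finset.sum_union]
  · ring
  · rw [Finset.disjoint_left]
    intro i hi hi'
    simp only [Finset.mem_Icc] at hi hi'
    omega

/-- Expanding the square, the energy of `y` is common to all codewords. The lags up to `min p K` of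
the filtered energy go to `typeMetric` and the others into the score. -/
theorem logV_zeroPad (hL : K ≤ L) (p : ℕ) (α : Fin (K + 1) → ℝ) (σ : ℝ) (x : Fin n → ℝ)
    (y : Fin (n + L) → ℝ) :
    logV α σ y (zeroPad L x) = (-(((n + L : ℕ) : ℝ) / 2) * Real.log (2 * Real.pi * σ ^ 2)
      - 1 / (2 * σ ^ 2) * ∑ t, y t ^ 2) + 1 / σ ^ 2 * (score p α x y - typeMetric p α x) := by
  have h1 := sum_filterOut_sq_eq_typeMetric (L := L) hL p α x
  have h2 : ∑ t, (y t - filterOut α (zeroPad L x) t) ^ 2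
      = ∑ t, y t ^ 2 - 2 * ∑ t, y t * filterOut α (zeroPad L x) t
        + ∑ t, filterOut α (zeroPad L x) t ^ 2 := by
    rw [Finset.mul_sum, ← Finset.sum_sub_distrib, ← Finset.sum_add_distrib]
    exact Finset.sum_congr rfl fun t _ => by ring
  have h3 : ∑ t, filterOut α (zeroPad L x) t ^ 2 = 2 * (typeMetric p α x
      + ∑ m ∈ Finset.Icc (1 + min p K) K, tapCorr α m * lagCorr x m) := by
    rw [← h1]; ring
  rw [logV, h2, h3, score]
  ring

theorem logV_zeroPad_le_iff (hL : K ≤ L) (p : ℕ) (α : Fin (K + 1) → ℝ) {σ : ℝ} (hσ : 0 < σ)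
    (x x' : Fin n → ℝ) (y : Fin (n + L) → ℝ) :
    logV α σ y (zeroPad L x) ≤ logV α σ y (zeroPad L x') ↔
      score p α x y - typeMetric p α x ≤ score p α x' y - typeMetric p α x' := by
  rw [logV_zeroPad hL p, logV_zeroPad hL p, add_le_add_iff_left]
  exact mul_le_mul_iff_right₀ (by positivity)

/-- The Lipschitz constant of `typeMetric` in the empirical correlations. -/
def tapBound (p : ℕ) (α : Fin (K + 1) → ℝ) : ℝ :=
  1 / 2 * |tapCorr α 0| + ∑ m ∈ Finset.Icc 1 (min p K), |tapCorr α m|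

theorem tapBound_nonneg (p : ℕ) (α : Fin (K + 1) → ℝ) : 0 ≤ tapBound p α := by
  unfold tapBound
  have : 0 ≤ ∑ m ∈ Finset.Icc 1 (min p K), |tapCorr α m| := Finset.sum_nonneg fun _ _ => abs_nonneg _
  positivity

theorem abs_typeMetric_sub_le (hγ : (toeplitz γ (p + 1)).PosDef) {ε : ℝ} (hn : 0 < n)
    {x x' : Fin n → ℝ} (hx : x ∈ typeClass n ε γ) (hx' : x' ∈ typeClass n ε γ) (α : Fin (K + 1) → ℝ) :
    |typeMetric p α x - typeMetric p α x'| ≤ 2 * n * ε * tapBound p α := by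
  have key : ∀ k ≤ p, |lagCorr x k - lagCorr x' k| ≤ 2 * n * ε := fun k hk => by
    have h1 := abs_lagCorr_sub_lt hγ hn hx hk
    have h2 := abs_lagCorr_sub_lt hγ hn hx' hk
    rw [abs_lt] at h1 h2
    rw [abs_le]
    constructor <;> linarith [h1.1, h1.2, h2.1, h2.2]
  have h1 : typeMetric p α x - typeMetric p α x' = 1 / 2 * (tapCorr α 0 * (lagCorr x 0 - lagCorr x' 0))
      + ∑ m ∈ Finset.Icc 1 (min p K), tapCorr α m * (lagCorr x m - lagCorr x' m) := by
    simp only [typeMetric, mul_sub, Finset.sum_sub_distrib]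
    ring
  rw [h1, tapBound, mul_add, Finset.mul_sum]
  refine (abs_add_le _ _).trans (add_le_add ?_ ((Finset.abs_sum_le_sum_abs _ _).trans
    (Finset.sum_le_sum fun m hm => ?_)))
  · rw [abs_mul, abs_mul, abs_of_pos (by norm_num : (0 : ℝ) < 1 / 2)]
    have := mul_le_mul_of_nonneg_left (key 0 (Nat.zero_le _)) (abs_nonneg (tapCorr α 0))
    linarith
  · rw [abs_mul, mul_comm]
    refine mul_le_mul_of_nonneg_right (key m ?_) (abs_nonneg _)
    simp only [Finset.mem_Icc] at hm
    omega

/-- Frequency by frequency the exponent is a concave quadratic in the transform of `x`. Its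
pointwise maximum bounds it and leaves an expression in the output alone. -/
theorem mul_sum_filterOut_sub_toepForm_le (hL : K ≤ L) {g : ℝ → ℝ} (hg : Continuous g) (hpos : ∀ ν, 0 < g ν)
    (α : Fin (K + 1) → ℝ) (w : ℝ) (x : Fin n → ℝ) (y : Fin (n + L) → ℝ) :
    w * ∑ t, y t * filterOut α (zeroPad L x) t - toepForm g x
      ≤ w ^ 2 / 4 * toepForm (fun ν => ‖fourier α ν‖ ^ 2 / g ν) y := by
  have hg0 : ∀ ν, g ν ≠ 0 := fun ν => (hpos ν).ne'
  rw [sum_filterOut_zeroPad_mul hL]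
  unfold toepForm
  rw [← cmean_const_mul, ← cmean_const_mul, ← cmean_sub (by fun_prop) (by fun_prop)]
  refine cmean_mono (by fun_prop) (by fun_prop (disch := assumption)) fun ν => ?_
  have h1 := two_re_mul_conj_le (hpos ν) (dft x ν) (((w / 2 : ℝ) : ℂ) * ((starRingEnd ℂ) (fourier α ν) * dft y ν))
  have h2 : (dft x ν * (starRingEnd ℂ) (((w / 2 : ℝ) : ℂ) * ((starRingEnd ℂ) (fourier α ν) * dft y ν))).re
      = w / 2 * (dft y ν * (starRingEnd ℂ) (fourier α ν * dft x ν)).re := by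
    rw [← Complex.conj_re, ← Complex.re_ofReal_mul]
    congr 1
    simp only [map_mul, Complex.conj_conj]
    ring
  rw [h2, norm_mul, norm_mul, RCLike.norm_conj, Complex.norm_real, Real.norm_eq_abs, mul_pow, mul_pow,
    sq_abs] at h1
  calc _ = 2 * (w / 2 * (dft y ν * (starRingEnd ℂ) (fourier α ν * dft x ν)).re) - g ν * ‖dft x ν‖ ^ 2 := by
        ring
    _ ≤ _ := h1
    _ = _ := by ring

/-- Chernoff bound for the volume of the competing codewords with a large score. -/
theorem volume_score_ge_le (hL : K ≤ L) (hn : 0 < n) {ε m : ℝ} (hm0 : 0 < m)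
    (hω : ∀ k, 0 ≤ ω k) (hm : ∀ ν, m ≤ gOmega α ω ν) (y : Fin (n + L) → ℝ) (s : ℝ) :
    volume {x : Fin n → ℝ | x ∈ typeClass n ε γ ∧ s ≤ score p α x y}
      ≤ ENNReal.ofReal (Real.exp (n * (1 / 2 * Real.log Real.pi
          - 1 / 2 * cmean (fun ν => Real.log (gOmega α ω ν)))
        + ω (Fin.last (p + 1)) ^ 2 / 4 * toepForm (fun ν => ‖fourier α ν‖ ^ 2 / gOmega α ω ν) y
        - ω (Fin.last (p + 1)) * s + n * ∑ k : Fin (p + 1), ω k.castSucc * (γ k + ε))) := by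
  have hn' : (0 : ℝ) < n := by exact_mod_cast hn
  set w := ω (Fin.last (p + 1)) with hw
  set c := -w * s + n * ∑ k : Fin (p + 1), ω k.castSucc * (γ k + ε) with hc
  set D := w ^ 2 / 4 * toepForm (fun ν => ‖fourier α ν‖ ^ 2 / gOmega α ω ν) y with hDdef
  have hpos : ∀ ν, 0 < gOmega α ω ν := fun ν => hm0.trans_le (hm ν)
  have hlin : IsLinearMap ℝ fun x : Fin n → ℝ => w * ∑ t, y t * filterOut α (zeroPad L x) t := by
    have h1 := fun t => isLinearMap_filterOut α (isLinearMap_zeroPad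
      (x := fun (x : Fin n → ℝ) => x) (fun t => ⟨fun _ _ => rfl, fun _ _ => rfl⟩) L) t
    constructor
    · intro x x'
      simp_rw [fun t => (h1 t).map_add x x', mul_add, Finset.sum_add_distrib, mul_add]
    · intro a x
      simp_rw [fun t => (h1 t).map_smul a x, smul_eq_mul, Finset.mul_sum]
      exact Finset.sum_congr rfl fun t _ => by ring
  have hb := isLinearMap_eq_dotProduct hlin
  set b : Fin n → ℝ := fun i => w * ∑ t, y t * filterOut α (zeroPad L (Pi.single i 1)) t with hbdef
  have hD : ∀ x : Fin n → ℝ, b ⬝ᵥ x - toepForm (gOmega α ω) x ≤ D := fun x => by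
    rw [← hb]
    exact mul_sum_filterOut_sub_toepForm_le hL (continuous_gOmega α ω) hpos α w x y
  have h1 := lintegral_exp_sub_toepForm_le (continuous_gOmega α ω) hm0 hm b hD
  -- The Chernoff step. Nonnegative multipliers let the upper bounds on the lags and the lower bound
  -- on the score be used with the right sign.
  have h2 : ∀ x ∈ {x : Fin n → ℝ | x ∈ typeClass n ε γ ∧ s ≤ score p α x y},
      (1 : ENNReal) ≤ ENNReal.ofReal (Real.exp c) *
        ENNReal.ofReal (Real.exp (b ⬝ᵥ x - toepForm (gOmega α ω) x)) := by
    rintro x ⟨hxT, hxs⟩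
    rw [← ENNReal.ofReal_mul (Real.exp_pos _).le, ← Real.exp_add, ← ENNReal.ofReal_one]
    refine ENNReal.ofReal_le_ofReal (Real.one_le_exp ?_)
    rw [← hb, toepForm_gOmega]
    have h3 : ∑ k : Fin (p + 1), ω k.castSucc * lagCorr x k
        ≤ n * ∑ k : Fin (p + 1), ω k.castSucc * (γ k + ε) := by
      rw [Finset.mul_sum]
      refine Finset.sum_le_sum fun k _ => ?_
      have h4 : |1 / (n : ℝ) * lagCorr x k - γ k| < ε := hxT k
      have h5 := (abs_lt.1 h4).2
      have h6 : lagCorr x k ≤ n * (γ k + ε) := by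
        have : lagCorr x k = n * (1 / (n : ℝ) * lagCorr x k) := by field_simp
        rw [this]
        exact mul_le_mul_of_nonneg_left (by linarith) hn'.le
      calc _ ≤ ω k.castSucc * (n * (γ k + ε)) := mul_le_mul_of_nonneg_left h6 (hω _)
        _ = _ := by ring
    have h7 : 0 ≤ w * (score p α x y - s) := mul_nonneg (hω _) (by linarith)
    rw [score] at h7
    rw [hc]
    linarith
  have hmeas : MeasurableSet {x : Fin n → ℝ | x ∈ typeClass n ε γ ∧ s ≤ score p α x y} :=
    (measurableSet_typeClass n ε γ).inter (isClosed_le continuous_const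
      ((continuous_score p α).comp (continuous_id.prodMk continuous_const))).measurableSet
  calc volume {x : Fin n → ℝ | x ∈ typeClass n ε γ ∧ s ≤ score p α x y}
      = ∫⁻ x in {x : Fin n → ℝ | x ∈ typeClass n ε γ ∧ s ≤ score p α x y}, 1 := by
        rw [setLIntegral_one]
    _ ≤ ∫⁻ x in {x : Fin n → ℝ | x ∈ typeClass n ε γ ∧ s ≤ score p α x y}, ENNReal.ofReal (Real.exp c) *
        ENNReal.ofReal (Real.exp (b ⬝ᵥ x - toepForm (gOmega α ω) x)) := setLIntegral_mono' hmeas h2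
    _ ≤ ∫⁻ x, ENNReal.ofReal (Real.exp c) *
        ENNReal.ofReal (Real.exp (b ⬝ᵥ x - toepForm (gOmega α ω) x)) := setLIntegral_le_lintegral _ _
    _ ≤ _ := by
        rw [lintegral_const_mul' _ _ ENNReal.ofReal_ne_top]
        refine (mul_le_mul_right h1 _).trans (le_of_eq ?_)
        rw [← ENNReal.ofReal_mul (Real.exp_pos _).le, ← Real.exp_add]
        congr 2
        rw [hc]; ring

/-- The objective at a weight vector whose trigonometric polynomial is positive. -/
def dualValue (h α : Fin (K + 1) → ℝ) (σ : ℝ) (γ : Fin (p + 1) → ℝ) (ω : Fin (p + 2) → ℝ) : ℝ :=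
  -(1 / 2) * cmean (fun ν => Real.log (gOmega α ω ν))
    + ω (Fin.last (p + 1)) ^ 2 / 4 *
      cmean (fun ν => ‖fourier α ν‖ ^ 2 / gOmega α ω ν * specY h σ γ ν)
    - ω (Fin.last (p + 1)) * scoreMean h α γ + ∑ k : Fin (p + 1), ω k.castSucc * γ k

/-- Given a typical pair, a codeword drawn from the type class competes with exponentially small
probability. -/
theorem eventually_cond_competitor_le (hL : K ≤ L) (hγ : (toeplitz γ (p + 1)).PosDef)
    (h : Fin (K + 1) → ℝ) {σ : ℝ} (hσ : 0 < σ) {ε m κ : ℝ} (hε : 0 < ε) (hm0 : 0 < m)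
    (hω : ∀ k, 0 ≤ ω k) (hm : ∀ ν, m ≤ gOmega α ω ν) :
    ∀ᶠ n : ℕ in atTop, ∀ (x : Fin n → ℝ) (y : Fin (n + L) → ℝ), x ∈ typeClass n ε γ →
      (x, y) ∉ atypical L p h α σ γ (fun ν => ‖fourier α ν‖ ^ 2 / gOmega α ω ν) κ n →
      ProbabilityTheory.cond volume (typeClass n ε γ)
        {x' | logV α σ y (zeroPad L x) ≤ logV α σ y (zeroPad L x')}
        ≤ ENNReal.ofReal (2 * Real.exp (n * (dualValue h α σ γ ω
          - 1 / 2 * Real.log (2 * Real.exp 1 * etaSq γ) + (ω (Fin.last (p + 1)) ^ 2 / 4 * κ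
          + ε * ∑ k : Fin (p + 1), ω k.castSucc
          + ω (Fin.last (p + 1)) * (κ + 2 * ε * tapBound p α) + ε / 2)))) := by
  filter_upwards [eventually_volume_typeClass_ge_exp hγ hε, eventually_gt_atTop 0] with n hvol hn x y hx hxy
  have hn' : (0 : ℝ) < n := by exact_mod_cast hn
  set f : ℝ → ℝ := fun ν => ‖fourier α ν‖ ^ 2 / gOmega α ω ν with hf
  set w := ω (Fin.last (p + 1)) with hw
  simp only [atypical, Set.mem_ofPred_eq, not_or, not_le] at hxy
  obtain ⟨hs, hy⟩ := hxy
  -- The subtracted term is the largest variation of `typeMetric` between two members of the type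
  -- class.
  set s := n * (scoreMean h α γ - κ) - 2 * n * ε * tapBound p α with hsdef
  have hsub : typeClass n ε γ ∩ {x' | logV α σ y (zeroPad L x) ≤ logV α σ y (zeroPad L x')}
      ⊆ {x' | x' ∈ typeClass n ε γ ∧ s ≤ score p α x' y} := by
    rintro x' ⟨hx', hV⟩
    refine ⟨hx', ?_⟩
    have h1 := (logV_zeroPad_le_iff hL p α hσ x x' y).1 hV
    have h2 := (abs_le.1 (abs_typeMetric_sub_le hγ hn hx hx' α)).2
    linarith
  have h1 := (measure_mono hsub).trans (volume_score_ge_le (γ := γ) hL hn (ε := ε) hm0 hω hm y s)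
  rw [cond_apply (measurableSet_typeClass n ε γ)]
  refine (mul_le_mul' (ENNReal.inv_le_inv.2 hvol) h1).trans ?_
  rw [← ENNReal.ofReal_inv_of_pos (by positivity), ← ENNReal.ofReal_mul (by positivity)]
  refine ENNReal.ofReal_le_ofReal ?_
  rw [inv_div, div_mul_eq_mul_div, mul_div_assoc, ← Real.exp_sub]
  refine mul_le_mul_of_nonneg_left (Real.exp_le_exp.2 ?_) (by norm_num)
  have hη := etaSq_pos hγ
  -- The `log π` of the Gaussian integral cancels the one in the volume, turning `2πe η²` into the
  -- `2e η²` of the rate.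
  have hlog : Real.log (2 * Real.pi * Real.exp 1 * etaSq γ)
      = Real.log Real.pi + Real.log (2 * Real.exp 1 * etaSq γ) := by
    rw [← Real.log_mul (by positivity) (by positivity)]; congr 1; ring
  have hsum : ∑ k : Fin (p + 1), ω k.castSucc * (γ k + ε)
      = ∑ k : Fin (p + 1), ω k.castSucc * γ k + ε * ∑ k : Fin (p + 1), ω k.castSucc := by
    rw [Finset.mul_sum, ← Finset.sum_add_distrib]
    exact Finset.sum_congr rfl fun k _ => by ring
  have hq := mul_le_mul_of_nonneg_left hy.le (by positivity : 0 ≤ w ^ 2 / 4)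
  rw [hlog, hsum, hsdef, dualValue, ← hw]
  linarith

end Competitor

/-! ### Error probability of the random code. -/

section Ensemble

variable {K L p n : ℕ} {γ : Fin (p + 1) → ℝ} {α : Fin (K + 1) → ℝ} {ω : Fin (p + 2) → ℝ}

theorem sum_sq_lt_of_mem_typeClass (hn : 0 < n) {ε : ℝ} {x : Fin n → ℝ} (hx : x ∈ typeClass n ε γ) :
    ∑ t, x t ^ 2 < n * (γ 0 + ε) := by
  have hn' : (0 : ℝ) < n := by exact_mod_cast hn
  have h1 : |1 / (n : ℝ) * lagCorr x 0 - γ 0| < ε := hx 0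
  have h2 := (abs_lt.1 h1).2
  rw [lagCorr_zero] at h2
  have h3 : ∑ t, x t ^ 2 = n * (1 / (n : ℝ) * ∑ t, x t ^ 2) := by field_simp
  rw [h3]
  exact mul_lt_mul_of_pos_left (by linarith) hn'

theorem volume_typeClass_ne_top (hn : 0 < n) (ε : ℝ) (γ : Fin (p + 1) → ℝ) :
    volume (typeClass n ε γ) ≠ ⊤ := by
  have hsub : typeClass n ε γ ⊆ Metric.closedBall 0 (n * (γ 0 + ε) + 1) := by
    intro x hx
    have h1 := sum_sq_lt_of_mem_typeClass hn hx
    have h0 : 0 ≤ ∑ t, x t ^ 2 := Finset.sum_nonneg fun _ _ => sq_nonneg _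
    rw [mem_closedBall_zero_iff, pi_norm_le_iff_of_nonneg (by linarith)]
    intro t
    have h2 := Finset.single_le_sum (f := fun t => x t ^ 2) (fun i _ => sq_nonneg _) (Finset.mem_univ t)
    rw [Real.norm_eq_abs]
    have h3 : |x t| ≤ x t ^ 2 + 1 := by
      rw [← sq_abs]; nlinarith [sq_nonneg (|x t| - 1), abs_nonneg (x t)]
    linarith
  exact ((measure_mono hsub).trans_lt measure_closedBall_lt_top).ne

theorem eventually_volume_typeClass_ne_zero (hγ : (toeplitz γ (p + 1)).PosDef) {ε : ℝ} (hε : 0 < ε) :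
    ∀ᶠ n : ℕ in atTop, volume (typeClass n ε γ) ≠ 0 := by
  filter_upwards [eventually_volume_typeClass_ge_exp hγ hε] with n hn
  exact ((ENNReal.ofReal_pos.2 (by positivity)).trans_le hn).ne'

theorem continuous_logV {N : ℕ} (α : Fin (K + 1) → ℝ) (σ : ℝ) :
    Continuous fun q : (Fin N → ℝ) × (Fin N → ℝ) => logV α σ q.1 q.2 := by
  unfold logV
  refine continuous_const.sub (continuous_const.mul (continuous_finsetSum _ fun t _ => ?_))
  exact (((continuous_apply t).comp continuous_fst).sub
    ((continuous_filterOut α t).comp continuous_snd)).pow 2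

/-- Pairwise independence of the codewords is all that the union bound uses. -/
theorem lintegral_pi_eval_pair {Ω : Type*} [MeasurableSpace Ω] {M : ℕ} (μ : Measure Ω)
    [IsProbabilityMeasure μ] {i j : Fin M} (hij : i ≠ j) {f : Ω × Ω → ENNReal} (hf : Measurable f) :
    ∫⁻ c : Fin M → Ω, f (c i, c j) ∂(Measure.pi fun _ => μ) = ∫⁻ q, f q ∂(μ.prod μ) := by
  have hind : iIndepFun (fun (i : Fin M) (c : Fin M → Ω) => c i) (Measure.pi fun _ => μ) :=
    iIndepFun_pi (X := fun _ x => x) fun _ => aemeasurable_id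
  have h1 := (indepFun_iff_map_prod_eq_prod_map_map (measurable_pi_apply i).aemeasurable
    (measurable_pi_apply j).aemeasurable).1 (hind.indepFun hij)
  have h2 : ∀ k : Fin M, (Measure.pi fun _ : Fin M => μ).map (fun c => c k) = μ := fun k =>
    (measurePreserving_eval (fun _ : Fin M => μ) k).map_eq
  rw [h2, h2] at h1
  rw [← h1, lintegral_map hf (by fun_prop)]

theorem measurable_channelLaw_section_pair (h : Fin (K + 1) → ℝ) (σ : ℝ)
    {E : Set (((Fin n → ℝ) × (Fin n → ℝ)) × (Fin (n + L) → ℝ))} (hE : MeasurableSet E) :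
    Measurable fun q : (Fin n → ℝ) × (Fin n → ℝ) =>
      channelLaw h σ (zeroPad L q.1) {y | (q, y) ∈ E} := by
  have h1 : ∀ q : (Fin n → ℝ) × (Fin n → ℝ), channelLaw h σ (zeroPad L q.1) {y | (q, y) ∈ E}
      = stdGauss (Fin (n + L)) {w | (q, fun t => filterOut h (zeroPad L q.1) t + σ * w t) ∈ E} := by
    intro q
    have hm : MeasurableSet {y | (q, y) ∈ E} := measurable_prodMk_left hE
    rw [channelLaw_eq_map, Measure.map_apply (by fun_prop) hm]
    rfl
  simp_rw [h1]
  have h2 : Measurable fun r : ((Fin n → ℝ) × (Fin n → ℝ)) × (Fin (n + L) → ℝ) =>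
      (r.1, fun t => filterOut h (zeroPad L r.1.1) t + σ * r.2 t) := by
    refine Continuous.measurable (continuous_fst.prodMk (continuous_pi fun t => ?_))
    exact ((continuous_filterOut_zeroPad L h t).comp (continuous_fst.comp continuous_fst)).add
      (continuous_const.mul ((continuous_apply t).comp continuous_snd))
  exact measurable_measure_prodMk_left (h2 hE)

theorem measurableSet_competitor (α : Fin (K + 1) → ℝ) (σ : ℝ)
    {A : Set ((Fin n → ℝ) × (Fin (n + L) → ℝ))} (hA : MeasurableSet A) :
    MeasurableSet {r : ((Fin n → ℝ) × (Fin n → ℝ)) × (Fin (n + L) → ℝ) |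
      (r.1.1, r.2) ∉ A ∧ logV α σ r.2 (zeroPad L r.1.1) ≤ logV α σ r.2 (zeroPad L r.1.2)} := by
  have h1 : MeasurableSet {r : ((Fin n → ℝ) × (Fin n → ℝ)) × (Fin (n + L) → ℝ) | (r.1.1, r.2) ∉ A} := by
    have : Measurable fun r : ((Fin n → ℝ) × (Fin n → ℝ)) × (Fin (n + L) → ℝ) => (r.1.1, r.2) := by
      fun_prop
    exact this hA.compl
  have hz : Continuous (zeroPad L : (Fin n → ℝ) → Fin (n + L) → ℝ) := continuous_zeroPad L
  have hc1 : Continuous fun r : ((Fin n → ℝ) × (Fin n → ℝ)) × (Fin (n + L) → ℝ) =>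
      (r.2, zeroPad L r.1.1) := by fun_prop
  have hc2 : Continuous fun r : ((Fin n → ℝ) × (Fin n → ℝ)) × (Fin (n + L) → ℝ) =>
      (r.2, zeroPad L r.1.2) := by fun_prop
  have h2 := (isClosed_le ((continuous_logV α σ).comp hc1)
    ((continuous_logV α σ).comp hc2)).measurableSet
  exact h1.inter h2

/-- Union bound for a random code with independent codewords of law `μ`. -/
theorem lintegral_errorProb_le (h α : Fin (K + 1) → ℝ) (σ : ℝ) {M : ℕ} (hM : 0 < M)
    (μ : Measure (Fin n → ℝ)) [IsProbabilityMeasure μ] {A : Set ((Fin n → ℝ) × (Fin (n + L) → ℝ))}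
    (hA : MeasurableSet A) {q : ENNReal}
    (hq : ∀ᵐ x ∂μ, ∀ y, (x, y) ∉ A → μ {x' | logV α σ y (zeroPad L x) ≤ logV α σ y (zeroPad L x')} ≤ q) :
    ∫⁻ c : Fin M → Fin n → ℝ, errorProb h α σ (fun i => zeroPad L (c i)) ∂(Measure.pi fun _ => μ)
      ≤ ∫⁻ x, channelLaw h σ (zeroPad L x) {y | (x, y) ∈ A} ∂μ + ((M - 1 : ℕ) : ENNReal) * q := by
  set E : Set (((Fin n → ℝ) × (Fin n → ℝ)) × (Fin (n + L) → ℝ)) :=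
    {r | (r.1.1, r.2) ∉ A ∧ logV α σ r.2 (zeroPad L r.1.1) ≤ logV α σ r.2 (zeroPad L r.1.2)} with hE
  have hEm : MeasurableSet E := measurableSet_competitor α σ hA
  set a : (Fin n → ℝ) → ENNReal := fun x => channelLaw h σ (zeroPad L x) {y | (x, y) ∈ A} with ha
  set b : (Fin n → ℝ) × (Fin n → ℝ) → ENNReal :=
    fun r => channelLaw h σ (zeroPad L r.1) {y | (r, y) ∈ E} with hb
  have ham : Measurable a := measurable_channelLaw_section h σ hA
  have hbm : Measurable b := measurable_channelLaw_section_pair h σ hEm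
  have hle : ∀ c : Fin M → Fin n → ℝ, errorProb h α σ (fun i => zeroPad L (c i))
      ≤ (∑ i, (a (c i) + ∑ j ∈ Finset.univ.erase i, b (c i, c j))) / M := by
    intro c
    unfold errorProb
    refine ENNReal.div_le_div_right (Finset.sum_le_sum fun i _ => ?_) _
    have hsub : {y | ∃ j, j ≠ i ∧ logV α σ y (zeroPad L (c i)) ≤ logV α σ y (zeroPad L (c j))} ⊆
        {y | (c i, y) ∈ A} ∪ ⋃ j ∈ Finset.univ.erase i, {y | ((c i, c j), y) ∈ E} := by
      rintro y ⟨j, hj, hV⟩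
      by_cases hyA : (c i, y) ∈ A
      · exact Or.inl hyA
      · exact Or.inr (Set.mem_iUnion₂.2 ⟨j, Finset.mem_erase.2 ⟨hj, Finset.mem_univ _⟩, hyA, hV⟩)
    exact (measure_mono hsub).trans ((measure_union_le _ _).trans
      (add_le_add_right (measure_biUnion_finset_le _ _) _))
  have hpair : ∫⁻ r, b r ∂(μ.prod μ) ≤ q := by
    rw [lintegral_prod _ hbm.aemeasurable]
    have h1 : ∀ᵐ x ∂μ, ∫⁻ x', b (x, x') ∂μ ≤ q := by
      filter_upwards [hq] with x hx
      have hEx : MeasurableSet {r : (Fin n → ℝ) × (Fin (n + L) → ℝ) | ((x, r.1), r.2) ∈ E} := by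
        have : Measurable fun r : (Fin n → ℝ) × (Fin (n + L) → ℝ) => ((x, r.1), r.2) := by fun_prop
        exact this hEm
      have h2 : ∫⁻ x', b (x, x') ∂μ
          = (μ.prod (channelLaw h σ (zeroPad L x))) {r | ((x, r.1), r.2) ∈ E} := by
        rw [Measure.prod_apply hEx]
        rfl
      -- Exchanging the order of integration fixes the output and draws the competitor, which is
      -- independent of it; `hq` is stated for this order.
      rw [h2, Measure.prod_apply_symm hEx]
      refine (lintegral_mono (g := fun _ => q) fun y => ?_).trans (by simp)
      by_cases hyA : (x, y) ∈ A
      · have : (fun x' => (x', y)) ⁻¹' {r : (Fin n → ℝ) × (Fin (n + L) → ℝ) | ((x, r.1), r.2) ∈ E} = ∅ := by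
          ext x'; simp [hE, hyA]
        rw [this]; simp
      · exact (measure_mono fun x' hx' => hx'.2).trans (hx y hyA)
    exact (lintegral_mono_ae h1).trans (by simp)
  have hMne : (M : ENNReal) ≠ 0 := by simpa using hM.ne'
  calc _ ≤ ∫⁻ c : Fin M → Fin n → ℝ, (∑ i, (a (c i) + ∑ j ∈ Finset.univ.erase i, b (c i, c j))) / M
        ∂(Measure.pi fun _ => μ) := lintegral_mono hle
    _ = (∑ i : Fin M, (∫⁻ x, a x ∂μ + ∑ j ∈ Finset.univ.erase i, ∫⁻ r, b r ∂(μ.prod μ))) / M := by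
        simp_rw [div_eq_mul_inv]
        rw [lintegral_mul_const' _ _ (ENNReal.inv_ne_top.2 hMne), lintegral_finsetSum]
        · congr 1
          refine Finset.sum_congr rfl fun i _ => ?_
          have hai : Measurable fun c : Fin M → Fin n → ℝ => a (c i) := ham.comp (measurable_pi_apply i)
          rw [lintegral_add_left hai, lintegral_finsetSum]
          · rw [(measurePreserving_eval (fun _ : Fin M => μ) i).lintegral_comp ham]
            congr 1
            exact Finset.sum_congr rfl fun j hj =>
              lintegral_pi_eval_pair μ (Finset.ne_of_mem_erase hj).symm hbm
          · exact fun j _ => hbm.comp ((measurable_pi_apply i).prodMk (measurable_pi_apply j))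
        · exact fun i _ => (ham.comp (measurable_pi_apply i)).add (Finset.measurable_sum _ fun j _ =>
            hbm.comp ((measurable_pi_apply i).prodMk (measurable_pi_apply j)))
    _ = ∫⁻ x, a x ∂μ + ((M - 1 : ℕ) : ENNReal) * ∫⁻ r, b r ∂(μ.prod μ) := by
        simp only [Finset.sum_const, Finset.card_erase_of_mem (Finset.mem_univ _), Finset.card_univ,
          Fintype.card_fin, nsmul_eq_mul]
        rw [mul_comm, ENNReal.mul_div_cancel_right hMne (ENNReal.natCast_ne_top M)]
    _ ≤ _ := add_le_add_right (mul_le_mul_right hpair _) _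

theorem ensembleErrorProb_tendsto_of_dualValue (hγ : (toeplitz γ (p + 1)).PosDef)
    (h : Fin (K + 1) → ℝ) {σ : ℝ} (hσ : 0 < σ) {m R : ℝ} (hm0 : 0 < m) (hω : ∀ k, 0 ≤ ω k)
    (hm : ∀ ν, m ≤ gOmega α ω ν)
    (hR : R < 1 / 2 * Real.log (2 * Real.exp 1 * etaSq γ) - dualValue h α σ γ ω) :
    ∃ ε₀ : ℝ, 0 < ε₀ ∧ ∀ ε : ℝ, 0 < ε → ε < ε₀ →
      Tendsto (fun n : ℕ => ensembleErrorProb h α σ γ ε n ⌈Real.exp (n * R)⌉₊) atTop (𝓝 0) := by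
  set w := ω (Fin.last (p + 1)) with hw
  have hw0 : 0 ≤ w := hω _
  set W := ∑ k : Fin (p + 1), ω k.castSucc with hW
  have hW0 : 0 ≤ W := Finset.sum_nonneg fun k _ => hω _
  have hB := tapBound_nonneg p α
  set Δ := 1 / 2 * Real.log (2 * Real.exp 1 * etaSq γ) - dualValue h α σ γ ω - R with hΔ
  have hΔ0 : 0 < Δ := by rw [hΔ]; linarith
  -- The slack `Δ` is budgeted: `κ` costs at most `Δ / 4` in the competitor exponent, `ε` another `Δ
  -- / 4`, and `exp (-n Δ / 2)` remains after the union bound.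
  set κ := Δ / (4 * (w ^ 2 / 4 + w + 1)) with hκ
  have hκ0 : 0 < κ := by positivity
  have hgpos : ∀ ν, 0 < gOmega α ω ν := fun ν => hm0.trans_le (hm ν)
  set f : ℝ → ℝ := fun ν => ‖fourier α ν‖ ^ 2 / gOmega α ω ν with hf
  have hfc : Continuous f := by
    have hg0 : ∀ ν, gOmega α ω ν ≠ 0 := fun ν => (hgpos ν).ne'
    rw [hf]; fun_prop (disch := assumption)
  obtain ⟨ε₁, hε₁, hatyp⟩ := exists_tendsto_atypical (le_max_right p K) hγ h α σ hfc
    (fun ν => by simp only [hf, gOmega_periodic α ω ν, normSq_fourier_periodic α ν])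
    (fun ν => by simp only [hf, gOmega_neg, fourier_eq_dft, normSq_dft_neg])
    (fun ν => div_nonneg (sq_nonneg _) (hgpos ν).le) hκ0
  set D := W + 2 * w * tapBound p α + 1 / 2 with hD
  have hD0 : 0 < D := by positivity
  refine ⟨min ε₁ (Δ / (4 * D)), lt_min hε₁ (by positivity), fun ε hε hεlt => ?_⟩
  have hεD : ε * D < Δ / 4 := by
    have := hεlt.trans_le (min_le_right _ _)
    rw [lt_div_iff₀ (by positivity)] at this
    linarith
  have hκle : κ * (w ^ 2 / 4 + w) ≤ Δ / 4 := by
    have : κ * (w ^ 2 / 4 + w + 1) = Δ / 4 := by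
      rw [hκ]; field_simp
    linarith
  have hlim : Tendsto (fun n : ℕ => ∫⁻ x, channelLaw h σ (zeroPad (max p K) x)
      {y | (x, y) ∈ atypical (max p K) p h α σ γ f κ n} ∂(ProbabilityTheory.cond volume (typeClass n ε γ))
      + ENNReal.ofReal 2 * ENNReal.ofReal (Real.exp (-(n * (Δ / 2))))) atTop (𝓝 0) := by
    have h1 := (hatyp ε hε (hεlt.trans_le (min_le_left _ _))).add (ENNReal.Tendsto.const_mul
      (a := ENNReal.ofReal 2) (tendsto_ofReal_exp_neg_mul (half_pos hΔ0)) (Or.inr (by simp)))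
    simpa using h1
  refine tendsto_of_tendsto_of_tendsto_of_le_of_le' tendsto_const_nhds hlim
    (Eventually.of_forall fun n => zero_le) ?_
  filter_upwards [eventually_volume_typeClass_ne_zero hγ hε, eventually_gt_atTop 0,
    eventually_cond_competitor_le (κ := κ) (le_max_right p K) hγ h hσ hε hm0 hω hm] with n hvol hn hcomp
  have hfin := volume_typeClass_ne_top hn ε γ
  have : IsProbabilityMeasure (ProbabilityTheory.cond volume (typeClass n ε γ)) :=
    cond_isProbabilityMeasure_of_finite hvol hfin
  have hMpos : 0 < ⌈Real.exp (n * R)⌉₊ := Nat.ceil_pos.2 (Real.exp_pos _)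
  refine (lintegral_errorProb_le h α σ hMpos _ (measurableSet_atypical h α σ γ hfc κ n)
    (q := ENNReal.ofReal (2 * Real.exp (n * (-R - Δ / 2)))) ?_).trans (add_le_add_right ?_ _)
  · filter_upwards [ae_cond_mem (measurableSet_typeClass n ε γ)] with x hx y hxy
    refine (hcomp x y hx hxy).trans (ENNReal.ofReal_le_ofReal ?_)
    refine mul_le_mul_of_nonneg_left (Real.exp_le_exp.2 (mul_le_mul_of_nonneg_left ?_
      (Nat.cast_nonneg n))) (by norm_num)
    rw [hD] at hεD
    rw [← hw, ← hW]
    nlinarith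
  · have h1 : (((⌈Real.exp (n * R)⌉₊ - 1 : ℕ)) : ENNReal) ≤ ENNReal.ofReal (Real.exp (n * R)) := by
      rw [← ENNReal.ofReal_natCast]
      refine ENNReal.ofReal_le_ofReal ?_
      have := Nat.ceil_lt_add_one (Real.exp_pos (n * R)).le
      rw [Nat.cast_sub hMpos]
      push_cast
      linarith
    refine (mul_le_mul_left h1 _).trans (le_of_eq ?_)
    rw [← ENNReal.ofReal_mul (Real.exp_pos _).le, ← ENNReal.ofReal_mul (by norm_num)]
    congr 1
    rw [mul_left_comm, ← Real.exp_add]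
    congr 2
    ring

end Ensemble

/-! ### The dual objective: convexity and positive multipliers. -/

section Dual

variable {K p : ℕ} {γ : Fin (p + 1) → ℝ} {α : Fin (K + 1) → ℝ} {ω ω' : Fin (p + 2) → ℝ}

theorem gOmega_combo (α : Fin (K + 1) → ℝ) (ω ω' : Fin (p + 2) → ℝ) (a b ν : ℝ) :
    gOmega α (a • ω + b • ω') ν = a * gOmega α ω ν + b * gOmega α ω' ν := by
  simp only [gOmega, Pi.add_apply, Pi.smul_apply, smul_eq_mul, add_mul, Finset.sum_add_distrib, mul_add,
    Finset.mul_sum]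
  simp only [mul_assoc]
  ring

theorem gOmega_eq (α : Fin (K + 1) → ℝ) (ω : Fin (p + 2) → ℝ) (ν : ℝ) :
    gOmega α ω ν = ω 0 + ∑ i : Fin p, ω i.succ.castSucc * Real.cos (((i : ℕ) + 1 : ℕ) * ν)
      + ω (Fin.last (p + 1)) * ∑ k ∈ Finset.Icc (1 + min p K) K, tapCorr α k * Real.cos (k * ν) := by
  rw [gOmega, Fin.sum_univ_succ]
  simp

/-- The defining inequality of `𝒲` says that `ω_0` dominates the sum of the absolute coefficients of
all other cosines. -/
theorem gOmega_nonneg (hω : ω ∈ dualSet p α) (ν : ℝ) : 0 ≤ gOmega α ω ν := by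
  obtain ⟨hpos, hle⟩ := hω
  rw [gOmega_eq]
  have h1 : -∑ i : Fin p, ω i.succ.castSucc
      ≤ ∑ i : Fin p, ω i.succ.castSucc * Real.cos (((i : ℕ) + 1 : ℕ) * ν) := by
    rw [← Finset.sum_neg_distrib]
    refine Finset.sum_le_sum fun i _ => ?_
    nlinarith [hpos i.succ.castSucc, Real.neg_one_le_cos (((i : ℕ) + 1 : ℕ) * ν)]
  have h2 : -∑ k ∈ Finset.Icc (1 + min p K) K, |tapCorr α k|
      ≤ ∑ k ∈ Finset.Icc (1 + min p K) K, tapCorr α k * Real.cos (k * ν) := by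
    rw [← Finset.sum_neg_distrib]
    refine Finset.sum_le_sum fun k _ => ?_
    refine (neg_le_neg ?_).trans (neg_abs_le _)
    rw [abs_mul]
    exact mul_le_of_le_one_right (abs_nonneg _) (Real.abs_cos_le_one _)
  have h3 := mul_le_mul_of_nonneg_left h2 (hpos (Fin.last (p + 1))).le
  linarith

theorem cmean_gOmega (α : Fin (K + 1) → ℝ) (ω : Fin (p + 2) → ℝ) : cmean (gOmega α ω) = ω 0 := by
  have h1 : gOmega α ω = fun ν => ω 0 + ∑ i : Fin p, ω i.succ.castSucc * Real.cos (((i : ℕ) + 1 : ℕ) * ν)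
      + ω (Fin.last (p + 1)) * ∑ k ∈ Finset.Icc (1 + min p K) K, tapCorr α k * Real.cos (k * ν) :=
    funext (gOmega_eq α ω)
  have h2 : ∀ k : ℕ, 1 ≤ k → cmean (fun ν => Real.cos (k * ν)) = 0 := fun k hk => by
    have := cmean_cos (k : ℤ)
    rw [if_neg (by omega)] at this
    exact_mod_cast this
  rw [h1, cmean_add (by fun_prop) (by fun_prop), cmean_add (by fun_prop) (by fun_prop), cmean_const,
    cmean_sum _ (fun i _ => by fun_prop), cmean_const_mul, cmean_sum _ (fun i _ => by fun_prop)]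
  simp_rw [cmean_const_mul]
  rw [Finset.sum_eq_zero fun i _ => by rw [h2 _ (by omega), mul_zero],
    Finset.sum_eq_zero fun k hk => by rw [h2 _ (by simp at hk; omega), mul_zero]]
  ring

theorem analyticOnNhd_gOmega (α : Fin (K + 1) → ℝ) (ω : Fin (p + 2) → ℝ) :
    AnalyticOnNhd ℝ (gOmega α ω) Set.univ := by
  intro ν _
  unfold gOmega
  fun_prop

/-- Zeros of an analytic function produce only integrable logarithmic singularities, so the entropy
term is meaningful on the boundary of `𝒲` too. -/
theorem intervalIntegrable_log_gOmega (α : Fin (K + 1) → ℝ) (ω : Fin (p + 2) → ℝ) (a b : ℝ) :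
    IntervalIntegrable (fun ν => Real.log (gOmega α ω ν)) volume a b :=
  MeromorphicOn.intervalIntegrable_log fun ν _ => (analyticOnNhd_gOmega α ω ν trivial).meromorphicAt

/-- The mean of `g_ω` is `ω_0 > 0`, so this analytic function is not identically zero; its zeros are
discrete and hence null. -/
theorem ae_gOmega_pos (hω : ω ∈ dualSet p α) {s : Set ℝ} (hs : MeasurableSet s) :
    ∀ᵐ ν ∂(volume.restrict s), 0 < gOmega α ω ν := by
  have h0 : ∃ ν, gOmega α ω ν ≠ 0 := by
    by_contra! hall
    have h1 := cmean_gOmega α ω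
    rw [funext hall, cmean_const] at h1
    exact (hω.1 0).ne h1
  obtain ⟨ν₀, hν₀⟩ := h0
  have h1 := (analyticOnNhd_gOmega α ω).preimage_zero_mem_codiscrete hν₀
  have h2 : ∀ᶠ ν in codiscreteWithin s, gOmega α ω ν ≠ 0 := by
    have h3 : (gOmega α ω ⁻¹' {0})ᶜ ∈ codiscreteWithin s := codiscreteWithin_mono (Set.subset_univ s) h1
    exact h3
  filter_upwards [ae_restrict_le_codiscreteWithin hs h2] with ν hν
  exact lt_of_le_of_ne (gOmega_nonneg hω ν) (Ne.symm hν)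

theorem convex_dualSet (p : ℕ) (α : Fin (K + 1) → ℝ) : Convex ℝ (dualSet p α) := by
  rintro ω ⟨h1, h2⟩ ω' ⟨h1', h2'⟩ a b ha hb hab
  refine ⟨fun k => ?_, ?_⟩
  · rcases ha.eq_or_lt with rfl | ha
    · have : b = 1 := by linarith
      simpa [this] using h1' k
    · exact add_pos_of_pos_of_nonneg (mul_pos ha (h1 k)) (mul_nonneg hb (h1' k).le)
  · simp only [Pi.add_apply, Pi.smul_apply, smul_eq_mul, Finset.sum_add_distrib, ← Finset.mul_sum]
    nlinarith [mul_le_mul_of_nonneg_left h2 ha, mul_le_mul_of_nonneg_left h2' hb]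

/-- The linear part of the objective. -/
def dualLin (h α : Fin (K + 1) → ℝ) (γ : Fin (p + 1) → ℝ) (ω : Fin (p + 2) → ℝ) : ℝ :=
  -(ω (Fin.last (p + 1)) * scoreMean h α γ) + ∑ k : Fin (p + 1), ω k.castSucc * γ k

/-- The fractional part of the objective. -/
def dualQuad (h α : Fin (K + 1) → ℝ) (σ : ℝ) (γ : Fin (p + 1) → ℝ) (ω : Fin (p + 2) → ℝ) : ENNReal :=
  ENNReal.ofReal (ω (Fin.last (p + 1)) ^ 2 / (8 * Real.pi)) *
    ∫⁻ ν in Set.Icc (0 : ℝ) (2 * Real.pi),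
      ENNReal.ofReal (specY h σ γ ν * ‖fourier α ν‖ ^ 2) / ENNReal.ofReal (gOmega α ω ν)

theorem objective_eq (h α : Fin (K + 1) → ℝ) (σ : ℝ) (γ : Fin (p + 1) → ℝ) (ω : Fin (p + 2) → ℝ) :
    objective h α σ γ ω = ((-(1 / 2) * cmean (fun ν => Real.log (gOmega α ω ν)) + dualLin h α γ ω : ℝ) : EReal)
      + (dualQuad h α σ γ ω : EReal) := by
  unfold objective dualQuad
  congr 2
  unfold dualLin scoreMean cmean
  field_simp
  ring

theorem cmean_log_concave (hω : ω ∈ dualSet p α) (hω' : ω' ∈ dualSet p α) {a b : ℝ} (ha : 0 ≤ a)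
    (hb : 0 ≤ b) (hab : a + b = 1) :
    a * cmean (fun ν => Real.log (gOmega α ω ν)) + b * cmean (fun ν => Real.log (gOmega α ω' ν))
      ≤ cmean (fun ν => Real.log (gOmega α (a • ω + b • ω') ν)) := by
  have hpi := Real.pi_pos
  unfold cmean
  have h1 : a * ∫ ν in (0 : ℝ)..(2 * Real.pi), Real.log (gOmega α ω ν)
      = ∫ ν in (0 : ℝ)..(2 * Real.pi), a * Real.log (gOmega α ω ν) :=
    (intervalIntegral.integral_const_mul _ _).symm
  have h2 : b * ∫ ν in (0 : ℝ)..(2 * Real.pi), Real.log (gOmega α ω' ν)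
      = ∫ ν in (0 : ℝ)..(2 * Real.pi), b * Real.log (gOmega α ω' ν) :=
    (intervalIntegral.integral_const_mul _ _).symm
  have i1 := (intervalIntegrable_log_gOmega α ω 0 (2 * Real.pi)).const_mul a
  have i2 := (intervalIntegrable_log_gOmega α ω' 0 (2 * Real.pi)).const_mul b
  rw [mul_left_comm, mul_left_comm b, h1, h2, ← mul_add, ← intervalIntegral.integral_add i1 i2]
  refine mul_le_mul_of_nonneg_left ?_ (by positivity)
  refine intervalIntegral.integral_mono_ae_restrict (by positivity) (i1.add i2)
    (intervalIntegrable_log_gOmega α _ 0 (2 * Real.pi)) ?_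
  filter_upwards [ae_gOmega_pos hω measurableSet_Icc, ae_gOmega_pos hω' measurableSet_Icc] with ν h1 h2
  rw [gOmega_combo]
  exact strictConcaveOn_log_Ioi.concaveOn.2 h1 h2 ha hb hab

/-- Joint convexity of `u² / g`, the perspective of the square. After clearing denominators the
defect is the explicit term `a b (u g' - v g)² / (g g')`. -/
theorem sq_div_convex {a b u v g g' : ℝ} (ha : 0 ≤ a) (hb : 0 ≤ b) (hab : a + b = 1) (hg : 0 < g)
    (hg' : 0 < g') : (a * u + b * v) ^ 2 / (a * g + b * g') ≤ a * (u ^ 2 / g) + b * (v ^ 2 / g') := by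
  have hpos : 0 < a * g + b * g' := by
    rcases ha.eq_or_lt with rfl | ha
    · have : b = 1 := by linarith
      simpa [this] using hg'
    · have := mul_nonneg hb hg'.le
      positivity
  rw [div_le_iff₀ hpos]
  have h1 : (a * (u ^ 2 / g) + b * (v ^ 2 / g')) * (a * g + b * g') - (a * u + b * v) ^ 2
      = a * b * ((u * g' - v * g) ^ 2 / (g * g')) := by
    field_simp; ring
  have h2 : 0 ≤ a * b * ((u * g' - v * g) ^ 2 / (g * g')) := by positivity
  linarith

theorem measurable_dualQuad_integrand (hγ : (toeplitz γ (p + 1)).PosDef) (h α : Fin (K + 1) → ℝ) (σ : ℝ)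
    (ω : Fin (p + 2) → ℝ) : Measurable fun ν =>
      ENNReal.ofReal (specY h σ γ ν * ‖fourier α ν‖ ^ 2) / ENNReal.ofReal (gOmega α ω ν) := by
  have h1 := (continuous_specY hγ h σ).measurable
  have h2 := (continuous_fourier α).measurable
  have h3 := (continuous_gOmega α ω).measurable
  fun_prop

theorem dualQuad_convex (hγ : (toeplitz γ (p + 1)).PosDef) (h : Fin (K + 1) → ℝ) (σ : ℝ)
    (hω : ω ∈ dualSet p α) (hω' : ω' ∈ dualSet p α) {a b : ℝ} (ha : 0 ≤ a)
    (hb : 0 ≤ b) (hab : a + b = 1) :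
    dualQuad h α σ γ (a • ω + b • ω')
      ≤ ENNReal.ofReal a * dualQuad h α σ γ ω + ENNReal.ofReal b * dualQuad h α σ γ ω' := by
  have hpi := Real.pi_pos
  have hm := measurable_dualQuad_integrand hγ h α σ (p := p)
  unfold dualQuad
  rw [← mul_assoc, ← mul_assoc, ← lintegral_const_mul _ (hm _), ← lintegral_const_mul _ (hm _),
    ← lintegral_const_mul _ (hm _), ← lintegral_add_left ((hm ω).const_mul _)]
  refine lintegral_mono_ae ?_
  filter_upwards [ae_gOmega_pos hω measurableSet_Icc, ae_gOmega_pos hω' measurableSet_Icc,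
    ae_gOmega_pos (convex_dualSet p α hω hω' ha hb hab) measurableSet_Icc] with ν h1 h2 h3
  set q := specY h σ γ ν * ‖fourier α ν‖ ^ 2 with hq
  have hq0 : 0 ≤ q := by
    have := (specX_pos hγ ν).le
    rw [hq, specY]; positivity
  rw [← ENNReal.ofReal_div_of_pos h1, ← ENNReal.ofReal_div_of_pos h2, ← ENNReal.ofReal_div_of_pos h3,
    ← ENNReal.ofReal_mul ha, ← ENNReal.ofReal_mul hb, ← ENNReal.ofReal_mul (by positivity),
    ← ENNReal.ofReal_mul (by positivity), ← ENNReal.ofReal_mul (by positivity),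
    ← ENNReal.ofReal_add (by positivity) (by positivity)]
  refine ENNReal.ofReal_le_ofReal ?_
  have h4 := mul_le_mul_of_nonneg_left (sq_div_convex ha hb hab h1 h2 (u := ω (Fin.last (p + 1)))
    (v := ω' (Fin.last (p + 1)))) (by positivity : 0 ≤ q / (8 * Real.pi))
  rw [gOmega_combo]
  simp only [Pi.add_apply, Pi.smul_apply, smul_eq_mul]
  calc _ = _ := by ring
    _ ≤ _ := h4
    _ = _ := by ring

theorem dualLin_combo (h α : Fin (K + 1) → ℝ) (γ : Fin (p + 1) → ℝ) (ω ω' : Fin (p + 2) → ℝ) (a b : ℝ) :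
    dualLin h α γ (a • ω + b • ω') = a * dualLin h α γ ω + b * dualLin h α γ ω' := by
  simp only [dualLin, Pi.add_apply, Pi.smul_apply, smul_eq_mul, add_mul, Finset.sum_add_distrib, mul_add,
    Finset.mul_sum]
  simp only [mul_assoc]
  ring

theorem objective_convex (hγ : (toeplitz γ (p + 1)).PosDef) (h : Fin (K + 1) → ℝ) (σ : ℝ)
    (hω : ω ∈ dualSet p α) (hω' : ω' ∈ dualSet p α) {a b : ℝ} (ha : 0 ≤ a)
    (hb : 0 ≤ b) (hab : a + b = 1) :
    objective h α σ γ (a • ω + b • ω')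
      ≤ (a : EReal) * objective h α σ γ ω + (b : EReal) * objective h α σ γ ω' := by
  -- Distributivity is delicate in `EReal`; it holds here because the scalar is nonnegative and
  -- finite.
  have hdist : ∀ {c : ℝ} (_ : 0 ≤ c) (r : ℝ) (q : ENNReal), (c : EReal) * ((r : EReal) + (q : EReal))
      = ((c * r : ℝ) : EReal) + ((ENNReal.ofReal c * q : ENNReal) : EReal) := fun {c} hc r q => by
    rw [EReal.left_distrib_of_nonneg_of_ne_top (EReal.coe_nonneg.2 hc) (EReal.coe_ne_top c),
      EReal.coe_ennreal_mul, EReal.coe_ennreal_ofReal, max_eq_left hc, EReal.coe_mul]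
  rw [objective_eq, objective_eq, objective_eq, hdist ha, hdist hb, add_add_add_comm, ← EReal.coe_add,
    ← EReal.coe_ennreal_add]
  refine add_le_add (EReal.coe_le_coe_iff.2 ?_)
    (EReal.coe_ennreal_le_coe_ennreal_iff.2 (dualQuad_convex hγ h σ hω hω' ha hb hab))
  have := cmean_log_concave hω hω' ha hb hab
  rw [dualLin_combo]
  linarith

theorem objective_eq_dualValue (hγ : (toeplitz γ (p + 1)).PosDef) (h : Fin (K + 1) → ℝ) (σ : ℝ)
    (hpos : ∀ ν, 0 < gOmega α ω ν) : objective h α σ γ ω = (dualValue h α σ γ ω : EReal) := by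
  have hpi := Real.pi_pos
  have hg0 : ∀ ν, gOmega α ω ν ≠ 0 := fun ν => (hpos ν).ne'
  have hY := continuous_specY hγ h σ
  have hc : Continuous fun ν => ‖fourier α ν‖ ^ 2 / gOmega α ω ν * specY h σ γ ν := by
    fun_prop (disch := assumption)
  have hnn : ∀ ν, 0 ≤ ‖fourier α ν‖ ^ 2 / gOmega α ω ν * specY h σ γ ν := fun ν => by
    have := (specX_pos hγ ν).le
    have := (hpos ν).le
    rw [specY]; positivity
  have hq : dualQuad h α σ γ ω = ENNReal.ofReal (ω (Fin.last (p + 1)) ^ 2 / 4 *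
      cmean (fun ν => ‖fourier α ν‖ ^ 2 / gOmega α ω ν * specY h σ γ ν)) := by
    have h1 : ∫⁻ ν in Set.Icc (0 : ℝ) (2 * Real.pi), ENNReal.ofReal (specY h σ γ ν * ‖fourier α ν‖ ^ 2)
          / ENNReal.ofReal (gOmega α ω ν)
        = ENNReal.ofReal (∫ ν in (0 : ℝ)..(2 * Real.pi),
          ‖fourier α ν‖ ^ 2 / gOmega α ω ν * specY h σ γ ν) := by
      rw [intervalIntegral.integral_of_le (by positivity), ← integral_Icc_eq_integral_Ioc,
        ofReal_integral_eq_lintegral_ofReal (hc.integrableOn_Icc) (Eventually.of_forall hnn)]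
      refine lintegral_congr fun ν => ?_
      rw [← ENNReal.ofReal_div_of_pos (hpos ν)]
      congr 1; ring
    rw [dualQuad, h1, ← ENNReal.ofReal_mul (by positivity), cmean]
    congr 1
    field_simp
    ring
  rw [objective_eq, hq, EReal.coe_ennreal_ofReal,
    max_eq_left (mul_nonneg (by positivity) (cmean_nonneg hc hnn)), ← EReal.coe_add, dualValue, dualLin]
  congr 1
  ring

/-- Every rate below the rate formula is certified by a weight vector with a positive trigonometric
polynomial. -/
theorem exists_dualValue_lt (hγ : (toeplitz γ (p + 1)).PosDef) (h α : Fin (K + 1) → ℝ) (σ : ℝ) {R : ℝ}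
    (hR : (R : EReal) < rateI2 h α σ γ) :
    ∃ ω : Fin (p + 2) → ℝ, ∃ m : ℝ, 0 < m ∧ (∀ k, 0 ≤ ω k) ∧ (∀ ν, m ≤ gOmega α ω ν) ∧
      R < 1 / 2 * Real.log (2 * Real.exp 1 * etaSq γ) - dualValue h α σ γ ω := by
  have hpi := Real.pi_pos
  set c := 1 / 2 * Real.log (2 * Real.exp 1 * etaSq γ) with hc
  have h1 : (⨅ ω ∈ dualSet p α, objective h α σ γ ω) < ((c - R : ℝ) : EReal) := by
    by_contra! hle
    have h2 : rateI2 h α σ γ ≤ (c : EReal) - ((c - R : ℝ) : EReal) := EReal.sub_le_sub le_rfl hle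
    rw [← EReal.coe_sub] at h2
    have h3 := hR.trans_le h2
    rw [EReal.coe_lt_coe_iff] at h3
    linarith
  obtain ⟨ω, h2⟩ := iInf_lt_iff.1 h1
  obtain ⟨hω, h2⟩ := iInf_lt_iff.1 h2
  rw [objective_eq] at h2
  have hγ0 := posDef_zero_pos hγ
  set A := -(1 / 2) * cmean (fun ν => Real.log (gOmega α ω ν)) + dualLin h α γ ω with hA
  have hQ : dualQuad h α σ γ ω ≠ ⊤ := by
    intro htop
    rw [htop] at h2
    simp at h2
  obtain ⟨Q, hQ'⟩ : ∃ Q : NNReal, (Q : ENNReal) = dualQuad h α σ γ ω := ⟨_, ENNReal.coe_toNNReal hQ⟩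
  rw [← hQ'] at h2
  have h3 : A + Q < c - R := by
    have : ((A + (Q : ℝ) : ℝ) : EReal) < ((c - R : ℝ) : EReal) := by
      rw [EReal.coe_add]; exact h2
    exact EReal.coe_lt_coe_iff.1 this
  -- Raising `ω_0` by `τ` lifts `g_ω` to at least `τ`, increases the logarithmic mean and decreases
  -- the fractional term. The only cost is `τ γ_0`, half of the available slack.
  set τ := (c - R - (A + Q)) / (2 * γ 0) with hτ
  have hτ0 : 0 < τ := div_pos (by linarith) (by linarith)
  set e : Fin (p + 2) → ℝ := Pi.single 0 τ with he
  have hlast : e (Fin.last (p + 1)) = 0 := Pi.single_eq_of_ne (Fin.last_pos).ne' _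
  have hg : ∀ ν, gOmega α (ω + e) ν = gOmega α ω ν + τ := by
    intro ν
    have h4 : gOmega α e ν = τ := by
      rw [gOmega_eq, hlast, Finset.sum_eq_zero]
      · simp [he]
      · intro i _
        rw [he, Pi.single_eq_of_ne, zero_mul]
        exact fun hi => Fin.succ_ne_zero i (Fin.castSucc_eq_zero_iff.1 hi)
    have h5 := gOmega_combo α ω e 1 1 ν
    simp only [one_smul, one_mul] at h5
    rw [h5, h4]
  have hle : ∀ ν, τ ≤ gOmega α (ω + e) ν := fun ν => by
    rw [hg]; linarith [gOmega_nonneg hω ν]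
  have hpos : ∀ ν, 0 < gOmega α (ω + e) ν := fun ν => hτ0.trans_le (hle ν)
  refine ⟨ω + e, τ, hτ0, fun k => ?_, hle, ?_⟩
  · refine add_nonneg (hω.1 k).le ?_
    rw [he, Pi.single_apply]
    split_ifs
    · exact hτ0.le
    · exact le_rfl
  have hlin : dualLin h α γ (ω + e) = dualLin h α γ ω + τ * γ 0 := by
    have h5 := dualLin_combo h α γ ω e 1 1
    simp only [one_smul, one_mul] at h5
    rw [h5]
    congr 1
    rw [dualLin, hlast, Fin.sum_univ_succ, Finset.sum_eq_zero]
    · simp [he]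
    · intro i _
      rw [he, Pi.single_eq_of_ne, zero_mul]
      exact fun hi => Fin.succ_ne_zero i (Fin.castSucc_eq_zero_iff.1 hi)
  have hlog : cmean (fun ν => Real.log (gOmega α ω ν)) ≤ cmean (fun ν => Real.log (gOmega α (ω + e) ν)) := by
    unfold cmean
    refine mul_le_mul_of_nonneg_left ?_ (by positivity)
    refine intervalIntegral.integral_mono_ae_restrict (by positivity)
      (intervalIntegrable_log_gOmega α _ 0 (2 * Real.pi))
      (intervalIntegrable_log_gOmega α _ 0 (2 * Real.pi)) ?_
    filter_upwards [ae_gOmega_pos hω measurableSet_Icc] with ν hν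
    exact Real.log_le_log hν (by rw [hg]; linarith)
  have hquad : dualQuad h α σ γ (ω + e) ≤ Q := by
    rw [hQ']
    unfold dualQuad
    rw [Pi.add_apply, hlast, add_zero]
    refine mul_le_mul_right (lintegral_mono fun ν => ?_) _
    refine ENNReal.div_le_div_left (ENNReal.ofReal_le_ofReal ?_) _
    rw [hg]; linarith
  have h6 : ((dualValue h α σ γ (ω + e) : ℝ) : EReal) ≤ ((A + τ * γ 0 + Q : ℝ) : EReal) := by
    rw [← objective_eq_dualValue hγ h σ hpos, objective_eq, EReal.coe_add (A + τ * γ 0)]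
    refine add_le_add (EReal.coe_le_coe_iff.2 ?_) ?_
    · rw [hlin]; linarith
    · exact EReal.coe_ennreal_le_coe_ennreal_iff.2 hquad
  have h7 := EReal.coe_le_coe_iff.1 h6
  have h8 : τ * γ 0 = (c - R - (A + Q)) / 2 := by
    rw [hτ]; field_simp
  linarith

end Dual

/-! ### Scaling the autocorrelation vector. -/

section Scaling

variable {K p : ℕ} {γ : Fin (p + 1) → ℝ} {α : Fin (K + 1) → ℝ} {ω : Fin (p + 2) → ℝ} {r : ℝ}

theorem toeplitz_smul (r : ℝ) (γ : Fin (p + 1) → ℝ) (m : ℕ) : toeplitz (r • γ) m = r • toeplitz γ m := by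
  ext i j
  simp only [toeplitz, Matrix.of_apply, Matrix.smul_apply, smul_eq_mul, zeroExt]
  split_ifs
  · rfl
  · simp

theorem posDef_toeplitz_smul (hγ : (toeplitz γ (p + 1)).PosDef) (hr : 0 < r) :
    (toeplitz (r • γ) (p + 1)).PosDef := by
  rw [toeplitz_smul]
  exact hγ.smul hr

theorem yuleWalker_smul (hγ : (toeplitz γ (p + 1)).PosDef) (hr : 0 < r) :
    yuleWalker (r • γ) = yuleWalker γ := by
  have hdet : IsUnit (toeplitz γ p).det := (toeplitz_posDef_of_succ hγ).det_pos.ne'.isUnit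
  have : Invertible r := invertibleOfNonzero hr.ne'
  unfold yuleWalker
  have h1 : (fun m : Fin p => (r • γ) m.succ) = r • fun m : Fin p => γ m.succ := rfl
  rw [toeplitz_smul, Matrix.inv_smul _ _ hdet, h1, Matrix.mulVec_smul, Matrix.smul_mulVec, smul_smul,
    mul_invOf_self, one_smul]

theorem arGain_smul (hγ : (toeplitz γ (p + 1)).PosDef) (hr : 0 < r) : arGain (r • γ) = arGain γ := by
  ext ν
  rw [arGain, arGain, yuleWalker_smul hγ hr]

theorem etaSq_smul (hγ : (toeplitz γ (p + 1)).PosDef) (hr : 0 < r) : etaSq (r • γ) = r * etaSq γ := by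
  rw [etaSq, etaSq, arGain_smul hγ hr, Pi.smul_apply, smul_eq_mul, mul_assoc]

theorem specX_smul (hγ : (toeplitz γ (p + 1)).PosDef) (hr : 0 < r) (ν : ℝ) :
    specX (r • γ) ν = r * specX γ ν := by
  rw [specX, specX, etaSq_smul hγ hr, arGain_smul hγ hr, mul_div_assoc]

theorem autocov_smul (hγ : (toeplitz γ (p + 1)).PosDef) (hr : 0 < r) (m : ℕ) :
    autocov (r • γ) m = r * autocov γ m := by
  rw [← covX_eq_autocov hγ, ← covX_eq_autocov (posDef_toeplitz_smul hγ hr), covX, covX, ← cmean_const_mul]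
  simp_rw [specX_smul hγ hr, mul_assoc]

theorem scoreMean_smul (hγ : (toeplitz γ (p + 1)).PosDef) (hr : 0 < r) (h α : Fin (K + 1) → ℝ) :
    scoreMean h α (r • γ) = r * scoreMean h α γ := by
  simp only [scoreMean, autocov_smul hγ hr, mul_sub, Finset.mul_sum]
  congr 1
  · exact Finset.sum_congr rfl fun k _ => Finset.sum_congr rfl fun i _ => by ring
  · exact Finset.sum_congr rfl fun k _ => by ring

/-- The linear terms scale exactly. The noise in `S_Y` does not scale, but `S_Y` only decreases with
the power, so the fractional term can be bounded by its old value. -/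
theorem dualValue_smul_le (hγ : (toeplitz γ (p + 1)).PosDef) (hr : 0 < r) (hr1 : r ≤ 1)
    (h : Fin (K + 1) → ℝ) (σ : ℝ) (hpos : ∀ ν, 0 < gOmega α ω ν) :
    dualValue h α σ (r • γ) ω ≤ dualValue h α σ γ ω + (1 - r) *
      (ω (Fin.last (p + 1)) * scoreMean h α γ - ∑ k : Fin (p + 1), ω k.castSucc * γ k) := by
  have hg0 : ∀ ν, gOmega α ω ν ≠ 0 := fun ν => (hpos ν).ne'
  have hY := continuous_specY hγ h σ
  have hY' := continuous_specY (posDef_toeplitz_smul hγ hr) h σ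
  have h1 : cmean (fun ν => ‖fourier α ν‖ ^ 2 / gOmega α ω ν * specY h σ (r • γ) ν)
      ≤ cmean (fun ν => ‖fourier α ν‖ ^ 2 / gOmega α ω ν * specY h σ γ ν) := by
    refine cmean_mono (by fun_prop (disch := assumption)) (by fun_prop (disch := assumption)) fun ν => ?_
    refine mul_le_mul_of_nonneg_left ?_ (div_nonneg (sq_nonneg _) (hpos ν).le)
    rw [specY, specY, specX_smul hγ hr]
    refine add_le_add_left (mul_le_mul_of_nonneg_left ?_ (sq_nonneg _)) _
    exact mul_le_of_le_one_left (specX_pos hγ ν).le hr1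
  have h2 := mul_le_mul_of_nonneg_left h1 (by positivity : 0 ≤ ω (Fin.last (p + 1)) ^ 2 / 4)
  have h3 : ∑ k : Fin (p + 1), ω k.castSucc * (r • γ) k = r * ∑ k : Fin (p + 1), ω k.castSucc * γ k := by
    rw [Finset.mul_sum]
    exact Finset.sum_congr rfl fun k _ => by rw [Pi.smul_apply, smul_eq_mul]; ring
  rw [dualValue, dualValue, h3, scoreMean_smul hγ hr]
  linarith

/-- The slack in the rate allows the input power to be reduced slightly. -/
theorem exists_scaling (hγ : (toeplitz γ (p + 1)).PosDef) (h : Fin (K + 1) → ℝ) (σ : ℝ)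
    (hpos : ∀ ν, 0 < gOmega α ω ν) {R : ℝ}
    (hR : R < 1 / 2 * Real.log (2 * Real.exp 1 * etaSq γ) - dualValue h α σ γ ω) :
    ∃ r : ℝ, 0 < r ∧ r < 1 ∧
      R < 1 / 2 * Real.log (2 * Real.exp 1 * etaSq (r • γ)) - dualValue h α σ (r • γ) ω := by
  have hη := etaSq_pos hγ
  set B := ω (Fin.last (p + 1)) * scoreMean h α γ - ∑ k : Fin (p + 1), ω k.castSucc * γ k with hB
  have hcont : ContinuousAt (fun r : ℝ => 1 / 2 * Real.log (2 * Real.exp 1 * (r * etaSq γ))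
      - (dualValue h α σ γ ω + (1 - r) * B)) 1 := by
    refine ContinuousAt.sub (continuousAt_const.mul (ContinuousAt.log (by fun_prop) ?_)) (by fun_prop)
    positivity
  have h1 : ∀ᶠ r : ℝ in 𝓝[<] 1, R < 1 / 2 * Real.log (2 * Real.exp 1 * (r * etaSq γ))
      - (dualValue h α σ γ ω + (1 - r) * B) :=
    nhdsWithin_le_nhds (hcont.eventually (lt_mem_nhds (by simpa using hR)))
  have h2 : ∀ᶠ r : ℝ in 𝓝[<] 1, 0 < r := nhdsWithin_le_nhds (lt_mem_nhds one_pos)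
  obtain ⟨r, hr1, hr2, hr3⟩ := (h1.and (h2.and self_mem_nhdsWithin)).exists
  refine ⟨r, hr2, hr3, ?_⟩
  rw [etaSq_smul hγ hr2]
  have := dualValue_smul_le hγ hr2 (le_of_lt hr3) h σ hpos (α := α) (ω := ω)
  linarith

end Scaling

/-! ### From the ensemble to codes and the capacity. -/

section Capacity

variable {K p n : ℕ} {γ : Fin (p + 1) → ℝ}

/-- A random code contains a code that is nearly as good as the average, with codewords in the type
class. -/
theorem exists_code_of_ensemble (h α : Fin (K + 1) → ℝ) (σ : ℝ) {ε : ℝ} (hn : 0 < n)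
    (hvol : volume (typeClass n ε γ) ≠ 0) (M : ℕ) (hfin : ensembleErrorProb h α σ γ ε n M ≠ ⊤)
    {η : ENNReal} (hη : η ≠ 0) :
    ∃ c : Fin M → Fin n → ℝ, (∀ i, c i ∈ typeClass n ε γ) ∧
      errorProb h α σ (fun i => zeroPad (max p K) (c i)) ≤ ensembleErrorProb h α σ γ ε n M + η := by
  by_contra! hcon
  have : IsProbabilityMeasure (ProbabilityTheory.cond volume (typeClass n ε γ)) :=
    cond_isProbabilityMeasure_of_finite hvol (volume_typeClass_ne_top hn ε γ)
  have hae : ∀ᵐ c ∂(Measure.pi fun _ : Fin M => ProbabilityTheory.cond volume (typeClass n ε γ)),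
      ∀ i, c i ∈ typeClass n ε γ := by
    rw [ae_all_iff]
    intro i
    exact (measurePreserving_eval (fun _ : Fin M => ProbabilityTheory.cond volume (typeClass n ε γ))
      i).quasiMeasurePreserving.ae (ae_cond_mem (measurableSet_typeClass n ε γ))
  have h1 : ensembleErrorProb h α σ γ ε n M + η ≤ ensembleErrorProb h α σ γ ε n M := by
    conv_rhs => rw [ensembleErrorProb]
    calc ensembleErrorProb h α σ γ ε n M + η
        = ∫⁻ _, (ensembleErrorProb h α σ γ ε n M + η)
          ∂(Measure.pi fun _ : Fin M => ProbabilityTheory.cond volume (typeClass n ε γ)) := by simp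
      _ ≤ _ := lintegral_mono_ae (hae.mono fun c hc => (hcon c hc).le)
  exact (ENNReal.lt_add_right hfin hη).not_ge h1

theorem sum_zeroPad_sq (L : ℕ) (x : Fin n → ℝ) : ∑ t, zeroPad L x t ^ 2 = ∑ t, x t ^ 2 := by
  unfold zeroPad
  rw [Fin.sum_univ_add]
  simp

theorem average_power_le {N M : ℕ} (hM : 0 < M) {c : Fin M → Fin N → ℝ} {B : ℝ}
    (hc : ∀ i, ∑ t, c i t ^ 2 ≤ B) : ∑ t, (∑ i, c i t ^ 2) / (M : ℝ) ≤ B := by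
  have hM' : (0 : ℝ) < M := by exact_mod_cast hM
  rw [← Finset.sum_div, Finset.sum_comm, div_le_iff₀ hM']
  refine (Finset.sum_le_sum fun i _ => hc i).trans (le_of_eq ?_)
  simp [mul_comm]

/-- Codes whose guard interval is negligible achieve their rate. -/
theorem achievable_of_codes {h α : Fin (K + 1) → ℝ} {P σ R : ℝ} (hP : 0 ≤ P) (L : ℕ) {u : ℕ → ENNReal}
    (hu : Tendsto u atTop (𝓝 0))
    (hcode : ∀ᶠ n : ℕ in atTop, ∃ c : Fin ⌈Real.exp (n * R)⌉₊ → Fin n → ℝ,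
      (∀ i, ∑ t, c i t ^ 2 ≤ n * P) ∧ errorProb h α σ (fun i => zeroPad L (c i)) ≤ u n) :
    Achievable h α P σ R := by
  intro δ hδ
  -- Equivalent to `(n + L) (R - δ) ≤ n R`: the rate lost to the guard interval fits into `δ`.
  have hbig : ∀ᶠ n : ℕ in atTop, L * (R - δ) ≤ n * δ :=
    (tendsto_natCast_atTop_atTop.atTop_mul_const hδ).eventually_ge_atTop _
  obtain ⟨n₀, hn₀⟩ := eventually_atTop.1 (hcode.and hbig)
  have key : ∀ N : ℕ, ∃ (M : ℕ) (c : Fin M → Fin N → ℝ),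
      (1 ≤ N → Real.exp (N * (R - δ)) ≤ M ∧ (∑ t, (∑ i, c i t ^ 2) / (M : ℝ)) ≤ N * P) ∧
      (n₀ + L ≤ N → errorProb h α σ c ≤ u (N - L)) := by
    intro N
    by_cases hN : n₀ + L ≤ N
    · obtain ⟨n, rfl⟩ : ∃ n, N = n + L := ⟨N - L, by omega⟩
      obtain ⟨⟨c, hc1, hc2⟩, hrate⟩ := hn₀ n (by omega)
      refine ⟨_, fun i => zeroPad L (c i), fun _ => ⟨?_, ?_⟩, fun _ => ?_⟩
      · refine le_trans (Real.exp_le_exp.2 ?_) (Nat.le_ceil _)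
        push_cast
        linarith
      · refine (average_power_le (Nat.ceil_pos.2 (Real.exp_pos _)) (B := n * P) fun i => ?_).trans ?_
        · rw [sum_zeroPad_sq]; exact hc1 i
        · refine mul_le_mul_of_nonneg_right ?_ hP
          push_cast
          linarith [(Nat.cast_nonneg L : (0 : ℝ) ≤ L)]
      · rw [Nat.add_sub_cancel]; exact hc2
    -- At the remaining lengths the all-zero code meets the rate and power requirements; its error
    -- probability does not affect the limit.
    · refine ⟨⌈Real.exp (N * (R - δ))⌉₊, fun _ => 0, fun _ => ⟨Nat.le_ceil _, ?_⟩, fun hN' => absurd hN' hN⟩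
      simpa using mul_nonneg (Nat.cast_nonneg N) hP
  choose M c hc1 hc2 using key
  refine ⟨M, c, hc1, ?_⟩
  refine tendsto_of_tendsto_of_tendsto_of_le_of_le' tendsto_const_nhds
    (hu.comp (tendsto_sub_atTop_nat L)) (Eventually.of_forall fun n => zero_le) ?_
  filter_upwards [eventually_ge_atTop (n₀ + L)] with N hN using hc2 N hN

theorem achievable_of_lt_rateI2 (hγ : (toeplitz γ (p + 1)).PosDef) (h α : Fin (K + 1) → ℝ) {σ : ℝ}
    (hσ : 0 < σ) {R : ℝ} (hR : (R : EReal) < rateI2 h α σ γ) : Achievable h α (γ 0) σ R := by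
  obtain ⟨ω, m, hm0, hω, hm, hlt⟩ := exists_dualValue_lt hγ h α σ hR
  obtain ⟨r, hr0, hr1, hlt'⟩ := exists_scaling hγ h σ (fun ν => hm0.trans_le (hm ν)) hlt
  have hγ0 := posDef_zero_pos hγ
  have hγ' := posDef_toeplitz_smul hγ hr0
  obtain ⟨ε₀, hε₀, hens⟩ := ensembleErrorProb_tendsto_of_dualValue hγ' h hσ hm0 hω hm hlt'
  -- The second bound makes every word of the shrunken type class satisfy the original power
  -- constraint individually.
  set ε := min (ε₀ / 2) ((1 - r) * γ 0) with hε
  have hεpos : 0 < ε := lt_min (half_pos hε₀) (mul_pos (by linarith) hγ0)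
  have hεlt : ε < ε₀ := (min_le_left _ _).trans_lt (half_lt_self hε₀)
  have hεle : r * γ 0 + ε ≤ γ 0 := by linarith [min_le_right (ε₀ / 2) ((1 - r) * γ 0)]
  have ht := hens ε hεpos hεlt
  -- The extra `exp (-n)` is the positive slack needed to select one good code from an average.
  refine achievable_of_codes hγ0.le (max p K) (u := fun n => ensembleErrorProb h α σ (r • γ) ε n
    ⌈Real.exp (n * R)⌉₊ + ENNReal.ofReal (Real.exp (-(n * 1)))) ?_ ?_
  · simpa using ht.add (tendsto_ofReal_exp_neg_mul one_pos)
  · filter_upwards [eventually_volume_typeClass_ne_zero hγ' hεpos, eventually_gt_atTop 0,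
      ht.eventually (gt_mem_nhds ENNReal.zero_lt_top)] with n hvol hn hfin
    obtain ⟨c, hc1, hc2⟩ := exists_code_of_ensemble h α σ hn hvol _ hfin.ne
      (ENNReal.ofReal_pos.2 (Real.exp_pos (-(n * 1)))).ne'
    refine ⟨c, fun i => ?_, hc2⟩
    refine (sum_sq_lt_of_mem_typeClass hn (hc1 i)).le.trans
      (mul_le_mul_of_nonneg_left ?_ (Nat.cast_nonneg n))
    simpa using hεle

theorem rateI2_le_mismatchCapacity (hγ : (toeplitz γ (p + 1)).PosDef) (h α : Fin (K + 1) → ℝ) {σ : ℝ}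
    (hσ : 0 < σ) : rateI2 h α σ γ ≤ mismatchCapacity h α (γ 0) σ := by
  refine le_of_forall_lt fun b hb => ?_
  obtain ⟨R, hbR, hR⟩ := EReal.lt_iff_exists_real_btwn.1 hb
  exact hbR.trans_le (le_sSup ⟨R, rfl, achievable_of_lt_rateI2 hγ h α hσ hR⟩)

end Capacity

end ISI

end

theorem theorem2 (K p : ℕ) (h α : Fin (K + 1) → ℝ) (P σ : ℝ) (hσ : 0 < σ) :
    -- the mismatch capacity is at least the supremum of the rates
    (⨆ γ ∈ ISI.admissible p P, ISI.rateI2 h α σ γ) ≤ ISI.mismatchCapacity h α P σ ∧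
    -- the minimization over `𝒲` is a convex problem
    (∀ γ ∈ ISI.admissible p P, Convex ℝ (ISI.dualSet p α) ∧
      ∀ ω ∈ ISI.dualSet p α, ∀ ω' ∈ ISI.dualSet p α, ∀ a b : ℝ, 0 ≤ a → 0 ≤ b → a + b = 1 →
        ISI.objective h α σ γ (a • ω + b • ω') ≤
          (a : EReal) * ISI.objective h α σ γ ω + (b : EReal) * ISI.objective h α σ γ ω') ∧
    -- every smaller rate is attained by the ensemble that is uniform on a type class
    (∀ γ ∈ ISI.admissible p P, ∀ R : ℝ, (R : EReal) < ISI.rateI2 h α σ γ →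
      ∃ ε₀ : ℝ, 0 < ε₀ ∧ ∀ ε : ℝ, 0 < ε → ε < ε₀ →
        (∀ᶠ n : ℕ in Filter.atTop, MeasureTheory.volume (ISI.typeClass n ε γ) ≠ 0) ∧
        Filter.Tendsto
          (fun n : ℕ => ISI.ensembleErrorProb h α σ γ ε n ⌈Real.exp (n * R)⌉₊)
          Filter.atTop (nhds 0)) := by
  refine ⟨?_, ?_, ?_⟩
  · refine iSup₂_le fun γ hγ => ?_
    rw [← hγ.1]
    exact ISI.rateI2_le_mismatchCapacity hγ.2 h α hσ
  · exact fun γ hγ => ⟨ISI.convex_dualSet p α, fun ω hω ω' hω' a b ha hb hab =>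
      ISI.objective_convex hγ.2 h σ hω hω' ha hb hab⟩
  · intro γ hγ R hR
    obtain ⟨ω, m, hm0, hω, hm, hlt⟩ := ISI.exists_dualValue_lt hγ.2 h α σ hR
    obtain ⟨ε₀, hε₀, hens⟩ := ISI.ensembleErrorProb_tendsto_of_dualValue hγ.2 h hσ hm0 hω hm hlt
    exact ⟨ε₀, hε₀, fun ε hε hlt => ⟨ISI.eventually_volume_typeClass_ne_zero hγ.2 hε, hens ε hε hlt⟩⟩
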